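/- Let $n\ge 3$, let $M$ be a smooth $n$-manifold and let $x:M\to\mathbb R^{n+1}$ be a locally strongly convex centroaffine hypersurface, i.e. a smooth immersion whose position vector is everywhere transversal, such that for some $\varepsilon\in\{1,-1\}$ the symmetric form $h$ in the Gauss formula $D_Xx_*Y=x_*(\nabla_XY)-\varepsilon h(X,Y)x$ is positive definite. Let $\hat\nabla$ be the Levi-Civita connection of $h$, $K_XY=K(X,Y)=\nabla_XY-\hat\nabla_XY$ the difference tensor, $T$ the Tchebychev vector field, $h(T,X)=\frac1n\operatorname{Tr}K_X$, and $\|T\|^2=h(T,T)$. Assume that for functions $\alpha,\lambda,\mu$ we have $\hat\nabla_XT=\alpha X$ for all $X$ (so $x$ is a Tchebychev hypersurface), $K_TT=\lambda T$, and, at every point where $T\ne0$, $K_TV=\mu V$ for all $V\in\mathfrak D:=T^{\perp}$. Then every point $p$ with $T(p)\neq0$ has a neighbourhood diffeomorphic to $I\times N$, where $I$ is an open interval with coordinate $t$ and $N$ is a connected open subset of $\mathbb R^{n-1}$, such that $T=\partial/\partial t$, $h=\|T\|^2(dt^2+g')$ with a metric $g'$ on $N$ (so the slices $\{t\}\times N$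 are integral manifolds of $\mathfrak D$), $\alpha,\lambda,\mu$ are smooth functions of $t$ alone, and the following holds. For every choice of the antiderivatives on $I$ in $$\gamma_1(t)=e^{\int(\alpha+\mu)\,dt},\qquad \gamma_2(t)=e^{\int(\alpha+\mu)\,dt}\int e^{\int(\lambda-2\mu-\alpha)\,dt}\,dt$$ (the same $\int(\alpha+\mu)\,dt$ in both), there are a nonzero constant vector $C\in\mathbb R^{n+1}$ and a locally strongly convex affine hypersphere $\varphi:N\to\mathbb R^n$, where $\mathbb R^n$ is identified with an affine hyperplane of $\mathbb R^{n+1}$ by an injective affine map, such that $$x=\gamma_1(t)\,\varphi+\gamma_2(t)\,C\quad\text{on } I\times N .$$ Moreover, for $X,Y\in\mathfrak D$ (vectors tangent to $N$), $$K(X,Y)=\|T\|^{-2}h(X,Y)\,\mu T+K'(X,Y),$$ where $K'$ is the difference tensor of $\varphi$, i.e. the connection induced by the equiaffine (Blaschke) normal of $\varphi$ minus the Levi-Civita connection of its affine metric. Here an affine hypersphere is a hypersurface whose equiaffine shape operator is a constant multiple of the identity. -/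

import Mathlib

open scoped ContDiff Manifold

set_option maxSynthPendingDepth 4

noncomputable section

/-! Hypersurfaces in a coordinate domain: `f : E → F` is an immersion of (an open subset of) the
coordinate space `E` as a hypersurface of the affine space `F`, and `ξ : E → F` is a transversal
vector field along `f`.  All tensors are given by their components in the coordinates, as
(multi)linear maps of `E`. -/

section Relative

variable {E F : Type*} [NormedAddCommGroup E] [NormedSpace ℝ E]
  [NormedAddCommGroup F] [NormedSpace ℝ F]

/-- `(v, s) ↦ f_* v + s ξ`, the splitting of `F` at `p` into tangential and transversal part. -/
def frame (f ξ : E → F) (p : E) : E × ℝ →L[ℝ] F :=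
  (fderiv ℝ f p).coprod ((ContinuousLinearMap.id ℝ ℝ).smulRight (ξ p))

/-- At `p`, `f` is an immersion, `ξ` is transversal to `f`, and both together span `F`. -/
def IsTransversalAt (f ξ : E → F) (p : E) : Prop :=
  Function.Bijective (frame f ξ p)

/-- The induced connection `∇` (its Christoffel symbols): the tangential part of the second
derivative in the Gauss formula `D_v f_* w = f_* (∇_v w) + h(v, w) ξ`. -/
def inducedConn (f ξ : E → F) (p : E) : E →L[ℝ] E →L[ℝ] E :=
  (ContinuousLinearMap.compL ℝ E F E
    ((ContinuousLinearMap.fst ℝ E ℝ).comp (frame f ξ p).inverse)).comp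
    (fderiv ℝ (fderiv ℝ f) p)

/-- The induced metric `h`: the transversal part of the second derivative in the Gauss formula
`D_v f_* w = f_* (∇_v w) + h(v, w) ξ`. -/
def inducedMetric (f ξ : E → F) (p : E) : E →L[ℝ] E →L[ℝ] ℝ :=
  (ContinuousLinearMap.compL ℝ E F ℝ
    ((ContinuousLinearMap.snd ℝ E ℝ).comp (frame f ξ p).inverse)).comp
    (fderiv ℝ (fderiv ℝ f) p)

/-- The Christoffel symbols of the first kind of a metric `g`:
`(v, w, z) ↦ (∂_v g(w, z) + ∂_w g(v, z) - ∂_z g(v, w)) / 2`. -/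
def christoffelFirst (g : E → E →L[ℝ] E →L[ℝ] ℝ) (p : E) : E →L[ℝ] E →L[ℝ] E →L[ℝ] ℝ :=
  (1 / 2 : ℝ) • (fderiv ℝ g p + (fderiv ℝ g p).flip -
    (ContinuousLinearMap.flipₗᵢ ℝ E E ℝ).toContinuousLinearEquiv.toContinuousLinearMap.comp
      (fderiv ℝ g p).flip)

/-- The Levi-Civita connection of a metric `g` (its Christoffel symbols `Γ`, with
`∇̂_v W = D_v W + Γ(v, W)`): the first index of `christoffelFirst` is raised by `g`. -/
def leviCivita (g : E → E →L[ℝ] E →L[ℝ] ℝ) (p : E) : E →L[ℝ] E →L[ℝ] E :=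
  (ContinuousLinearMap.compL ℝ E (E →L[ℝ] ℝ) E (g p).inverse).comp (christoffelFirst g p)

/-- The difference tensor `K(v, w) = ∇_v w - ∇̂_v w` of the induced connection and the Levi-Civita
connection of the induced metric. -/
def diffTensor (f ξ : E → F) (p : E) : E →L[ℝ] E →L[ℝ] E :=
  inducedConn f ξ p - leviCivita (inducedMetric f ξ) p

theorem christoffelFirst_apply (g : E → E →L[ℝ] E →L[ℝ] ℝ) (p v w z : E) :
    christoffelFirst g p v w z =
      1 / 2 * (fderiv ℝ g p v w z + fderiv ℝ g p w v z - fderiv ℝ g p z v w) := by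
  simp [christoffelFirst]

end Relative

/-! The centroaffine normalization, `ξ = -ε f`. -/

section Centroaffine

variable {E F : Type*} [NormedAddCommGroup E] [NormedSpace ℝ E]
  [NormedAddCommGroup F] [NormedSpace ℝ F]

/-- The centroaffine normal `-ε f`. -/
def caNormal (ε : ℝ) (f : E → F) (p : E) : F := -(ε • f p)

/-- The centroaffine metric `h`. -/
def caMetric (ε : ℝ) (f : E → F) : E → E →L[ℝ] E →L[ℝ] ℝ := inducedMetric f (caNormal ε f)

/-- The centroaffine difference tensor `K`. -/
def caDiff (ε : ℝ) (f : E → F) : E → E →L[ℝ] E →L[ℝ] E := diffTensor f (caNormal ε f)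

/-- The Tchebychev form `v ↦ (1 / n) Tr K_v`, where `n = dim E`. -/
def tchebForm [FiniteDimensional ℝ E] (ε : ℝ) (f : E → F) (p : E) : E →L[ℝ] ℝ :=
  (1 / (Module.finrank ℝ E : ℝ)) • LinearMap.toContinuousLinearMap
    ((LinearMap.trace ℝ E).comp
      ((ContinuousLinearMap.coeLM ℝ).comp (caDiff ε f p).toLinearMap))

/-- The Tchebychev vector field `T`, with `h(T, v) = (1 / n) Tr K_v`. -/
def tchebField [FiniteDimensional ℝ E] (ε : ℝ) (f : E → F) (p : E) : E :=
  (caMetric ε f p).inverse (tchebForm ε f p)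

/-- The squared norm `‖T‖² = h(T, T)`. -/
def tchebNormSq [FiniteDimensional ℝ E] (ε : ℝ) (f : E → F) (p : E) : ℝ :=
  caMetric ε f p (tchebField ε f p) (tchebField ε f p)

/-- The Tchebychev operator (centroaffine shape operator) `v ↦ ∇̂_v T`. -/
def tchebOperator [FiniteDimensional ℝ E] (ε : ℝ) (f : E → F) (p : E) : E →L[ℝ] E :=
  fderiv ℝ (tchebField ε f) p + (leviCivita (caMetric ε f) p).flip (tchebField ε f p)

end Centroaffine

/-! Centroaffine hypersurfaces `x : M → F` of a manifold `M` modelled on `E`.  A property of the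
tensors of `x` holds if it holds for the components in every chart `e` of `M`, that is, for the
hypersurface `x ∘ e.symm` on the coordinate domain `e.target`. -/

section Manifold

variable (E : Type*) {F : Type*} [NormedAddCommGroup E] [NormedSpace ℝ E]
  [NormedAddCommGroup F] [NormedSpace ℝ F]
  {M : Type*} [TopologicalSpace M] [ChartedSpace E M]

/-- `x` is a smooth centroaffine hypersurface (an immersion with transversal position vector), it is
locally strongly convex, and the sign `ε` is chosen such that its centroaffine metric is positive
definite. -/
structure IsConvexCentroaffine (ε : ℝ) (x : M → F) : Prop where
  sign : ε = 1 ∨ ε = -1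
  smooth : ContMDiff 𝓘(ℝ, E) 𝓘(ℝ, F) ∞ x
  transversal : ∀ e ∈ atlas E M, ∀ y ∈ e.target, IsTransversalAt (x ∘ e.symm) (x ∘ e.symm) y
  posDef : ∀ e ∈ atlas E M, ∀ y ∈ e.target, ∀ v : E, v ≠ 0 → 0 < caMetric ε (x ∘ e.symm) y v v

variable [FiniteDimensional ℝ E]

/-- `𝒯 = α id`: the Tchebychev operator is the multiple `α` of the identity. -/
def TchebOperatorEq (ε : ℝ) (x : M → F) (α : M → ℝ) : Prop :=
  ∀ e ∈ atlas E M, ∀ y ∈ e.target,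
    tchebOperator ε (x ∘ e.symm) y = α (e.symm y) • ContinuousLinearMap.id ℝ E

/-- `K_T T = lam T`. -/
def DiffTTEq (ε : ℝ) (x : M → F) (lam : M → ℝ) : Prop :=
  ∀ e ∈ atlas E M, ∀ y ∈ e.target,
    caDiff ε (x ∘ e.symm) y (tchebField ε (x ∘ e.symm) y) (tchebField ε (x ∘ e.symm) y) =
      lam (e.symm y) • tchebField ε (x ∘ e.symm) y

/-- `K_T V = μ V` for all `V` orthogonal to `T`, at all points where `T ≠ 0`. -/
def DiffTPerpEq (ε : ℝ) (x : M → F) (μ : M → ℝ) : Prop :=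
  ∀ e ∈ atlas E M, ∀ y ∈ e.target, tchebField ε (x ∘ e.symm) y ≠ 0 →
    ∀ v : E, caMetric ε (x ∘ e.symm) y v (tchebField ε (x ∘ e.symm) y) = 0 →
      caDiff ε (x ∘ e.symm) y (tchebField ε (x ∘ e.symm) y) v = μ (e.symm y) • v

/-- `T ≠ 0` at the point `p` of `M`. -/
def TchebNeZeroAt (ε : ℝ) (x : M → F) (p : M) : Prop :=
  tchebField ε (x ∘ (chartAt E p).symm) (chartAt E p p) ≠ 0

end Manifold

/-! Equiaffine (Blaschke) hypersurfaces `φ : N → ℝ^(m+1)`, for an open set `N` of `ℝ^m`. -/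

section Equiaffine

variable {m : ℕ}

/-- The square of the determinant of `φ_* e_1, …, φ_* e_m, ξ`, the volume that `ξ` induces. -/
def inducedVolSq (φ ξ : EuclideanSpace ℝ (Fin m) → EuclideanSpace ℝ (Fin (m + 1)))
    (u : EuclideanSpace ℝ (Fin m)) : ℝ :=
  (Matrix.of fun i j : Fin (m + 1) =>
    (Fin.snoc (α := fun _ => EuclideanSpace ℝ (Fin (m + 1)))
      (fun k : Fin m => fderiv ℝ φ u (EuclideanSpace.single k 1)) (ξ u) i) j).det ^ 2

/-- The square `det (g(e_i, e_j))` of the Riemannian volume of a metric `g`. -/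
def metricVolSq (g : EuclideanSpace ℝ (Fin m) →L[ℝ] EuclideanSpace ℝ (Fin m) →L[ℝ] ℝ) : ℝ :=
  (Matrix.of fun i j : Fin m => g (EuclideanSpace.single i 1) (EuclideanSpace.single j 1)).det

/-- `φ` is a smooth locally strongly convex hypersurface on `N`, and `ξ` is its affine (Blaschke)
normal field: `ξ` is transversal, the affine metric is positive definite, the derivatives of `ξ` are
tangential, and the volume induced by `ξ` is the volume of the affine metric. -/
structure IsAffineNormal (N : Set (EuclideanSpace ℝ (Fin m)))
    (φ ξ : EuclideanSpace ℝ (Fin m) → EuclideanSpace ℝ (Fin (m + 1))) : Prop where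
  smooth : ContDiffOn ℝ ∞ φ N
  smooth_normal : ContDiffOn ℝ ∞ ξ N
  transversal : ∀ u ∈ N, IsTransversalAt φ ξ u
  posDef : ∀ u ∈ N, ∀ v : EuclideanSpace ℝ (Fin m), v ≠ 0 → 0 < inducedMetric φ ξ u v v
  equiaffine : ∀ u ∈ N, ∀ v : EuclideanSpace ℝ (Fin m),
    fderiv ℝ ξ u v ∈ Set.range (fderiv ℝ φ u)
  volume : ∀ u ∈ N, inducedVolSq φ ξ u = metricVolSq (inducedMetric φ ξ u)

/-- `φ` is a locally strongly convex affine hypersphere on `N` with affine normal `ξ`: its affine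
shape operator `S`, given by `D_v ξ = -φ_* (S v)`, is a constant multiple of the identity. -/
def IsAffineHypersphere (N : Set (EuclideanSpace ℝ (Fin m)))
    (φ ξ : EuclideanSpace ℝ (Fin m) → EuclideanSpace ℝ (Fin (m + 1))) : Prop :=
  IsAffineNormal N φ ξ ∧
    ∃ H : ℝ, ∀ u ∈ N, ∀ v : EuclideanSpace ℝ (Fin m), fderiv ℝ ξ u v = -fderiv ℝ φ u (H • v)

end Equiaffine

/-! Local product coordinates `(t, u)` around a point. -/

section Product

variable {F : Type*} [NormedAddCommGroup F] [NormedSpace ℝ F] {m : ℕ}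
  {M : Type*} [TopologicalSpace M] [ChartedSpace (EuclideanSpace ℝ (Fin (m + 1))) M]

/-- `ψ = (t, u)` are smooth coordinates of `M` with range `(t₀, t₁) × N`, where `N` is open and
connected, in which `T = ∂/∂t` and `h = ‖T‖² (dt² + g')` for a metric `g'` on `N`. In particular the
slices `t = const` are orthogonal to `T`. -/
structure IsTchebProduct (ε : ℝ) (x : M → F)
    (ψ : OpenPartialHomeomorph M (ℝ × EuclideanSpace ℝ (Fin m))) (t₀ t₁ : ℝ)
    (N : Set (EuclideanSpace ℝ (Fin m)))
    (g' : EuclideanSpace ℝ (Fin m) →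
      EuclideanSpace ℝ (Fin m) →L[ℝ] EuclideanSpace ℝ (Fin m) →L[ℝ] ℝ) : Prop where
  smooth : ContMDiffOn 𝓘(ℝ, EuclideanSpace ℝ (Fin (m + 1)))
    𝓘(ℝ, ℝ × EuclideanSpace ℝ (Fin m)) ∞ ψ ψ.source
  smooth_symm : ContMDiffOn 𝓘(ℝ, ℝ × EuclideanSpace ℝ (Fin m))
    𝓘(ℝ, EuclideanSpace ℝ (Fin (m + 1))) ∞ ψ.symm ψ.target
  isOpen : IsOpen N
  isConnected : IsConnected N
  target_eq : ψ.target = Set.Ioo t₀ t₁ ×ˢ N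
  field_eq : ∀ q ∈ ψ.target, tchebField ε (x ∘ ψ.symm) q = (1, 0)
  metric_eq : ∀ q ∈ ψ.target, ∀ (s s' : ℝ) (v v' : EuclideanSpace ℝ (Fin m)),
    caMetric ε (x ∘ ψ.symm) q (s, v) (s', v') =
      tchebNormSq ε (x ∘ ψ.symm) q * (s * s' + g' q.2 v v')

end Product

end

set_option linter.unusedSectionVars false

noncomputable section



/-! ### Relative hypersurfaces: Gauss formula, smoothness, and the Levi-Civita connection in
coordinates. -/

section RelativeBasics

variable {E F : Type*} [NormedAddCommGroup E] [NormedSpace ℝ E] [CompleteSpace E]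
  [NormedAddCommGroup F] [NormedSpace ℝ F] [CompleteSpace F]

/-! Write `θ = h(T, ·) / ‖T‖²` and `Z = x_* T`. The Gauss formula and the hypotheses on `T` and `K`
turn the problem into a closed linear system along `x`, namely `dZ = (α + μ) dx + θ ((λ - μ) Z - ε
‖T‖² x)` (`fderiv_push`). Total symmetry of the cubic form gives the same system for the conormal
map, with the signs of `λ` and `μ` reversed (`fderiv_copush`). Since `n ≥ 3`, the symmetry of second
derivatives forces the differentials of `α ± μ` and of `λ - μ` to be multiples of `θ`
(`integrability_of_fderiv_eq`). The form `θ` is closed, so `θ = dt` locally and `α`, `λ`, `μ`,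
`‖T‖²` depend on `t` only.

The two derivative formulas for `α ± μ` also show that the vector `Z - (α + μ) x` and its conormal
counterpart satisfy `dw = ±(λ - μ) θ w`, so each has constant direction (`fderiv_axis`,
`fderiv_coaxis`). The vector gives the axis `C`. The covector gives the direction of the hyperplane
that contains the base hypersurface. Projecting along the axis also yields coordinates that are
constant along `T` (`exists_product_coordinates`).

In these coordinates `W = e^{-A} x - Y C` and `η = e^{-A} ((μ - α) Z - ε ‖T‖² x)` do not depend on
`t` (`fderiv_slice`, `fderiv_normal`). The first is the hypersurface `φ`. The second is a
transversal field with `dη = const · dφ`, whose induced metric is `h / ‖T‖²` on the slices. The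
difference tensor of `φ` is the slice part of `K`, which is trace-free because `Tr K_V = n h(T, V) =
0` for `V` orthogonal to `T` (`trace_diff_base`). Apolarity makes the two volumes proportional, so a
constant multiple of `η` is the affine normal (`exists_isAffineNormal`). -/

theorem frame_apply (f ξ : E → F) (p v : E) (s : ℝ) :
    frame f ξ p (v, s) = fderiv ℝ f p v + s • ξ p := by
  simp [frame]

theorem isInvertible_of_bijective {V W : Type*} [NormedAddCommGroup V] [NormedSpace ℝ V]
    [CompleteSpace V] [NormedAddCommGroup W] [NormedSpace ℝ W] [CompleteSpace W]
    {A : V →L[ℝ] W} (hA : Function.Bijective A) : A.IsInvertible :=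
  ⟨ContinuousLinearEquiv.ofBijective A (LinearMap.ker_eq_bot.2 hA.1)
    (LinearMap.range_eq_top.2 hA.2), by ext; simp⟩

theorem IsTransversalAt.isInvertible {f ξ : E → F} {p : E} (h : IsTransversalAt f ξ p) :
    (frame f ξ p).IsInvertible :=
  isInvertible_of_bijective h

/-- The Gauss formula. -/
theorem gauss_formula {f ξ : E → F} {p : E} (h : IsTransversalAt f ξ p) (v w : E) :
    fderiv ℝ (fderiv ℝ f) p v w =
      fderiv ℝ f p (inducedConn f ξ p v w) + inducedMetric f ξ p v w • ξ p := by
  rw [← frame_apply]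
  have : (inducedConn f ξ p v w, inducedMetric f ξ p v w) =
      (frame f ξ p).inverse (fderiv ℝ (fderiv ℝ f) p v w) := by
    simp [inducedConn, inducedMetric]
  rw [this, h.isInvertible.self_apply_inverse]

theorem IsTransversalAt.eq_of_add_smul_eq {f ξ : E → F} {p : E} (h : IsTransversalAt f ξ p)
    {v w : E} {s r : ℝ}
    (hvw : fderiv ℝ f p v + s • ξ p = fderiv ℝ f p w + r • ξ p) : v = w ∧ s = r := by
  rw [← frame_apply, ← frame_apply] at hvw
  simpa using h.1 hvw

/-- Uniqueness of the splitting in the Gauss formula. Every later computation of an induced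
connection or metric goes through this. -/
theorem induced_eq_of_gauss {f ξ : E → F} {p : E} (h : IsTransversalAt f ξ p) {v w a : E} {c : ℝ}
    (hac : fderiv ℝ (fderiv ℝ f) p v w = fderiv ℝ f p a + c • ξ p) :
    inducedConn f ξ p v w = a ∧ inducedMetric f ξ p v w = c :=
  h.eq_of_add_smul_eq ((gauss_formula h v w).symm.trans hac)

theorem fderiv_fderiv_comm {f : E → F} {p : E} (hf : ContDiffAt ℝ ∞ f p) (v w : E) :
    fderiv ℝ (fderiv ℝ f) p v w = fderiv ℝ (fderiv ℝ f) p w v :=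
  hf.isSymmSndFDerivAt (by simpa using WithTop.coe_le_coe.2 (le_top (a := (2 : ℕ∞)))) v w

theorem induced_symm {f ξ : E → F} {p : E} (h : IsTransversalAt f ξ p) (hf : ContDiffAt ℝ ∞ f p)
    (v w : E) : inducedConn f ξ p v w = inducedConn f ξ p w v ∧
      inducedMetric f ξ p v w = inducedMetric f ξ p w v :=
  induced_eq_of_gauss h ((fderiv_fderiv_comm hf v w).trans (gauss_formula h w v))

theorem contDiffAt_fderiv {f : E → F} {p : E} (hf : ContDiffAt ℝ ∞ f p) :
    ContDiffAt ℝ ∞ (fderiv ℝ f) p :=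
  hf.fderiv_right (by simp)

theorem contDiffAt_inverse {V W : Type*} [NormedAddCommGroup V] [NormedSpace ℝ V]
    [CompleteSpace V] [NormedAddCommGroup W] [NormedSpace ℝ W]
    {A : E → V →L[ℝ] W} {p : E} (hA : ContDiffAt ℝ ∞ A p) (hi : (A p).IsInvertible) :
    ContDiffAt ℝ ∞ (fun q => (A q).inverse) p :=
  hi.contDiffAt_map_inverse.comp p hA

theorem contDiffAt_frame {f ξ : E → F} {p : E} (hf : ContDiffAt ℝ ∞ f p)
    (hξ : ContDiffAt ℝ ∞ ξ p) : ContDiffAt ℝ ∞ (frame f ξ) p := by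
  have h1 : ContDiffAt ℝ ∞ (fun q => (fderiv ℝ f q).comp (ContinuousLinearMap.fst ℝ E ℝ)) p :=
    (contDiffAt_fderiv hf).clm_comp contDiffAt_const
  have h2 : ContDiffAt ℝ ∞
      (fun q => (ContinuousLinearMap.snd ℝ E ℝ).smulRight (ξ q)) p :=
    contDiffAt_const.smulRight hξ
  refine (h1.add h2).congr_of_eventuallyEq (Filter.Eventually.of_forall fun q => ?_)
  ext <;> simp [frame]

theorem contDiffAt_induced {f ξ : E → F} {p : E} (h : IsTransversalAt f ξ p)
    (hf : ContDiffAt ℝ ∞ f p) (hξ : ContDiffAt ℝ ∞ ξ p) :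
    ContDiffAt ℝ ∞ (inducedConn f ξ) p ∧ ContDiffAt ℝ ∞ (inducedMetric f ξ) p := by
  have hi := contDiffAt_inverse (contDiffAt_frame hf hξ) h.isInvertible
  have h2 := contDiffAt_fderiv (contDiffAt_fderiv hf)
  constructor
  · exact ((ContinuousLinearMap.compL ℝ E F E).contDiff.contDiffAt.comp p
      (contDiffAt_const.clm_comp hi)).clm_comp h2
  · exact ((ContinuousLinearMap.compL ℝ E F ℝ).contDiff.contDiffAt.comp p
      (contDiffAt_const.clm_comp hi)).clm_comp h2

theorem isInvertible_of_posDef [FiniteDimensional ℝ E] {g : E →L[ℝ] E →L[ℝ] ℝ}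
    (hg : ∀ v, v ≠ 0 → 0 < g v v) : g.IsInvertible := by
  have hinj : Function.Injective g.toLinearMap := by
    rw [← LinearMap.ker_eq_bot, LinearMap.ker_eq_bot']
    intro v hv
    by_contra hne
    have := hg v hne
    have h0 : g v = 0 := hv
    simp [h0] at this
  have hfin : Module.finrank ℝ E = Module.finrank ℝ (E →L[ℝ] ℝ) := by
    rw [← (LinearMap.toContinuousLinearMap (𝕜 := ℝ) (E := E) (F' := ℝ)).finrank_eq]
    exact (Subspace.dual_finrank_eq (K := ℝ) (V := E)).symm
  exact isInvertible_of_bijective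
    ⟨hinj, (LinearMap.injective_iff_surjective_of_finrank_eq_finrank hfin).1 hinj⟩

theorem leviCivita_apply {g : E → E →L[ℝ] E →L[ℝ] ℝ} {p : E} (hg : (g p).IsInvertible)
    (v w z : E) : g p (leviCivita g p v w) z = christoffelFirst g p v w z := by
  have : leviCivita g p v w = (g p).inverse (christoffelFirst g p v w) := by
    simp [leviCivita]
  rw [this, hg.self_apply_inverse]

theorem leviCivita_eq_of {g : E → E →L[ℝ] E →L[ℝ] ℝ} {p : E} (hg : (g p).IsInvertible)
    {v w a : E} (h : ∀ z, g p a z = christoffelFirst g p v w z) : leviCivita g p v w = a := by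
  apply hg.injective
  ext z
  rw [leviCivita_apply hg, h]

theorem contDiffAt_leviCivita {g : E → E →L[ℝ] E →L[ℝ] ℝ} {p : E} (hg : ContDiffAt ℝ ∞ g p)
    (hi : (g p).IsInvertible) : ContDiffAt ℝ ∞ (leviCivita g) p := by
  have h1 := contDiffAt_fderiv hg
  have h2 : ContDiffAt ℝ ∞ (fun q => (fderiv ℝ g q).flip) p :=
    (ContinuousLinearMap.flipₗᵢ ℝ E E (E →L[ℝ] ℝ)).toContinuousLinearEquiv.contDiff.contDiffAt.comp
      p h1
  have h3 : ContDiffAt ℝ ∞ (christoffelFirst g) p :=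
    (contDiffAt_const (c := (1 / 2 : ℝ))).smul
      ((h1.add h2).sub (contDiffAt_const.clm_comp h2))
  exact ((ContinuousLinearMap.compL ℝ E (E →L[ℝ] ℝ) E).contDiff.contDiffAt.comp p
      (contDiffAt_inverse hg hi)).clm_comp h3

theorem fderiv_clm_apply₂ {V W G X : Type*} [NormedAddCommGroup V] [NormedSpace ℝ V]
    [NormedAddCommGroup W] [NormedSpace ℝ W] [NormedAddCommGroup G] [NormedSpace ℝ G]
    [NormedAddCommGroup X] [NormedSpace ℝ X]
    {g : X → V →L[ℝ] W →L[ℝ] G} {a : X → V} {b : X → W} {p : X} (hg : DifferentiableAt ℝ g p)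
    (ha : DifferentiableAt ℝ a p) (hb : DifferentiableAt ℝ b p) (y : X) :
    fderiv ℝ (fun q => g q (a q) (b q)) p y =
      fderiv ℝ g p y (a p) (b p) + g p (fderiv ℝ a p y) (b p) + g p (a p) (fderiv ℝ b p y) := by
  have := ((hg.hasFDerivAt.clm_apply ha.hasFDerivAt).clm_apply hb.hasFDerivAt).fderiv
  rw [this]
  simp
  abel

theorem fderiv_metric_symm {g : E → E →L[ℝ] E →L[ℝ] ℝ} {p : E} (hg : DifferentiableAt ℝ g p)
    (hs : ∀ᶠ q in nhds p, ∀ v w, g q v w = g q w v) (y v w : E) :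
    fderiv ℝ g p y v w = fderiv ℝ g p y w v := by
  have h1 := fderiv_clm_apply₂ hg (differentiableAt_const v) (differentiableAt_const w) y
  have h2 := fderiv_clm_apply₂ hg (differentiableAt_const w) (differentiableAt_const v) y
  have h3 : (fun q => g q v w) =ᶠ[nhds p] fun q => g q w v := hs.mono fun q hq => hq v w
  rw [h3.fderiv_eq, h2] at h1
  simpa using h1.symm

/-- The Levi-Civita connection is metric. -/
theorem fderiv_metric_eq {g : E → E →L[ℝ] E →L[ℝ] ℝ} {p : E} (hg : DifferentiableAt ℝ g p)
    (hi : (g p).IsInvertible) (hs : ∀ᶠ q in nhds p, ∀ v w, g q v w = g q w v) (y v w : E) :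
    fderiv ℝ g p y v w = g p (leviCivita g p y v) w + g p v (leviCivita g p y w) := by
  rw [hs.self_of_nhds v, leviCivita_apply hi, leviCivita_apply hi, christoffelFirst_apply,
    christoffelFirst_apply, fderiv_metric_symm hg hs y w v, fderiv_metric_symm hg hs v y w,
    fderiv_metric_symm hg hs w y v]
  ring

theorem leviCivita_symm {g : E → E →L[ℝ] E →L[ℝ] ℝ} {p : E} (hg : DifferentiableAt ℝ g p)
    (hi : (g p).IsInvertible) (hs : ∀ᶠ q in nhds p, ∀ v w, g q v w = g q w v) (v w : E) :
    leviCivita g p v w = leviCivita g p w v := by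
  refine leviCivita_eq_of hi fun z => ?_
  rw [leviCivita_apply hi, christoffelFirst_apply, christoffelFirst_apply,
    fderiv_metric_symm hg hs z v w]
  ring

end RelativeBasics



/-! ### Centroaffine hypersurfaces: the conormal map, the Codazzi equation, smoothness of the
tensors. -/

/-- `f` is a locally strongly convex centroaffine hypersurface on the coordinate domain `U`, with
positive definite centroaffine metric for the sign `ε`. -/
structure IsCaDomain {E F : Type*} [NormedAddCommGroup E] [NormedSpace ℝ E]
    [NormedAddCommGroup F] [NormedSpace ℝ F] (ε : ℝ) (f : E → F) (U : Set E) : Prop where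
  sign : ε = 1 ∨ ε = -1
  isOpen : IsOpen U
  smooth : ContDiffOn ℝ ∞ f U
  transversal : ∀ q ∈ U, IsTransversalAt f f q
  posDef : ∀ q ∈ U, ∀ v : E, v ≠ 0 → 0 < caMetric ε f q v v

/-- The conormal map of a centroaffine hypersurface: `1` on the centroaffine normal, `0` on tangent
vectors. -/
def caConormal {E F : Type*} [NormedAddCommGroup E] [NormedSpace ℝ E]
    [NormedAddCommGroup F] [NormedSpace ℝ F] (ε : ℝ) (f : E → F) (q : E) : F →L[ℝ] ℝ :=
  (ContinuousLinearMap.snd ℝ E ℝ).comp (frame f (caNormal ε f) q).inverse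

namespace IsCaDomain

variable {E F : Type*} [NormedAddCommGroup E] [NormedSpace ℝ E] [CompleteSpace E]
  [FiniteDimensional ℝ E] [NormedAddCommGroup F] [NormedSpace ℝ F] [CompleteSpace F]
  {ε : ℝ} {f : E → F} {U : Set E} {q : E}

theorem sign_mul_self (h : IsCaDomain ε f U) : ε * ε = 1 := by
  rcases h.sign with rfl | rfl <;> norm_num

theorem eventually_mem (h : IsCaDomain ε f U) (hq : q ∈ U) : ∀ᶠ p in nhds q, p ∈ U :=
  h.isOpen.mem_nhds hq

theorem contDiffAt (h : IsCaDomain ε f U) (hq : q ∈ U) : ContDiffAt ℝ ∞ f q :=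
  h.smooth.contDiffAt (h.isOpen.mem_nhds hq)

theorem contDiffAt_normal (h : IsCaDomain ε f U) (hq : q ∈ U) :
    ContDiffAt ℝ ∞ (caNormal ε f) q :=
  ((contDiffAt_const (c := ε)).smul (h.contDiffAt hq)).neg

theorem transversal_normal (h : IsCaDomain ε f U) (hq : q ∈ U) :
    IsTransversalAt f (caNormal ε f) q := by
  -- The frames of `f` and of `-ε f` differ by this map, an involution because `ε² = 1`.
  have hb : Function.Bijective fun x : E × ℝ => (x.1, -(ε * x.2)) := by
    refine Function.bijective_iff_has_inverse.2 ⟨fun x => (x.1, -(ε * x.2)), ?_, ?_⟩ <;>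
    · rintro ⟨v, s⟩
      simp only [mul_neg, neg_neg, Prod.mk.injEq, true_and]
      linear_combination s * h.sign_mul_self
  have := (h.transversal q hq).comp hb
  refine (congrArg Function.Bijective (funext ?_)).mp this
  rintro ⟨v, s⟩
  simp only [Function.comp, frame_apply, caNormal]
  module

theorem contDiffAt_metric (h : IsCaDomain ε f U) (hq : q ∈ U) :
    ContDiffAt ℝ ∞ (caMetric ε f) q :=
  (contDiffAt_induced (h.transversal_normal hq) (h.contDiffAt hq) (h.contDiffAt_normal hq)).2

theorem isInvertible_metric (h : IsCaDomain ε f U) (hq : q ∈ U) :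
    (caMetric ε f q).IsInvertible :=
  isInvertible_of_posDef (h.posDef q hq)

theorem metric_symm (h : IsCaDomain ε f U) (hq : q ∈ U) (v w : E) :
    caMetric ε f q v w = caMetric ε f q w v :=
  (induced_symm (h.transversal_normal hq) (h.contDiffAt hq) v w).2

theorem eventually_metric_symm (h : IsCaDomain ε f U) (hq : q ∈ U) :
    ∀ᶠ p in nhds q, ∀ v w, caMetric ε f p v w = caMetric ε f p w v :=
  (h.eventually_mem hq).mono fun _ hp => h.metric_symm hp

theorem fderiv_metric (h : IsCaDomain ε f U) (hq : q ∈ U) (y v w : E) :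
    fderiv ℝ (caMetric ε f) q y v w = caMetric ε f q (leviCivita (caMetric ε f) q y v) w +
      caMetric ε f q v (leviCivita (caMetric ε f) q y w) :=
  fderiv_metric_eq ((h.contDiffAt_metric hq).differentiableAt (by simp)) (h.isInvertible_metric hq)
    (h.eventually_metric_symm hq) y v w

theorem leviCivita_symm (h : IsCaDomain ε f U) (hq : q ∈ U) (v w : E) :
    leviCivita (caMetric ε f) q v w = leviCivita (caMetric ε f) q w v :=
  _root_.leviCivita_symm ((h.contDiffAt_metric hq).differentiableAt (by simp))
    (h.isInvertible_metric hq) (h.eventually_metric_symm hq) v w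

theorem gauss (h : IsCaDomain ε f U) (hq : q ∈ U) (v w : E) :
    fderiv ℝ (fderiv ℝ f) q v w = fderiv ℝ f q (leviCivita (caMetric ε f) q v w +
      caDiff ε f q v w) - (ε * caMetric ε f q v w) • f q := by
  have h1 := gauss_formula (h.transversal_normal hq) v w
  have h2 : inducedConn f (caNormal ε f) q v w = leviCivita (caMetric ε f) q v w +
      caDiff ε f q v w := by
    simp [caDiff, diffTensor, caMetric]
  rw [h1, h2, caMetric, caNormal]
  module

theorem diff_symm (h : IsCaDomain ε f U) (hq : q ∈ U) (v w : E) :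
    caDiff ε f q v w = caDiff ε f q w v := by
  have h1 := (induced_symm (h.transversal_normal hq) (h.contDiffAt hq) v w).1
  have h2 := h.leviCivita_symm hq v w
  rw [caMetric] at h2
  simp [caDiff, diffTensor, h1, h2]

theorem contDiffAt_leviCivita (h : IsCaDomain ε f U) (hq : q ∈ U) :
    ContDiffAt ℝ ∞ (leviCivita (caMetric ε f)) q :=
  _root_.contDiffAt_leviCivita (h.contDiffAt_metric hq) (h.isInvertible_metric hq)

theorem contDiffAt_diff (h : IsCaDomain ε f U) (hq : q ∈ U) :
    ContDiffAt ℝ ∞ (caDiff ε f) q :=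
  (contDiffAt_induced (h.transversal_normal hq) (h.contDiffAt hq) (h.contDiffAt_normal hq)).1.sub
    (h.contDiffAt_leviCivita hq)

theorem contDiffAt_conormal (h : IsCaDomain ε f U) (hq : q ∈ U) :
    ContDiffAt ℝ ∞ (caConormal ε f) q :=
  contDiffAt_const.clm_comp (contDiffAt_inverse
    (contDiffAt_frame (h.contDiffAt hq) (h.contDiffAt_normal hq))
    (h.transversal_normal hq).isInvertible)

theorem conormal_add (h : IsCaDomain ε f U) (hq : q ∈ U) (v : E) (s : ℝ) :
    caConormal ε f q (fderiv ℝ f q v + s • f q) = -(ε * s) := by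
  have h1 : fderiv ℝ f q v + s • f q = frame f (caNormal ε f) q (v, -(ε * s)) := by
    rw [frame_apply, caNormal]
    match_scalars
    · simp
    · linear_combination -s * h.sign_mul_self
  rw [h1]
  simp [caConormal, (h.transversal_normal hq).isInvertible.inverse_apply_self]

theorem conormal_tangent (h : IsCaDomain ε f U) (hq : q ∈ U) (v : E) :
    caConormal ε f q (fderiv ℝ f q v) = 0 := by
  simpa using h.conormal_add hq v 0

theorem conormal_self (h : IsCaDomain ε f U) (hq : q ∈ U) : caConormal ε f q (f q) = -ε := by
  simpa using h.conormal_add hq 0 1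

theorem conormal_snd (h : IsCaDomain ε f U) (hq : q ∈ U) (v w : E) :
    caConormal ε f q (fderiv ℝ (fderiv ℝ f) q v w) = caMetric ε f q v w := by
  rw [h.gauss hq, sub_eq_add_neg, ← neg_smul, h.conormal_add hq]
  linear_combination caMetric ε f q v w * h.sign_mul_self

/-- Differentiate the vanishing of the conormal on tangent vectors; the second derivative of `f`
contributes `h`. With `fderiv_conormal_self` this makes the conormal map an immersion dual to `f`.
-/
theorem fderiv_conormal_tangent (h : IsCaDomain ε f U) (hq : q ∈ U) (y v : E) :
    fderiv ℝ (caConormal ε f) q y (fderiv ℝ f q v) = -caMetric ε f q y v := by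
  have h1 : (fun p => caConormal ε f p (fderiv ℝ f p v)) =ᶠ[nhds q] fun _ => 0 :=
    (h.eventually_mem hq).mono fun p hp => h.conormal_tangent hp v
  have h2 := (((h.contDiffAt_conormal hq).differentiableAt (by simp)).hasFDerivAt.clm_apply
    (((contDiffAt_fderiv (h.contDiffAt hq)).differentiableAt (by simp)).hasFDerivAt.clm_apply
      (hasFDerivAt_const v q))).fderiv
  rw [h1.fderiv_eq] at h2
  have h3 := DFunLike.congr_fun h2 y
  simp [h.conormal_snd hq] at h3
  linear_combination -h3

theorem fderiv_conormal_self (h : IsCaDomain ε f U) (hq : q ∈ U) (y : E) :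
    fderiv ℝ (caConormal ε f) q y (f q) = 0 := by
  have h1 : (fun p => caConormal ε f p (f p)) =ᶠ[nhds q] fun _ => -ε :=
    (h.eventually_mem hq).mono fun p hp => h.conormal_self hp
  have h2 := (((h.contDiffAt_conormal hq).differentiableAt (by simp)).hasFDerivAt.clm_apply
    ((h.contDiffAt hq).differentiableAt (by simp)).hasFDerivAt).fderiv
  rw [h1.fderiv_eq] at h2
  have h3 := DFunLike.congr_fun h2 y
  simp [h.conormal_tangent hq] at h3
  exact h3.symm

theorem clm_ext (h : IsCaDomain ε f U) (hq : q ∈ U) {G : Type*} [NormedAddCommGroup G]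
    [NormedSpace ℝ G] {A B : F →L[ℝ] G} (h1 : ∀ v, A (fderiv ℝ f q v) = B (fderiv ℝ f q v))
    (h2 : A (f q) = B (f q)) : A = B := by
  ext z
  obtain ⟨⟨v, s⟩, rfl⟩ := (h.transversal q hq).2 z
  simp [frame_apply, h1, h2]

/-- Differentiating `h(v, w) = conormal (D²f(v, w))` produces a third derivative of `f`. Its
symmetry in `y` and `v` is the Codazzi equation. -/
theorem fderiv_metric_add (h : IsCaDomain ε f U) (hq : q ∈ U) (y v w : E) :
    fderiv ℝ (caMetric ε f) q y v w + caMetric ε f q y (leviCivita (caMetric ε f) q v w +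
      caDiff ε f q v w) = caConormal ε f q (fderiv ℝ (fderiv ℝ (fderiv ℝ f)) q y v w) := by
  have hd := contDiffAt_fderiv (h.contDiffAt hq)
  have h1 : (fun p => caMetric ε f p v w) =ᶠ[nhds q]
      fun p => caConormal ε f p (fderiv ℝ (fderiv ℝ f) p v w) :=
    (h.eventually_mem hq).mono fun p hp => (h.conormal_snd hp v w).symm
  have h2 := (((h.contDiffAt_conormal hq).differentiableAt (by simp)).hasFDerivAt.clm_apply
    ((((contDiffAt_fderiv hd).differentiableAt (by simp)).hasFDerivAt.clm_apply
      (hasFDerivAt_const v q)).clm_apply (hasFDerivAt_const w q))).fderiv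
  have h4 := fderiv_clm_apply₂ ((h.contDiffAt_metric hq).differentiableAt (by simp))
    (differentiableAt_const v) (differentiableAt_const w) y
  rw [h1.fderiv_eq, h2] at h4
  have h5 := h.gauss hq v w
  simp [h5, h.fderiv_conormal_tangent hq, h.fderiv_conormal_self hq] at h4
  simp
  linear_combination -h4

/-- The cubic form `h(K(v, w), z)` is totally symmetric. -/
theorem cubic_symm (h : IsCaDomain ε f U) (hq : q ∈ U) (y v w : E) :
    caMetric ε f q (caDiff ε f q v w) y = caMetric ε f q (caDiff ε f q y w) v := by
  have h1 := h.fderiv_metric_add hq y v w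
  have h2 := h.fderiv_metric_add hq v y w
  have h3 := fderiv_fderiv_comm (contDiffAt_fderiv (h.contDiffAt hq)) y v
  -- Once `∂h` is written through the metric connection, all Levi-Civita terms are symmetric in `y`
  -- and `v` and cancel, so only the terms with `K` remain.
  rw [h3, ← h2, h.fderiv_metric hq, h.fderiv_metric hq, h.leviCivita_symm hq y v] at h1
  simp only [map_add] at h1
  rw [h.metric_symm hq (caDiff ε f q v w), h.metric_symm hq (caDiff ε f q y w)]
  linear_combination h1

theorem contDiffAt_tchebForm (h : IsCaDomain ε f U) (hq : q ∈ U) :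
    ContDiffAt ℝ ∞ (tchebForm ε f) q := by
  let Λ : (E →L[ℝ] E →L[ℝ] E) →ₗ[ℝ] (E →L[ℝ] ℝ) :=
    { toFun := fun A => LinearMap.toContinuousLinearMap
        ((LinearMap.trace ℝ E).comp ((ContinuousLinearMap.coeLM ℝ).comp A.toLinearMap))
      map_add' := fun A B => by ext; simp
      map_smul' := fun c A => by ext; simp }
  exact (contDiffAt_const (c := (1 / (Module.finrank ℝ E : ℝ)))).smul
    ((LinearMap.toContinuousLinearMap Λ).contDiff.contDiffAt.comp q (h.contDiffAt_diff hq))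

theorem contDiffAt_tchebField (h : IsCaDomain ε f U) (hq : q ∈ U) :
    ContDiffAt ℝ ∞ (tchebField ε f) q :=
  (contDiffAt_inverse (h.contDiffAt_metric hq) (h.isInvertible_metric hq)).clm_apply
    (h.contDiffAt_tchebForm hq)

theorem metric_tchebField (h : IsCaDomain ε f U) (hq : q ∈ U) :
    caMetric ε f q (tchebField ε f q) = tchebForm ε f q :=
  (h.isInvertible_metric hq).self_apply_inverse _

end IsCaDomain

/-! ### Linear algebra behind the integrability condition. -/

section Compatibility

variable {E : Type*} [AddCommGroup E] [Module ℝ E] [FiniteDimensional ℝ E]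

/-- The kernel has dimension at least `3 - 1 = 2`, so no line contains it. The bound `n ≥ 3` enters
here. -/
theorem exists_ker_notMem_span {θ : E →ₗ[ℝ] ℝ} (h3 : 3 ≤ Module.finrank ℝ E) (v : E) :
    ∃ w, θ w = 0 ∧ ∀ c : ℝ, w ≠ c • v := by
  by_contra hcon
  push Not at hcon
  have h1 : LinearMap.ker θ ≤ Submodule.span ℝ {v} := by
    intro w hw
    obtain ⟨c, rfl⟩ := hcon w hw
    exact Submodule.mem_span_singleton.2 ⟨c, rfl⟩
  have h2 := Submodule.finrank_mono h1
  have h4 := finrank_span_le_card (R := ℝ) ({v} : Set E)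
  rw [Set.toFinset_singleton, Finset.card_singleton] at h4
  have h5 := LinearMap.finrank_range_add_finrank_ker θ
  have h6 := Submodule.finrank_le (LinearMap.range θ)
  simp at h6
  omega

/-- On independent vectors of `ker θ` the relation reads `σ(v) w = σ(w) v`, which kills `σ` on `ker
θ`. Pairing a nonzero kernel vector with `T` then kills `σ(T)`, and the remaining term says that `τ`
is proportional to `θ`. -/
theorem eq_zero_of_alternating {θ σ τ : E →ₗ[ℝ] ℝ} {T : E} (h3 : 3 ≤ Module.finrank ℝ E)
    (hT : θ T = 1)
    (h : ∀ v w, σ v • w - σ w • v + (θ w * τ v - θ v * τ w) • T = 0) :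
    σ = 0 ∧ τ = τ T • θ := by
  have hσ : ∀ v, θ v = 0 → σ v = 0 := by
    intro v hv
    obtain ⟨w, hw, hne⟩ := exists_ker_notMem_span (θ := θ) h3 v
    have h1 := h v w
    simp [hv, hw, sub_eq_zero] at h1
    by_contra hs
    refine hne ((σ v)⁻¹ * σ w) ?_
    rw [mul_smul, ← h1, smul_smul, inv_mul_cancel₀ hs, one_smul]
  have hσT : σ T = 0 := by
    obtain ⟨w, hw, hne⟩ := exists_ker_notMem_span (θ := θ) h3 0
    have hw0 : w ≠ 0 := by simpa using hne 0
    have h1 := h w T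
    have h2 := congrArg θ h1
    simp [hw, hT, hσ w hw] at h2
    simpa [hw, hT, hσ w hw, h2, hw0] using h1
  have hdec : ∀ v, ∃ u, θ u = 0 ∧ v = u + θ v • T := fun v =>
    ⟨v - θ v • T, by simp [hT], by simp⟩
  have hσ0 : ∀ v, σ v = 0 := by
    intro v
    obtain ⟨u, hu, hv⟩ := hdec v
    rw [hv]
    simp [hσ u hu, hσT]
  refine ⟨LinearMap.ext hσ0, LinearMap.ext fun v => ?_⟩
  have h1 := congrArg θ (h v T)
  simp [hσ0, hT] at h1
  simp
  linarith

end Compatibility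

/-! ### The integrability condition, applied below both to the immersion and to its conormal map. -/

section StructureEquation

variable {E W : Type*} [NormedAddCommGroup E] [NormedSpace ℝ E] [CompleteSpace E]
  [FiniteDimensional ℝ E] [NormedAddCommGroup W] [NormedSpace ℝ W] [CompleteSpace W]

/-- The integrability condition of `dZ = κ dy + θ (ν Z + c y)` for a vector field `Z = y_* T`
along an immersion `y`, where `θ` is a closed form. -/
theorem integrability_of_fderiv_eq {y Z : E → W} {κ ν c : E → ℝ} {θ : E → E →L[ℝ] ℝ} {q T : E}
    (h3 : 3 ≤ Module.finrank ℝ E)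
    (hy : ContDiffAt ℝ ∞ y q) (hZ : ContDiffAt ℝ ∞ Z q)
    (hκ : DifferentiableAt ℝ κ q) (hν : DifferentiableAt ℝ ν q) (hc : DifferentiableAt ℝ c q)
    (hθ : DifferentiableAt ℝ θ q) (hθs : ∀ v w, fderiv ℝ θ q v w = fderiv ℝ θ q w v)
    (hdc : ∃ c' : ℝ, fderiv ℝ c q = c' • θ q)
    (hdZ : ∀ᶠ p in nhds q, ∀ v,
      fderiv ℝ Z p v = κ p • fderiv ℝ y p v + θ p v • (ν p • Z p + c p • y p))
    (hinj : Function.Injective (fderiv ℝ y q)) (hZT : Z q = fderiv ℝ y q T) (hT : θ q T = 1) :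
    fderiv ℝ κ q = (ν q * κ q + c q) • θ q ∧ fderiv ℝ ν q = fderiv ℝ ν q T • θ q := by
  obtain ⟨c', hc'⟩ := hdc
  have hy1 : DifferentiableAt ℝ y q := hy.differentiableAt (by simp)
  have hZ1 : DifferentiableAt ℝ Z q := hZ.differentiableAt (by simp)
  have hy2 : DifferentiableAt ℝ (fderiv ℝ y) q :=
    (contDiffAt_fderiv hy).differentiableAt (by simp)
  have hZ2 : DifferentiableAt ℝ (fderiv ℝ Z) q :=
    (contDiffAt_fderiv hZ).differentiableAt (by simp)
  have key : ∀ v w, fderiv ℝ (fderiv ℝ Z) q v w =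
      fderiv ℝ κ q v • fderiv ℝ y q w + κ q • fderiv ℝ (fderiv ℝ y) q v w +
      fderiv ℝ θ q v w • (ν q • Z q + c q • y q) +
      θ q w • (fderiv ℝ ν q v • Z q + ν q • fderiv ℝ Z q v + (c' * θ q v) • y q +
        c q • fderiv ℝ y q v) := by
    intro v w
    have h1 : (fun p => fderiv ℝ Z p w) =ᶠ[nhds q]
        fun p => κ p • fderiv ℝ y p w + θ p w • (ν p • Z p + c p • y p) :=
      hdZ.mono fun p hp => hp w
    have h2 := (hZ2.hasFDerivAt.clm_apply (hasFDerivAt_const w q)).fderiv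
    have h4 := ((hκ.hasFDerivAt.smul (hy2.hasFDerivAt.clm_apply (hasFDerivAt_const w q))).add
      ((hθ.hasFDerivAt.clm_apply (hasFDerivAt_const w q)).smul
        ((hν.hasFDerivAt.smul hZ1.hasFDerivAt).add
          (hc.hasFDerivAt.smul hy1.hasFDerivAt)))).fderiv
    have h5 : fderiv ℝ (fun p => fderiv ℝ Z p w) q v = fderiv ℝ (fun p =>
        κ p • fderiv ℝ y p w + θ p w • (ν p • Z p + c p • y p)) q v := by
      rw [h1.fderiv_eq]
    rw [h2] at h5
    erw [h4] at h5
    simp [hc'] at h5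
    rw [h5]
    module
  have hz := hdZ.self_of_nhds
  -- Antisymmetrize `key`. Closedness of `θ` and proportionality of `dc` to `θ` remove the terms in
  -- `y`; what is left is tangential because `Z = y_* T`, and `y_*` is injective.
  have halt : ∀ v w, (fderiv ℝ κ q v - (ν q * κ q + c q) * θ q v) • w -
      (fderiv ℝ κ q w - (ν q * κ q + c q) * θ q w) • v +
      (θ q w * fderiv ℝ ν q v - θ q v * fderiv ℝ ν q w) • T = 0 := by
    intro v w
    apply hinj
    have h1 := fderiv_fderiv_comm hZ v w
    rw [key, key, hθs v w, fderiv_fderiv_comm hy v w, hz v, hz w] at h1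
    rw [← sub_eq_zero] at h1
    simp only [map_add, map_sub, map_smul, map_zero, ← hZT]
    rw [← h1]
    module
  obtain ⟨h4, h5⟩ := eq_zero_of_alternating (θ := (θ q).toLinearMap)
    (σ := (fderiv ℝ κ q - (ν q * κ q + c q) • θ q).toLinearMap)
    (τ := (fderiv ℝ ν q).toLinearMap) (T := T) h3 hT (fun v w => by simpa using halt v w)
  constructor
  · rw [← sub_eq_zero]
    ext v
    exact DFunLike.congr_fun h4 v
  · ext v
    exact DFunLike.congr_fun h5 v

end StructureEquation

/-! ### Tchebychev hypersurfaces on a coordinate domain: smoothness of the coefficients, closedness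
of `θ`. -/

/-- The hypotheses of the classification of Tchebychev hypersurfaces with `K_T T = lam T` and
`K_T V = μ V` for `V` orthogonal to `T`, on a coordinate domain `U` without zeros of `T`. -/
structure IsTchebDomain {E F : Type*} [NormedAddCommGroup E] [NormedSpace ℝ E]
    [FiniteDimensional ℝ E] [NormedAddCommGroup F] [NormedSpace ℝ F] (ε : ℝ) (f : E → F)
    (U : Set E) (α lam μ : E → ℝ) : Prop extends IsCaDomain ε f U where
  operator_eq : ∀ q ∈ U, tchebOperator ε f q = α q • ContinuousLinearMap.id ℝ E
  diff_self : ∀ q ∈ U, caDiff ε f q (tchebField ε f q) (tchebField ε f q) =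
    lam q • tchebField ε f q
  diff_perp : ∀ q ∈ U, ∀ v, caMetric ε f q v (tchebField ε f q) = 0 →
    caDiff ε f q (tchebField ε f q) v = μ q • v
  ne_zero : ∀ q ∈ U, tchebField ε f q ≠ 0

/-- The form `θ` with `θ(T) = 1` whose kernel is orthogonal to `T`. -/
def tchebDual {E F : Type*} [NormedAddCommGroup E] [NormedSpace ℝ E]
    [FiniteDimensional ℝ E] [NormedAddCommGroup F] [NormedSpace ℝ F] (ε : ℝ) (f : E → F)
    (q : E) : E →L[ℝ] ℝ :=
  (tchebNormSq ε f q)⁻¹ • caMetric ε f q (tchebField ε f q)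

namespace IsTchebDomain

variable {E F : Type*} [NormedAddCommGroup E] [NormedSpace ℝ E] [CompleteSpace E]
  [FiniteDimensional ℝ E] [NormedAddCommGroup F] [NormedSpace ℝ F] [CompleteSpace F]
  {ε : ℝ} {f : E → F} {U : Set E} {α lam μ : E → ℝ} {q : E}

theorem normSq_pos (h : IsTchebDomain ε f U α lam μ) (hq : q ∈ U) : 0 < tchebNormSq ε f q :=
  h.posDef q hq _ (h.ne_zero q hq)

theorem dual_self (h : IsTchebDomain ε f U α lam μ) (hq : q ∈ U) :
    tchebDual ε f q (tchebField ε f q) = 1 :=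
  inv_mul_cancel₀ (h.normSq_pos hq).ne'

theorem metric_field (h : IsTchebDomain ε f U α lam μ) (hq : q ∈ U) (v : E) :
    caMetric ε f q (tchebField ε f q) v = tchebNormSq ε f q * tchebDual ε f q v := by
  simp [tchebDual, (h.normSq_pos hq).ne']

theorem metric_field' (h : IsTchebDomain ε f U α lam μ) (hq : q ∈ U) (v : E) :
    caMetric ε f q v (tchebField ε f q) = tchebNormSq ε f q * tchebDual ε f q v := by
  rw [h.metric_symm hq, h.metric_field hq]

/-- Split `v` into `θ(v) T` and a part orthogonal to `T`. This puts both hypotheses on `K_T` into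
one formula. -/
theorem diff_field (h : IsTchebDomain ε f U α lam μ) (hq : q ∈ U) (v : E) :
    caDiff ε f q (tchebField ε f q) v =
      μ q • v + ((lam q - μ q) * tchebDual ε f q v) • tchebField ε f q := by
  have h1 := h.diff_perp q hq (v - tchebDual ε f q v • tchebField ε f q) (by
    rw [h.metric_field' hq]
    simp [h.dual_self hq])
  rw [map_sub, map_smul, h.diff_self q hq, sub_eq_iff_eq_add] at h1
  rw [h1]
  module

theorem diff_field' (h : IsTchebDomain ε f U α lam μ) (hq : q ∈ U) (v : E) :
    caDiff ε f q v (tchebField ε f q) =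
      μ q • v + ((lam q - μ q) * tchebDual ε f q v) • tchebField ε f q := by
  rw [h.diff_symm hq, h.diff_field hq]

/-- Both sides are `Tr K_T`: by the definition of `T`, and because `K_T` is `μ` times the identity
plus a rank-one map of trace `λ - μ`. -/
theorem trace_eq (h : IsTchebDomain ε f U α lam μ) (hq : q ∈ U) :
    Module.finrank ℝ E * tchebNormSq ε f q =
      (Module.finrank ℝ E - 1) * μ q + lam q := by
  have h1 : tchebNormSq ε f q = tchebForm ε f q (tchebField ε f q) := by
    rw [← h.metric_tchebField hq, tchebNormSq]
  have h2 : ((caDiff ε f q (tchebField ε f q) : E →L[ℝ] E) : E →ₗ[ℝ] E) =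
      μ q • LinearMap.id + ((lam q - μ q) • (tchebDual ε f q).toLinearMap).smulRight
        (tchebField ε f q) := by
    ext v
    simpa using h.diff_field hq v
  have h3 : (Module.finrank ℝ E : ℝ) ≠ 0 := by
    have : Nontrivial E := ⟨_, _, h.ne_zero q hq⟩
    exact_mod_cast (Module.finrank_pos (R := ℝ) (M := E)).ne'
  have h4 : Module.finrank ℝ E * tchebNormSq ε f q = LinearMap.trace ℝ E
      ((caDiff ε f q (tchebField ε f q) : E →L[ℝ] E) : E →ₗ[ℝ] E) := by
    rw [h1]
    simp [tchebForm, h3]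
  rw [h4, h2]
  simp [h.dual_self hq]
  ring

theorem contDiffAt_field (h : IsTchebDomain ε f U α lam μ) (hq : q ∈ U) :
    ContDiffAt ℝ ∞ (tchebField ε f) q :=
  h.contDiffAt_tchebField hq

theorem contDiffAt_normSq (h : IsTchebDomain ε f U α lam μ) (hq : q ∈ U) :
    ContDiffAt ℝ ∞ (tchebNormSq ε f) q :=
  ((h.contDiffAt_metric hq).clm_apply (h.contDiffAt_field hq)).clm_apply (h.contDiffAt_field hq)

theorem contDiffAt_dual (h : IsTchebDomain ε f U α lam μ) (hq : q ∈ U) :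
    ContDiffAt ℝ ∞ (tchebDual ε f) q :=
  ((h.contDiffAt_normSq hq).inv (h.normSq_pos hq).ne').smul
    ((h.contDiffAt_metric hq).clm_apply (h.contDiffAt_field hq))

theorem contDiffAt_alpha (h : IsTchebDomain ε f U α lam μ) (hq : q ∈ U) :
    ContDiffAt ℝ ∞ α q := by
  have h1 : ContDiffAt ℝ ∞ (tchebOperator ε f) q :=
    (contDiffAt_fderiv (h.contDiffAt_field hq)).add
      (((ContinuousLinearMap.flipₗᵢ ℝ E E E).toContinuousLinearEquiv.contDiff.contDiffAt.comp
        q (h.contDiffAt_leviCivita hq)).clm_apply (h.contDiffAt_field hq))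
  refine ((h.contDiffAt_dual hq).clm_apply
    (h1.clm_apply (h.contDiffAt_field hq))).congr_of_eventuallyEq ?_
  filter_upwards [h.eventually_mem hq] with p hp
  simp [h.operator_eq p hp, h.dual_self hp]

theorem contDiffAt_lam (h : IsTchebDomain ε f U α lam μ) (hq : q ∈ U) :
    ContDiffAt ℝ ∞ lam q := by
  refine ((h.contDiffAt_dual hq).clm_apply (((h.contDiffAt_diff hq).clm_apply
    (h.contDiffAt_field hq)).clm_apply (h.contDiffAt_field hq))).congr_of_eventuallyEq ?_
  filter_upwards [h.eventually_mem hq] with p hp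
  simp [h.diff_self p hp, h.dual_self hp]

/-- Smoothness of the coefficients is not assumed. Solving the trace identity for `μ` avoids
choosing a smooth section of the orthogonal complement of `T`. -/
theorem contDiffAt_mu (h : IsTchebDomain ε f U α lam μ) (h3 : 3 ≤ Module.finrank ℝ E)
    (hq : q ∈ U) : ContDiffAt ℝ ∞ μ q := by
  have h4 : (Module.finrank ℝ E - 1 : ℝ) ≠ 0 := by
    have : (3 : ℝ) ≤ Module.finrank ℝ E := by exact_mod_cast h3
    linarith
  refine (((contDiffAt_const (c := (Module.finrank ℝ E : ℝ))).mul (h.contDiffAt_normSq hq)).sub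
    (h.contDiffAt_lam hq)).div_const (Module.finrank ℝ E - 1 : ℝ) |>.congr_of_eventuallyEq ?_
  filter_upwards [h.eventually_mem hq] with p hp
  rw [eq_div_iff h4]
  linear_combination -h.trace_eq hp

theorem fderiv_field (h : IsTchebDomain ε f U α lam μ) (hq : q ∈ U) (y : E) :
    fderiv ℝ (tchebField ε f) q y =
      α q • y - leviCivita (caMetric ε f) q y (tchebField ε f q) := by
  have := DFunLike.congr_fun (h.operator_eq q hq) y
  simp [tchebOperator] at this
  rw [← this]
  abel

theorem fderiv_metric_field (h : IsTchebDomain ε f U α lam μ) (hq : q ∈ U) (y w : E) :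
    fderiv ℝ (fun p => caMetric ε f p (tchebField ε f p) w) q y = α q * caMetric ε f q y w +
      caMetric ε f q (tchebField ε f q) (leviCivita (caMetric ε f) q y w) := by
  rw [fderiv_clm_apply₂ ((h.contDiffAt_metric hq).differentiableAt (by simp))
    ((h.contDiffAt_field hq).differentiableAt (by simp)) (differentiableAt_const w),
    h.fderiv_metric hq, h.fderiv_field hq]
  simp
  ring

theorem fderiv_normSq (h : IsTchebDomain ε f U α lam μ) (hq : q ∈ U) (y : E) :
    fderiv ℝ (tchebNormSq ε f) q y = 2 * α q * tchebNormSq ε f q * tchebDual ε f q y := by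
  have h0 := (h.contDiffAt_field hq).differentiableAt (by simp)
  have h1 := fderiv_clm_apply₂ ((h.contDiffAt_metric hq).differentiableAt (by simp)) h0 h0 y
  rw [h.fderiv_metric hq, h.fderiv_field hq] at h1
  have h2 : tchebNormSq ε f = fun p => caMetric ε f p (tchebField ε f p) (tchebField ε f p) := rfl
  rw [h2, h1, ← h2]
  simp [h.metric_field' hq, h.metric_field hq]
  ring

/-- Product rule in `h(T, ·) = ‖T‖² θ`, with `∇̂T = α id` on the left and `d‖T‖² = 2 α ‖T‖² θ` on
the right. Every term is symmetric in `y` and `w`, hence `θ` is closed. -/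
theorem fderiv_dual (h : IsTchebDomain ε f U α lam μ) (hq : q ∈ U) (y w : E) :
    fderiv ℝ (tchebDual ε f) q y w = -2 * α q * tchebDual ε f q y * tchebDual ε f q w +
      (tchebNormSq ε f q)⁻¹ * α q * caMetric ε f q y w +
      tchebDual ε f q (leviCivita (caMetric ε f) q y w) := by
  have hr := (h.normSq_pos hq).ne'
  have h1 := (((h.contDiffAt_normSq hq).differentiableAt (by simp)).hasFDerivAt.mul
    (((h.contDiffAt_dual hq).differentiableAt (by simp)).hasFDerivAt.clm_apply
      (hasFDerivAt_const w q))).fderiv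
  have h2 : (fun p => caMetric ε f p (tchebField ε f p) w) =ᶠ[nhds q]
      (tchebNormSq ε f) * fun p => tchebDual ε f p w :=
    (h.eventually_mem hq).mono fun p hp => h.metric_field hp w
  have h4 := h.fderiv_metric_field hq y w
  rw [h2.fderiv_eq, h1] at h4
  simp [h.fderiv_normSq hq, h.metric_field hq] at h4
  field_simp
  linear_combination h4

theorem fderiv_dual_symm (h : IsTchebDomain ε f U α lam μ) (hq : q ∈ U) (y w : E) :
    fderiv ℝ (tchebDual ε f) q y w = fderiv ℝ (tchebDual ε f) q w y := by
  rw [h.fderiv_dual hq, h.fderiv_dual hq, h.metric_symm hq y w, h.leviCivita_symm hq y w]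
  ring

end IsTchebDomain

/-! ### The structure equations of the field `x_* T` and of its dual, and their consequences. -/

/-- The vector field `x_* T` along the hypersurface. -/
def tchebPush {E F : Type*} [NormedAddCommGroup E] [NormedSpace ℝ E] [FiniteDimensional ℝ E]
    [NormedAddCommGroup F] [NormedSpace ℝ F] (ε : ℝ) (f : E → F) (q : E) : F :=
  fderiv ℝ f q (tchebField ε f q)

/-- The derivative of the conormal map in the direction of `T`. -/
def tchebCopush {E F : Type*} [NormedAddCommGroup E] [NormedSpace ℝ E] [FiniteDimensional ℝ E]
    [NormedAddCommGroup F] [NormedSpace ℝ F] (ε : ℝ) (f : E → F) (q : E) : F →L[ℝ] ℝ :=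
  fderiv ℝ (caConormal ε f) q (tchebField ε f q)

namespace IsTchebDomain

variable {E F : Type*} [NormedAddCommGroup E] [NormedSpace ℝ E] [CompleteSpace E]
  [FiniteDimensional ℝ E] [NormedAddCommGroup F] [NormedSpace ℝ F] [CompleteSpace F]
  {ε : ℝ} {f : E → F} {U : Set E} {α lam μ : E → ℝ} {q : E}

theorem contDiffAt_push (h : IsTchebDomain ε f U α lam μ) (hq : q ∈ U) :
    ContDiffAt ℝ ∞ (tchebPush ε f) q :=
  (contDiffAt_fderiv (h.contDiffAt hq)).clm_apply (h.contDiffAt_field hq)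

theorem contDiffAt_copush (h : IsTchebDomain ε f U α lam μ) (hq : q ∈ U) :
    ContDiffAt ℝ ∞ (tchebCopush ε f) q :=
  (contDiffAt_fderiv (h.contDiffAt_conormal hq)).clm_apply (h.contDiffAt_field hq)

/-- By the Gauss formula the tangential part is `∇̂_y T + K(y, T) = (α + μ) y + (λ - μ) θ(y) T`, and
the transversal part is `-ε h(y, T) x`. -/
theorem fderiv_push (h : IsTchebDomain ε f U α lam μ) (hq : q ∈ U) (y : E) :
    fderiv ℝ (tchebPush ε f) q y = (α q + μ q) • fderiv ℝ f q y + tchebDual ε f q y •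
      ((lam q - μ q) • tchebPush ε f q + (-(ε * tchebNormSq ε f q)) • f q) := by
  have h1 := (((contDiffAt_fderiv (h.contDiffAt hq)).differentiableAt
    (by simp)).hasFDerivAt.clm_apply
    ((h.contDiffAt_field hq).differentiableAt (by simp)).hasFDerivAt).fderiv
  have h2 : tchebPush ε f = fun p => fderiv ℝ f p (tchebField ε f p) := rfl
  rw [h2, h1]
  simp [h.gauss hq, h.diff_field' hq, h.metric_field' hq, h.fderiv_field hq]
  module

theorem copush_tangent (h : IsTchebDomain ε f U α lam μ) (hq : q ∈ U) (v : E) :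
    tchebCopush ε f q (fderiv ℝ f q v) = -caMetric ε f q (tchebField ε f q) v :=
  h.fderiv_conormal_tangent hq _ v

theorem copush_self (h : IsTchebDomain ε f U α lam μ) (hq : q ∈ U) :
    tchebCopush ε f q (f q) = 0 :=
  h.fderiv_conormal_self hq _

/-- The dual of `fderiv_push`: for the conormal map the difference tensor changes sign, which
replaces `λ`, `μ` by `-λ`, `-μ`. Two covectors agree once they agree on tangent vectors and on the
position vector. -/
theorem fderiv_copush (h : IsTchebDomain ε f U α lam μ) (hq : q ∈ U) (y : E) :
    fderiv ℝ (tchebCopush ε f) q y = (α q - μ q) • fderiv ℝ (caConormal ε f) q y +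
      tchebDual ε f q y • ((μ q - lam q) • tchebCopush ε f q +
        (-(ε * tchebNormSq ε f q)) • caConormal ε f q) := by
  have hZ := ((h.contDiffAt_copush hq).differentiableAt (by simp)).hasFDerivAt
  refine h.clm_ext hq (fun v => ?_) ?_
  · have h1 : (fun p => tchebCopush ε f p (fderiv ℝ f p v)) =ᶠ[nhds q]
        -fun p => caMetric ε f p (tchebField ε f p) v :=
      (h.eventually_mem hq).mono fun p hp => h.copush_tangent hp v
    have h2 := (hZ.clm_apply (((contDiffAt_fderiv (h.contDiffAt hq)).differentiableAt
      (by simp)).hasFDerivAt.clm_apply (hasFDerivAt_const v q))).fderiv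
    rw [h1.fderiv_eq, fderiv_neg] at h2
    have h3 := DFunLike.congr_fun h2 y
    -- Total symmetry of the cubic form turns `h(K(y, v), T)` into `h(K_T y, v)`, where the
    -- hypotheses on `K_T` apply.
    have h4 := h.cubic_symm hq (tchebField ε f q) y v
    rw [h.diff_field hq, h.metric_symm hq (caDiff ε f q y v)] at h4
    simp [h.gauss hq, h.fderiv_metric_field hq, h.copush_tangent hq, h.copush_self hq] at h3 h4
    simp [h.copush_tangent hq, h.conormal_tangent hq, h.fderiv_conormal_tangent hq]
    simp only [h.metric_field hq, h.metric_symm hq v y] at h3 h4 ⊢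
    linear_combination -h3 + h4
  · have h1 : (fun p => tchebCopush ε f p (f p)) =ᶠ[nhds q] fun _ => 0 :=
      (h.eventually_mem hq).mono fun p hp => h.copush_self hp
    have h2 := (hZ.clm_apply ((h.contDiffAt hq).differentiableAt (by simp)).hasFDerivAt).fderiv
    rw [h1.fderiv_eq] at h2
    have h3 := DFunLike.congr_fun h2 y
    simp [h.copush_tangent hq, h.metric_field hq] at h3
    simp [h.copush_self hq, h.conormal_self hq, h.fderiv_conormal_self hq]
    linear_combination -h3 - tchebDual ε f q y * tchebNormSq ε f q * h.sign_mul_self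

theorem injective_fderiv (h : IsTchebDomain ε f U α lam μ) (hq : q ∈ U) :
    Function.Injective (fderiv ℝ f q) := by
  intro v w hvw
  have := (h.transversal q hq).eq_of_add_smul_eq (v := v) (w := w) (s := 0) (r := 0)
    (by rw [hvw])
  exact this.1

/-- The conormal map is an immersion because `h` is nondegenerate, so the integrability lemma
applies to it as well. -/
theorem injective_fderiv_conormal (h : IsTchebDomain ε f U α lam μ) (hq : q ∈ U) :
    Function.Injective (fderiv ℝ (caConormal ε f) q) := by
  intro v w hvw
  apply (h.isInvertible_metric hq).injective
  ext z
  have h1 := h.fderiv_conormal_tangent hq v z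
  rw [hvw, h.fderiv_conormal_tangent hq] at h1
  linarith

theorem exists_fderiv_normSq (h : IsTchebDomain ε f U α lam μ) (hq : q ∈ U) :
    ∃ c : ℝ, fderiv ℝ (fun p => -(ε * tchebNormSq ε f p)) q = c • tchebDual ε f q := by
  refine ⟨-(ε * (2 * α q * tchebNormSq ε f q)), ?_⟩
  ext y
  have h1 := ((((h.contDiffAt_normSq hq).differentiableAt (by simp)).hasFDerivAt.const_mul
    ε).neg).fderiv
  change fderiv ℝ (-fun p => ε * tchebNormSq ε f p) q y = _
  rw [h1]
  simp [h.fderiv_normSq hq]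
  ring

theorem fderiv_alpha_add_mu (h : IsTchebDomain ε f U α lam μ) (h3 : 3 ≤ Module.finrank ℝ E)
    (hq : q ∈ U) : fderiv ℝ (fun p => α p + μ p) q =
      ((lam q - μ q) * (α q + μ q) + -(ε * tchebNormSq ε f q)) • tchebDual ε f q ∧
      fderiv ℝ (fun p => lam p - μ p) q =
        fderiv ℝ (fun p => lam p - μ p) q (tchebField ε f q) • tchebDual ε f q :=
  integrability_of_fderiv_eq (y := f) (Z := tchebPush ε f) (κ := fun p => α p + μ p)
    (ν := fun p => lam p - μ p) (c := fun p => -(ε * tchebNormSq ε f p)) h3 (h.contDiffAt hq)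
    (h.contDiffAt_push hq)
    (((h.contDiffAt_alpha hq).add (h.contDiffAt_mu h3 hq)).differentiableAt (by simp))
    (((h.contDiffAt_lam hq).sub (h.contDiffAt_mu h3 hq)).differentiableAt (by simp))
    ((contDiffAt_const.mul (h.contDiffAt_normSq hq)).neg.differentiableAt (by simp))
    ((h.contDiffAt_dual hq).differentiableAt (by simp)) (h.fderiv_dual_symm hq)
    (h.exists_fderiv_normSq hq)
    ((h.eventually_mem hq).mono fun p hp => h.fderiv_push hp) (h.injective_fderiv hq) rfl
    (h.dual_self hq)

theorem fderiv_alpha_sub_mu (h : IsTchebDomain ε f U α lam μ) (h3 : 3 ≤ Module.finrank ℝ E)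
    (hq : q ∈ U) : fderiv ℝ (fun p => α p - μ p) q =
      ((μ q - lam q) * (α q - μ q) + -(ε * tchebNormSq ε f q)) • tchebDual ε f q :=
  (integrability_of_fderiv_eq (y := caConormal ε f) (Z := tchebCopush ε f)
    (κ := fun p => α p - μ p)
    (ν := fun p => μ p - lam p) (c := fun p => -(ε * tchebNormSq ε f p)) h3
    (h.contDiffAt_conormal hq)
    (h.contDiffAt_copush hq)
    (((h.contDiffAt_alpha hq).sub (h.contDiffAt_mu h3 hq)).differentiableAt (by simp))
    (((h.contDiffAt_mu h3 hq).sub (h.contDiffAt_lam hq)).differentiableAt (by simp))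
    ((contDiffAt_const.mul (h.contDiffAt_normSq hq)).neg.differentiableAt (by simp))
    ((h.contDiffAt_dual hq).differentiableAt (by simp)) (h.fderiv_dual_symm hq)
    (h.exists_fderiv_normSq hq)
    ((h.eventually_mem hq).mono fun p hp => h.fderiv_copush hp) (h.injective_fderiv_conormal hq)
    rfl (h.dual_self hq)).1

/-- The immersion gives `d(α + μ)`, the conormal map gives `d(α - μ)`; half the sum isolates `α`,
and half the difference isolates `μ` in `fderiv_mu`. -/
theorem fderiv_alpha (h : IsTchebDomain ε f U α lam μ) (h3 : 3 ≤ Module.finrank ℝ E)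
    (hq : q ∈ U) : fderiv ℝ α q =
      ((lam q - μ q) * μ q - ε * tchebNormSq ε f q) • tchebDual ε f q := by
  have ha := (h.contDiffAt_alpha hq).differentiableAt (by simp)
  have hm := (h.contDiffAt_mu h3 hq).differentiableAt (by simp)
  have h1 := (h.fderiv_alpha_add_mu h3 hq).1
  have h2 := h.fderiv_alpha_sub_mu h3 hq
  rw [fderiv_fun_add ha hm] at h1
  rw [fderiv_fun_sub ha hm] at h2
  ext y
  have h4 := DFunLike.congr_fun h1 y
  have h5 := DFunLike.congr_fun h2 y
  simp at h4 h5 ⊢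
  linear_combination (h4 + h5) / 2

theorem fderiv_mu (h : IsTchebDomain ε f U α lam μ) (h3 : 3 ≤ Module.finrank ℝ E)
    (hq : q ∈ U) : fderiv ℝ μ q = ((lam q - μ q) * α q) • tchebDual ε f q := by
  have ha := (h.contDiffAt_alpha hq).differentiableAt (by simp)
  have hm := (h.contDiffAt_mu h3 hq).differentiableAt (by simp)
  have h1 := (h.fderiv_alpha_add_mu h3 hq).1
  have h2 := h.fderiv_alpha_sub_mu h3 hq
  rw [fderiv_fun_add ha hm] at h1
  rw [fderiv_fun_sub ha hm] at h2
  ext y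
  have h4 := DFunLike.congr_fun h1 y
  have h5 := DFunLike.congr_fun h2 y
  simp at h4 h5 ⊢
  linear_combination (h4 - h5) / 2

theorem exists_fderiv_lam (h : IsTchebDomain ε f U α lam μ) (h3 : 3 ≤ Module.finrank ℝ E)
    (hq : q ∈ U) : ∃ c : ℝ, fderiv ℝ lam q = c • tchebDual ε f q := by
  have hl := (h.contDiffAt_lam hq).differentiableAt (by simp)
  have hm := (h.contDiffAt_mu h3 hq).differentiableAt (by simp)
  have h1 := (h.fderiv_alpha_add_mu h3 hq).2
  refine ⟨fderiv ℝ (fun p => lam p - μ p) q (tchebField ε f q) + (lam q - μ q) * α q, ?_⟩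
  rw [add_smul, ← h1, ← h.fderiv_mu h3 hq, fderiv_fun_sub hl hm]
  abel

/-- The vector field `x_* T - (α + μ) x` has constant direction. -/
theorem fderiv_axis (h : IsTchebDomain ε f U α lam μ) (h3 : 3 ≤ Module.finrank ℝ E)
    (hq : q ∈ U) : HasFDerivAt (fun p => tchebPush ε f p - (α p + μ p) • f p)
      (((lam q - μ q) • tchebDual ε f q).smulRight
        (tchebPush ε f q - (α q + μ q) • f q)) q := by
  have hd := ((h.contDiffAt_push hq).differentiableAt (by simp)).hasFDerivAt.sub
    ((((h.contDiffAt_alpha hq).add (h.contDiffAt_mu h3 hq)).differentiableAt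
      (by simp)).hasFDerivAt.smul ((h.contDiffAt hq).differentiableAt (by simp)).hasFDerivAt)
  refine hd.congr_fderiv ?_
  ext y
  have h1 := DFunLike.congr_fun (h.fderiv_alpha_add_mu h3 hq).1 y
  simp [h.fderiv_push hq] at h1 ⊢
  rw [h1]
  module

/-- The covector field dual to the axis has constant direction. -/
theorem fderiv_coaxis (h : IsTchebDomain ε f U α lam μ) (h3 : 3 ≤ Module.finrank ℝ E)
    (hq : q ∈ U) : HasFDerivAt (fun p => tchebCopush ε f p - (α p - μ p) • caConormal ε f p)
      (((μ q - lam q) • tchebDual ε f q).smulRight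
        (tchebCopush ε f q - (α q - μ q) • caConormal ε f q)) q := by
  have hd := ((h.contDiffAt_copush hq).differentiableAt (by simp)).hasFDerivAt.sub
    ((((h.contDiffAt_alpha hq).sub (h.contDiffAt_mu h3 hq)).differentiableAt
      (by simp)).hasFDerivAt.smul
        ((h.contDiffAt_conormal hq).differentiableAt (by simp)).hasFDerivAt)
  refine hd.congr_fderiv ?_
  refine ContinuousLinearMap.ext fun y => ?_
  have h1 := DFunLike.congr_fun (h.fderiv_alpha_sub_mu h3 hq) y
  simp [h.fderiv_copush hq] at h1 ⊢
  rw [h1]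
  module

end IsTchebDomain

/-! ### Invariance of the centroaffine tensors under coordinate changes. -/

/-- `τ` maps the open set `V` into `U`, as a local diffeomorphism. -/
structure IsCoordChange {E E' : Type*} [NormedAddCommGroup E] [NormedSpace ℝ E]
    [NormedAddCommGroup E'] [NormedSpace ℝ E'] (τ : E' → E) (V : Set E') (U : Set E) : Prop where
  isOpen : IsOpen V
  smooth : ContDiffOn ℝ ∞ τ V
  mapsTo : Set.MapsTo τ V U
  bijective : ∀ q ∈ V, Function.Bijective (fderiv ℝ τ q)

namespace IsCoordChange

variable {E E' F : Type*} [NormedAddCommGroup E] [NormedSpace ℝ E] [CompleteSpace E]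
  [FiniteDimensional ℝ E] [NormedAddCommGroup E'] [NormedSpace ℝ E'] [CompleteSpace E']
  [FiniteDimensional ℝ E'] [NormedAddCommGroup F] [NormedSpace ℝ F] [CompleteSpace F]
  {τ : E' → E} {V : Set E'} {ε : ℝ} {f : E → F} {U : Set E} {α lam μ : E → ℝ} {q : E'}

theorem contDiffAt (hτ : IsCoordChange τ V U) (hq : q ∈ V) : ContDiffAt ℝ ∞ τ q :=
  hτ.smooth.contDiffAt (hτ.isOpen.mem_nhds hq)

theorem eventually_mem (hτ : IsCoordChange τ V U) (hq : q ∈ V) : ∀ᶠ p in nhds q, p ∈ V :=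
  hτ.isOpen.mem_nhds hq

theorem fderiv_comp (hτ : IsCoordChange τ V U) (h : IsCaDomain ε f U) (hq : q ∈ V) :
    fderiv ℝ (f ∘ τ) q = (fderiv ℝ f (τ q)).comp (fderiv ℝ τ q) :=
  _root_.fderiv_comp q ((h.contDiffAt (hτ.mapsTo hq)).differentiableAt (by simp))
    ((hτ.contDiffAt hq).differentiableAt (by simp))

theorem fderiv_fderiv_comp (hτ : IsCoordChange τ V U) (h : IsCaDomain ε f U) (hq : q ∈ V)
    (v w : E') : fderiv ℝ (fderiv ℝ (f ∘ τ)) q v w =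
      fderiv ℝ (fderiv ℝ f) (τ q) (fderiv ℝ τ q v) (fderiv ℝ τ q w) +
        fderiv ℝ f (τ q) (fderiv ℝ (fderiv ℝ τ) q v w) := by
  have h1 : fderiv ℝ (f ∘ τ) =ᶠ[nhds q] fun p => (fderiv ℝ f (τ p)).comp (fderiv ℝ τ p) :=
    (hτ.eventually_mem hq).mono fun p hp => hτ.fderiv_comp h hp
  have h2 := ((contDiffAt_fderiv (h.contDiffAt (hτ.mapsTo hq))).differentiableAt
    (by simp)).hasFDerivAt.comp q ((hτ.contDiffAt hq).differentiableAt (by simp)).hasFDerivAt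
  have h3 := (h2.clm_comp ((contDiffAt_fderiv (hτ.contDiffAt hq)).differentiableAt
    (by simp)).hasFDerivAt).fderiv
  rw [h1.fderiv_eq]
  erw [h3]
  simp
  abel

theorem isTransversalAt (hτ : IsCoordChange τ V U) (h : IsCaDomain ε f U) (hq : q ∈ V)
    {ξ : E → F} (hξ : IsTransversalAt f ξ (τ q)) : IsTransversalAt (f ∘ τ) (ξ ∘ τ) q := by
  have hb : Function.Bijective (Prod.map (fderiv ℝ τ q) (id : ℝ → ℝ)) :=
    (hτ.bijective q hq).prodMap Function.bijective_id
  refine (congrArg Function.Bijective (funext ?_)).mp (Function.Bijective.comp hξ hb)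
  rintro ⟨v, s⟩
  simp [frame_apply, hτ.fderiv_comp h hq]

/-- The chain rule for second derivatives, compared with the Gauss formula. The connection acquires
the inhomogeneous term `D²τ`, the metric does not. -/
theorem induced_comp (hτ : IsCoordChange τ V U) (h : IsCaDomain ε f U) (hq : q ∈ V) (v w : E') :
    fderiv ℝ τ q (inducedConn (f ∘ τ) (caNormal ε (f ∘ τ)) q v w) =
        inducedConn f (caNormal ε f) (τ q) (fderiv ℝ τ q v) (fderiv ℝ τ q w) +
          fderiv ℝ (fderiv ℝ τ) q v w ∧
      caMetric ε (f ∘ τ) q v w = caMetric ε f (τ q) (fderiv ℝ τ q v) (fderiv ℝ τ q w) := by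
  have hξ := h.transversal_normal (hτ.mapsTo hq)
  obtain ⟨a, ha⟩ := (hτ.bijective q hq).2
    (inducedConn f (caNormal ε f) (τ q) (fderiv ℝ τ q v) (fderiv ℝ τ q w) +
      fderiv ℝ (fderiv ℝ τ) q v w)
  have h1 := induced_eq_of_gauss (hτ.isTransversalAt h hq hξ) (v := v) (w := w) (a := a)
    (c := caMetric ε f (τ q) (fderiv ℝ τ q v) (fderiv ℝ τ q w)) (by
      rw [hτ.fderiv_fderiv_comp h hq, gauss_formula hξ, hτ.fderiv_comp h hq]
      simp [ha, caMetric]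
      abel)
  rw [← ha]
  exact ⟨congrArg _ h1.1, h1.2⟩

theorem metric_comp (hτ : IsCoordChange τ V U) (h : IsCaDomain ε f U) (hq : q ∈ V) (v w : E') :
    caMetric ε (f ∘ τ) q v w = caMetric ε f (τ q) (fderiv ℝ τ q v) (fderiv ℝ τ q w) :=
  (hτ.induced_comp h hq v w).2

theorem isCaDomain (hτ : IsCoordChange τ V U) (h : IsCaDomain ε f U) :
    IsCaDomain ε (f ∘ τ) V where
  sign := h.sign
  isOpen := hτ.isOpen
  smooth := h.smooth.comp hτ.smooth hτ.mapsTo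
  transversal q hq := hτ.isTransversalAt h hq (h.transversal _ (hτ.mapsTo hq))
  posDef q hq v hv := by
    rw [hτ.metric_comp h hq]
    refine h.posDef _ (hτ.mapsTo hq) _ fun h0 => hv ((hτ.bijective q hq).1 ?_)
    rw [h0, map_zero]

theorem fderiv_metric_comp (hτ : IsCoordChange τ V U) (h : IsCaDomain ε f U) (hq : q ∈ V)
    (y v w : E') : fderiv ℝ (caMetric ε (f ∘ τ)) q y v w =
      fderiv ℝ (caMetric ε f) (τ q) (fderiv ℝ τ q y) (fderiv ℝ τ q v) (fderiv ℝ τ q w) +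
        caMetric ε f (τ q) (fderiv ℝ (fderiv ℝ τ) q y v) (fderiv ℝ τ q w) +
        caMetric ε f (τ q) (fderiv ℝ τ q v) (fderiv ℝ (fderiv ℝ τ) q y w) := by
  have h' := hτ.isCaDomain h
  have hd : ∀ v : E', HasFDerivAt (fun p => fderiv ℝ τ p v)
      ((fderiv ℝ (fderiv ℝ τ) q).flip v) q := fun v =>
    (((contDiffAt_fderiv (hτ.contDiffAt hq)).differentiableAt
      (by simp)).hasFDerivAt.clm_apply (hasFDerivAt_const v q)).congr_fderiv (by ext; simp)
  have hm := ((h.contDiffAt_metric (hτ.mapsTo hq)).differentiableAt (by simp)).hasFDerivAt.comp q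
    ((hτ.contDiffAt hq).differentiableAt (by simp)).hasFDerivAt
  have h1 := fderiv_clm_apply₂ ((h'.contDiffAt_metric hq).differentiableAt (by simp))
    (differentiableAt_const v) (differentiableAt_const w) y
  have h2 := fderiv_clm_apply₂ hm.differentiableAt (hd v).differentiableAt
    (hd w).differentiableAt y
  have h3 : (fun p => caMetric ε (f ∘ τ) p v w) =ᶠ[nhds q]
      fun p => (caMetric ε f ∘ τ) p (fderiv ℝ τ p v) (fderiv ℝ τ p w) :=
    (hτ.eventually_mem hq).mono fun p hp => hτ.metric_comp h hp v w
  rw [h3.fderiv_eq, h2, hm.fderiv, (hd v).fderiv, (hd w).fderiv] at h1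
  simp at h1
  rw [← h1]

/-- The inhomogeneous term `D²τ` is the same as for the induced connection, so it cancels in `K`
(`diff_comp`). -/
theorem leviCivita_comp (hτ : IsCoordChange τ V U) (h : IsCaDomain ε f U) (hq : q ∈ V)
    (v w : E') : fderiv ℝ τ q (leviCivita (caMetric ε (f ∘ τ)) q v w) =
      leviCivita (caMetric ε f) (τ q) (fderiv ℝ τ q v) (fderiv ℝ τ q w) +
        fderiv ℝ (fderiv ℝ τ) q v w := by
  have hU := hτ.mapsTo hq
  obtain ⟨a, ha⟩ := (hτ.bijective q hq).2
    (leviCivita (caMetric ε f) (τ q) (fderiv ℝ τ q v) (fderiv ℝ τ q w) +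
      fderiv ℝ (fderiv ℝ τ) q v w)
  rw [← ha]
  refine congrArg _ (leviCivita_eq_of ((hτ.isCaDomain h).isInvertible_metric hq) fun z => ?_)
  have hs := fderiv_fderiv_comm (hτ.contDiffAt hq)
  rw [hτ.metric_comp h hq, ha, map_add, add_apply,
    leviCivita_apply (h.isInvertible_metric hU), christoffelFirst_apply, christoffelFirst_apply,
    hτ.fderiv_metric_comp h hq, hτ.fderiv_metric_comp h hq, hτ.fderiv_metric_comp h hq,
    hs w v, hs z v, hs z w, h.metric_symm hU (fderiv ℝ τ q w),
    h.metric_symm hU (fderiv ℝ τ q v) (fderiv ℝ (fderiv ℝ τ) q w z)]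
  ring

theorem diff_comp (hτ : IsCoordChange τ V U) (h : IsCaDomain ε f U) (hq : q ∈ V) (v w : E') :
    fderiv ℝ τ q (caDiff ε (f ∘ τ) q v w) =
      caDiff ε f (τ q) (fderiv ℝ τ q v) (fderiv ℝ τ q w) := by
  have h1 := (hτ.induced_comp h hq v w).1
  have h2 := hτ.leviCivita_comp h hq v w
  rw [caMetric] at h2
  simp [caDiff, diffTensor, h1, h2, caMetric]

/-- The operators `K_v` in the two coordinate systems are conjugate by `dτ`, so their traces agree.
-/
theorem tchebForm_comp (hτ : IsCoordChange τ V U) (h : IsCaDomain ε f U) (hq : q ∈ V) (v : E') :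
    tchebForm ε (f ∘ τ) q v = tchebForm ε f (τ q) (fderiv ℝ τ q v) := by
  let e := LinearEquiv.ofBijective (fderiv ℝ τ q).toLinearMap (hτ.bijective q hq)
  have h1 : e.conj (caDiff ε (f ∘ τ) q v : E' →L[ℝ] E').toLinearMap =
      (caDiff ε f (τ q) (fderiv ℝ τ q v) : E →L[ℝ] E).toLinearMap := by
    ext w
    obtain ⟨w, rfl⟩ := e.surjective w
    simp only [LinearEquiv.conj_apply_apply, LinearEquiv.symm_apply_apply]
    exact hτ.diff_comp h hq v w
  have h2 := LinearMap.trace_conj' (caDiff ε (f ∘ τ) q v : E' →L[ℝ] E').toLinearMap e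
  rw [h1] at h2
  simp [tchebForm, e.finrank_eq, h2]

theorem field_comp (hτ : IsCoordChange τ V U) (h : IsCaDomain ε f U) (hq : q ∈ V) :
    fderiv ℝ τ q (tchebField ε (f ∘ τ) q) = tchebField ε f (τ q) := by
  apply (h.isInvertible_metric (hτ.mapsTo hq)).injective
  ext z
  obtain ⟨z, rfl⟩ := (hτ.bijective q hq).2 z
  rw [← hτ.metric_comp h hq, (hτ.isCaDomain h).metric_tchebField hq,
    h.metric_tchebField (hτ.mapsTo hq), hτ.tchebForm_comp h hq]

theorem operator_comp (hτ : IsCoordChange τ V U) (h : IsCaDomain ε f U) (hq : q ∈ V) (v : E') :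
    fderiv ℝ τ q (tchebOperator ε (f ∘ τ) q v) = tchebOperator ε f (τ q) (fderiv ℝ τ q v) := by
  have h' := hτ.isCaDomain h
  have h1 := (((contDiffAt_fderiv (hτ.contDiffAt hq)).differentiableAt
    (by simp)).hasFDerivAt.clm_apply
    ((h'.contDiffAt_tchebField hq).differentiableAt (by simp)).hasFDerivAt).fderiv
  have h2 := (((h.contDiffAt_tchebField (hτ.mapsTo hq)).differentiableAt
    (by simp)).hasFDerivAt.comp q
    ((hτ.contDiffAt hq).differentiableAt (by simp)).hasFDerivAt).fderiv
  have h3 : (fun p => fderiv ℝ τ p (tchebField ε (f ∘ τ) p)) =ᶠ[nhds q] tchebField ε f ∘ τ :=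
    (hτ.eventually_mem hq).mono fun p hp => hτ.field_comp h hp
  rw [h3.fderiv_eq, h2] at h1
  have h4 := DFunLike.congr_fun h1 v
  simp at h4
  simp [tchebOperator, hτ.leviCivita_comp h hq, hτ.field_comp h hq, h4]
  abel

/-- The hypotheses are invariant under coordinate changes. -/
theorem isTchebDomain (hτ : IsCoordChange τ V U) (h : IsTchebDomain ε f U α lam μ) :
    IsTchebDomain ε (f ∘ τ) V (α ∘ τ) (lam ∘ τ) (μ ∘ τ) where
  toIsCaDomain := hτ.isCaDomain h.toIsCaDomain
  operator_eq q hq := by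
    ext v
    apply (hτ.bijective q hq).1
    rw [hτ.operator_comp h.toIsCaDomain hq, h.operator_eq _ (hτ.mapsTo hq)]
    simp
  diff_self q hq := by
    apply (hτ.bijective q hq).1
    rw [hτ.diff_comp h.toIsCaDomain hq, map_smul, hτ.field_comp h.toIsCaDomain hq,
      h.diff_self _ (hτ.mapsTo hq)]
    rfl
  diff_perp q hq v hv := by
    apply (hτ.bijective q hq).1
    rw [hτ.metric_comp h.toIsCaDomain hq, hτ.field_comp h.toIsCaDomain hq] at hv
    rw [hτ.diff_comp h.toIsCaDomain hq, map_smul, hτ.field_comp h.toIsCaDomain hq,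
      h.diff_perp _ (hτ.mapsTo hq) _ hv]
    rfl
  ne_zero q hq h0 := by
    apply h.ne_zero _ (hτ.mapsTo hq)
    rw [← hτ.field_comp h.toIsCaDomain hq, h0, map_zero]

end IsCoordChange

/-! ### The Poincaré lemma and the inverse function theorem in the form needed for product charts.
-/

section Charts

variable {E G : Type*} [NormedAddCommGroup E] [NormedSpace ℝ E] [CompleteSpace E]
  [NormedAddCommGroup G] [NormedSpace ℝ G] [CompleteSpace G]

/-- The Poincaré lemma for one-forms on an open convex set. -/
theorem exists_hasFDerivAt_of_closed {B : Set E} (hB : IsOpen B) (hc : Convex ℝ B)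
    {σ : E → E →L[ℝ] ℝ} (hσ : ∀ q ∈ B, DifferentiableAt ℝ σ q)
    (hs : ∀ q ∈ B, ∀ v w, fderiv ℝ σ q v w = fderiv ℝ σ q w v) :
    ∃ t : E → ℝ, ∀ q ∈ B, HasFDerivAt t (σ q) q := by
  obtain ⟨t, ht⟩ := hc.exists_forall_hasFDerivWithinAt_of_hasFDerivWithinAt_symmetric
    (fun q hq => (hσ q hq).hasFDerivAt.hasFDerivWithinAt)
    (fun q hq v _ w _ => hs q hq v w)
  exact ⟨t, fun q hq => (ht q hq).hasFDerivAt (hB.mem_nhds hq)⟩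

/-- The inverse function theorem, with a product of an interval and a ball as range. -/
theorem exists_product_chart {g : E → ℝ × G} {q₀ : E} {W : Set E} (hW : IsOpen W) (hq₀ : q₀ ∈ W)
    (hg : ∀ q ∈ W, ContDiffAt ℝ ∞ g q) (hb : Function.Bijective (fderiv ℝ g q₀)) :
    ∃ (Ψ : OpenPartialHomeomorph E (ℝ × G)) (t₀ t₁ : ℝ) (u₀ : G) (r : ℝ),
      (Ψ : E → ℝ × G) = g ∧ q₀ ∈ Ψ.source ∧ Ψ.source ⊆ W ∧ 0 < r ∧
      Ψ.target = Set.Ioo t₀ t₁ ×ˢ Metric.ball u₀ r ∧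
      ∀ q ∈ Ψ.source, Function.Bijective (fderiv ℝ g q) := by
  obtain ⟨e, he⟩ := isInvertible_of_bijective hb
  have hder : HasFDerivAt g (e : E →L[ℝ] ℝ × G) q₀ := by
    rw [he]
    exact ((hg q₀ hq₀).differentiableAt (by simp)).hasFDerivAt
  have hev : ∀ᶠ q in nhds q₀, q ∈ W ∧ Function.Bijective (fderiv ℝ g q) := by
    refine Filter.Eventually.and (hW.mem_nhds hq₀) ?_
    have hcont : ContinuousAt (fderiv ℝ g) q₀ :=
      (contDiffAt_fderiv (hg q₀ hq₀)).continuousAt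
    have hn := e.nhds
    rw [he] at hn
    filter_upwards [hcont.preimage_mem_nhds hn] with q hq
    obtain ⟨e', he'⟩ := hq
    rw [← he']
    exact e'.bijective
  obtain ⟨W', hW', hW'o, hqW'⟩ := mem_nhds_iff.1 hev
  let Ψ₁ := (hg q₀ hq₀).toOpenPartialHomeomorph g hder (by simp)
  have hsrc : q₀ ∈ Ψ₁.source :=
    (hg q₀ hq₀).mem_toOpenPartialHomeomorph_source hder (by simp)
  let Ψ₂ := Ψ₁.restrOpen W' hW'o
  have hcoe : (Ψ₂ : E → ℝ × G) = g := rfl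
  have hsrc2 : q₀ ∈ Ψ₂.source := ⟨hsrc, hqW'⟩
  obtain ⟨r, hr, hball⟩ := Metric.isOpen_iff.1 Ψ₂.open_target (Ψ₂ q₀) (Ψ₂.map_source hsrc2)
  let Ψ := (Ψ₂.symm.restrOpen (Metric.ball (Ψ₂ q₀) r) Metric.isOpen_ball).symm
  have htar : Ψ.target = Metric.ball (Ψ₂ q₀) r := Set.inter_eq_right.2 hball
  have hsub : Ψ.source ⊆ Ψ₂.source := by
    intro q hq
    have h1 : Ψ q ∈ Ψ.target := Ψ.map_source hq
    have h2 : Ψ₂.symm (Ψ q) ∈ Ψ₂.source := Ψ₂.map_target h1.1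
    have h3 : Ψ₂.symm (Ψ q) = q := Ψ.left_inv hq
    rwa [h3] at h2
  refine ⟨Ψ, (g q₀).1 - r, (g q₀).1 + r, (g q₀).2, r, rfl, ?_, fun q hq => (hW' (hsub hq).2).1,
    hr, ?_, fun q hq => (hW' (hsub hq).2).2⟩
  · have h1 : Ψ₂ q₀ ∈ Ψ.target := htar ▸ Metric.mem_ball_self hr
    have h2 := Ψ.map_target h1
    have h3 : Ψ.symm (Ψ₂ q₀) = q₀ := Ψ₂.left_inv hsrc2
    rwa [h3] at h2
  -- A ball for the sup norm on `ℝ × G` is a product of an interval and a ball.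
  · rw [htar, ← Real.ball_eq_Ioo, ball_prod_same, Prod.mk.eta, hcoe]

theorem contDiffAt_of_hasFDerivAt {B : Set E} (hB : IsOpen B) {t : E → ℝ} {σ : E → E →L[ℝ] ℝ}
    (ht : ∀ q ∈ B, HasFDerivAt t (σ q) q) (hσ : ∀ q ∈ B, ContDiffAt ℝ ∞ σ q) {q : E}
    (hq : q ∈ B) : ContDiffAt ℝ ∞ t q := by
  have : ContDiffOn ℝ ∞ t B := by
    rw [contDiffOn_infty_iff_fderiv_of_isOpen hB]
    refine ⟨fun p hp => (ht p hp).differentiableAt.differentiableWithinAt, ?_⟩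
    exact ContDiffOn.congr (fun p hp => (hσ p hp).contDiffWithinAt) fun p hp => (ht p hp).fderiv
  exact this.contDiffAt (hB.mem_nhds hq)

theorem isCoordChange_symm {Ψ : OpenPartialHomeomorph E G} {U : Set E}
    (hU : Ψ.source ⊆ U) (hs : ∀ q ∈ Ψ.source, ContDiffAt ℝ ∞ Ψ q)
    (hb : ∀ q ∈ Ψ.source, Function.Bijective (fderiv ℝ Ψ q)) :
    IsCoordChange Ψ.symm Ψ.target U ∧
      ∀ q ∈ Ψ.target, ∀ v, fderiv ℝ Ψ (Ψ.symm q) (fderiv ℝ Ψ.symm q v) = v := by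
  have hd : ∀ q ∈ Ψ.target, ∃ e : E ≃L[ℝ] G, HasFDerivAt Ψ (e : E →L[ℝ] G) (Ψ.symm q) := by
    intro q hq
    have hq' := Ψ.map_target hq
    obtain ⟨e, he⟩ := isInvertible_of_bijective (hb _ hq')
    exact ⟨e, he ▸ ((hs _ hq').differentiableAt (by simp)).hasFDerivAt⟩
  constructor
  · refine ⟨Ψ.open_target, fun q hq => ?_, fun q hq => hU (Ψ.map_target hq), fun q hq => ?_⟩
    · obtain ⟨e, he⟩ := hd q hq
      exact (Ψ.contDiffAt_symm hq he (hs _ (Ψ.map_target hq))).contDiffWithinAt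
    · obtain ⟨e, he⟩ := hd q hq
      rw [(Ψ.hasFDerivAt_symm hq he).fderiv]
      exact e.symm.bijective
  · intro q hq v
    obtain ⟨e, he⟩ := hd q hq
    rw [(Ψ.hasFDerivAt_symm hq he).fderiv, he.fderiv]
    simp

end Charts

/-! ### Completing a linear form to linear coordinates. -/

section LinearAlgebra

variable {E G : Type*} [NormedAddCommGroup E] [NormedSpace ℝ E] [FiniteDimensional ℝ E]
  [NormedAddCommGroup G] [NormedSpace ℝ G] [FiniteDimensional ℝ G]

theorem exists_complement_coordinates {θ : E →L[ℝ] ℝ} {T : E} (hT : θ T = 1)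
    (hdim : Module.finrank ℝ E = Module.finrank ℝ G + 1) :
    ∃ R : E →L[ℝ] G, R T = 0 ∧ Function.Bijective (θ.prod R) := by
  have h1 := LinearMap.finrank_range_add_finrank_ker θ.toLinearMap
  have h2 : LinearMap.range θ.toLinearMap = ⊤ :=
    LinearMap.range_eq_top.2 fun s => ⟨s • T, by simp [hT]⟩
  rw [h2, finrank_top, Module.finrank_self] at h1
  let e : LinearMap.ker θ.toLinearMap ≃ₗ[ℝ] G := LinearEquiv.ofFinrankEq _ _ (by omega)
  let pr : E →ₗ[ℝ] LinearMap.ker θ.toLinearMap :=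
    LinearMap.codRestrict _ (LinearMap.id - θ.toLinearMap.smulRight T) (by
      intro v
      simp [hT])
  have hpr : ∀ v, (pr v : E) = v - θ v • T := fun v => rfl
  refine ⟨LinearMap.toContinuousLinearMap (e.toLinearMap ∘ₗ pr), ?_, ?_, ?_⟩
  · have : pr T = 0 := Subtype.ext (by rw [hpr]; simp [hT])
    simp [this]
  · intro v w hvw
    simp only [ContinuousLinearMap.prod_apply, Prod.mk.injEq] at hvw
    have h3 : pr v = pr w := e.injective hvw.2
    have h4 := congrArg Subtype.val h3
    rw [hpr, hpr, hvw.1] at h4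
    exact sub_left_injective h4
  · rintro ⟨s, g⟩
    refine ⟨(e.symm g : E) + s • T, ?_⟩
    have h3 : θ (e.symm g : E) = 0 := (e.symm g).2
    have h4 : pr ((e.symm g : E) + s • T) = e.symm g := Subtype.ext (by
      rw [hpr]
      simp [h3, hT])
    simp [h3, hT, h4]

end LinearAlgebra

/-! ### Product coordinates adapted to `T`. -/

namespace IsTchebDomain

variable {E F G : Type*} [NormedAddCommGroup E] [NormedSpace ℝ E] [CompleteSpace E]
  [FiniteDimensional ℝ E] [NormedAddCommGroup F] [NormedSpace ℝ F] [CompleteSpace F]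
  [NormedAddCommGroup G] [NormedSpace ℝ G] [CompleteSpace G] [FiniteDimensional ℝ G]
  {ε : ℝ} {f : E → F} {U : Set E} {α lam μ : E → ℝ} {q₀ : E}

/-- `θ` is closed, and so is `(λ - μ) θ`, since `d(λ - μ)` is a multiple of `θ`. The first potential
becomes the coordinate `t`; the second integrates the equation of the axis. -/
theorem exists_potentials (h : IsTchebDomain ε f U α lam μ) (h3 : 3 ≤ Module.finrank ℝ E)
    (hq₀ : q₀ ∈ U) : ∃ B, IsOpen B ∧ Convex ℝ B ∧ q₀ ∈ B ∧ B ⊆ U ∧ ∃ t s : E → ℝ,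
      ∀ q ∈ B, HasFDerivAt t (tchebDual ε f q) q ∧
        HasFDerivAt s ((lam q - μ q) • tchebDual ε f q) q := by
  obtain ⟨r, hr, hball⟩ := Metric.isOpen_iff.1 h.isOpen q₀ hq₀
  have hc := convex_ball q₀ r
  have hθ : ∀ q ∈ Metric.ball q₀ r, DifferentiableAt ℝ (tchebDual ε f) q := fun q hq =>
    (h.contDiffAt_dual (hball hq)).differentiableAt (by simp)
  have hν : ∀ q ∈ Metric.ball q₀ r, DifferentiableAt ℝ (fun p => lam p - μ p) q := fun q hq =>
    ((h.contDiffAt_lam (hball hq)).sub (h.contDiffAt_mu h3 (hball hq))).differentiableAt (by simp)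
  obtain ⟨t, ht⟩ := exists_hasFDerivAt_of_closed Metric.isOpen_ball hc hθ
    fun q hq => h.fderiv_dual_symm (hball hq)
  obtain ⟨s, hs⟩ := exists_hasFDerivAt_of_closed Metric.isOpen_ball hc
    (σ := fun q => (lam q - μ q) • tchebDual ε f q)
    (fun q hq => (hν q hq).smul (hθ q hq)) (fun q hq v w => by
      have h1 := ((hν q hq).hasFDerivAt.smul (hθ q hq).hasFDerivAt).fderiv
      have h2 := (h.fderiv_alpha_add_mu h3 (hball hq)).2
      erw [h1]
      rw [h2]
      simp [h.fderiv_dual_symm (hball hq) v w]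
      ring)
  exact ⟨_, Metric.isOpen_ball, hc, Metric.mem_ball_self hr, hball, t, s,
    fun q hq => ⟨ht q hq, hs q hq⟩⟩

/-- `exp (-s)` is the integrating factor for `fderiv_axis`. -/
theorem axis_eq_exp_smul (h : IsTchebDomain ε f U α lam μ) (h3 : 3 ≤ Module.finrank ℝ E)
    {B : Set E} (hB : IsOpen B) (hc : Convex ℝ B) (hBU : B ⊆ U) {s : E → ℝ}
    (hs : ∀ q ∈ B, HasFDerivAt s ((lam q - μ q) • tchebDual ε f q) q) {q p : E} (hq : q ∈ B)
    (hp : p ∈ B) : Real.exp (-s q) • (tchebPush ε f q - (α q + μ q) • f q) =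
      Real.exp (-s p) • (tchebPush ε f p - (α p + μ p) • f p) := by
  have hd : ∀ q ∈ B, HasFDerivAt (fun q => Real.exp (-s q) •
      (tchebPush ε f q - (α q + μ q) • f q)) (0 : E →L[ℝ] F) q := by
    intro q hq
    refine ((hs q hq).neg.exp.smul (h.fderiv_axis h3 (hBU hq))).congr_fderiv ?_
    ext v
    simp
    module
  exact hB.is_const_of_fderiv_eq_zero (𝕜 := ℝ) hc.isPreconnected
    (fun q hq => (hd q hq).differentiableAt.differentiableWithinAt)
    (fun q hq => (hd q hq).fderiv) hq hp

/-- Product coordinates in which `T = ∂/∂t` and the slices are orthogonal to `T`. -/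
theorem exists_product_coordinates (h : IsTchebDomain ε f U α lam μ)
    (h3 : 3 ≤ Module.finrank ℝ E) (hdim : Module.finrank ℝ E = Module.finrank ℝ G + 1)
    (hq₀ : q₀ ∈ U) :
    ∃ (Ψ : OpenPartialHomeomorph E (ℝ × G)) (t₀ t₁ : ℝ) (u₀ : G) (r : ℝ),
      q₀ ∈ Ψ.source ∧ Ψ.source ⊆ U ∧ 0 < r ∧ Ψ.target = Set.Ioo t₀ t₁ ×ˢ Metric.ball u₀ r ∧
      ContDiffOn ℝ ∞ Ψ Ψ.source ∧ ContDiffOn ℝ ∞ Ψ.symm Ψ.target ∧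
      IsTchebDomain ε (f ∘ Ψ.symm) Ψ.target (α ∘ Ψ.symm) (lam ∘ Ψ.symm) (μ ∘ Ψ.symm) ∧
      (∀ q ∈ Ψ.target, tchebField ε (f ∘ Ψ.symm) q = (1, 0)) ∧
      ∀ q ∈ Ψ.target, tchebDual ε (f ∘ Ψ.symm) q = ContinuousLinearMap.fst ℝ ℝ G := by
  obtain ⟨B, hB, hc, hqB, hBU, t, s, hts⟩ := h.exists_potentials h3 hq₀
  obtain ⟨R, hRT, hR⟩ := exists_complement_coordinates (G := G) (h.dual_self hq₀) hdim
  obtain ⟨e, he⟩ := (h.transversal q₀ hq₀).isInvertible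
  let J₁ : F →L[ℝ] E := (ContinuousLinearMap.fst ℝ E ℝ).comp e.symm.toContinuousLinearMap
  let J₂ : F →L[ℝ] ℝ := (ContinuousLinearMap.snd ℝ E ℝ).comp e.symm.toContinuousLinearMap
  have hJ : ∀ v c, e.symm (fderiv ℝ f q₀ v + c • f q₀) = (v, c) := by
    intro v c
    rw [e.symm_apply_eq, ← frame_apply, ← he]
    rfl
  have hJv : ∀ v, e.symm (fderiv ℝ f q₀ v) = (v, 0) := fun v => by simpa using hJ v 0
  have hJf : e.symm (f q₀) = (0, 1) := by simpa using hJ 0 1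
  -- `ℓ` and `L` are chosen to kill the axis `Z - (α + μ) f` at `q₀`, with `ℓ (f q₀) = 1` and `L (f
  -- q₀) = 0`. The axis has constant direction, so they kill it throughout `B`.
  let ℓ : F →L[ℝ] ℝ := J₂ + (α q₀ + μ q₀) • (tchebDual ε f q₀).comp J₁
  let L : F →L[ℝ] G := R.comp J₁
  have hℓf : ℓ (f q₀) = 1 := by simp [ℓ, J₁, J₂, hJf]
  have hLf : L (f q₀) = 0 := by simp [L, J₁, hJf]
  have hLv : ∀ v, L (fderiv ℝ f q₀ v) = R v := fun v => by simp [L, J₁, hJv]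
  have hℓT : ℓ (tchebPush ε f q₀) = α q₀ + μ q₀ := by
    simp [ℓ, J₁, J₂, tchebPush, hJv, h.dual_self hq₀]
  have hLT : L (tchebPush ε f q₀) = 0 := by rw [tchebPush, hLv, hRT]
  have haxis : ∀ q ∈ B, tchebPush ε f q - (α q + μ q) • f q = (Real.exp (s q) *
      Real.exp (-s q₀)) • (tchebPush ε f q₀ - (α q₀ + μ q₀) • f q₀) := by
    intro q hq
    rw [mul_smul, ← h.axis_eq_exp_smul h3 hB hc hBU (fun q hq => (hts q hq).2) hq hqB, smul_smul,
      ← Real.exp_add]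
    simp
  have hℓZ : ∀ q ∈ B, ℓ (tchebPush ε f q) = (α q + μ q) * ℓ (f q) := by
    intro q hq
    have := congrArg ℓ (haxis q hq)
    simp only [map_sub, map_smul, hℓT, hℓf, smul_eq_mul] at this
    linear_combination this
  have hLZ : ∀ q ∈ B, L (tchebPush ε f q) = (α q + μ q) • L (f q) := by
    intro q hq
    have := congrArg L (haxis q hq)
    simp only [map_sub, map_smul, hLT, hLf, smul_zero, sub_zero] at this
    exact sub_eq_zero.1 this
  have hfc : ContinuousOn f B := (h.smooth.continuousOn).mono hBU
  let W : Set E := B ∩ (fun q => ℓ (f q)) ⁻¹' {0}ᶜ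
  have hWo : IsOpen W :=
    (ℓ.continuous.comp_continuousOn hfc).isOpen_inter_preimage hB isOpen_compl_singleton
  have hqW : q₀ ∈ W := ⟨hqB, by simp [hℓf]⟩
  -- Along `T` both `ℓ (f ·)` and `L (f ·)` grow at the rate `α + μ`, so their quotient is constant
  -- on the integral curves of `T`. This projection along the axis gives slice coordinates without
  -- integrating the flow of `T`.
  let g : E → ℝ × G := fun q => (t q, (ℓ (f q))⁻¹ • L (f q))
  have hts' : ∀ q ∈ B, ContDiffAt ℝ ∞ t q := fun q hq =>
    contDiffAt_of_hasFDerivAt hB (fun p hp => (hts p hp).1)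
      (fun p hp => h.contDiffAt_dual (hBU hp)) hq
  have hgs : ∀ q ∈ W, ContDiffAt ℝ ∞ g q := by
    intro q hq
    have hf := h.contDiffAt (hBU hq.1)
    exact (hts' q hq.1).prodMk (((ℓ.contDiff.contDiffAt.comp q hf).inv hq.2).smul
      (L.contDiff.contDiffAt.comp q hf))
  have hgd : ∀ q ∈ W, ∀ v, fderiv ℝ g q v = (tchebDual ε f q v, (ℓ (f q))⁻¹ •
      L (fderiv ℝ f q v) - ((ℓ (f q) ^ 2)⁻¹ * ℓ (fderiv ℝ f q v)) • L (f q)) := by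
    intro q hq v
    have hf := ((h.contDiffAt (hBU hq.1)).differentiableAt (by simp)).hasFDerivAt
    have hℓ : HasFDerivAt (fun p => ℓ (f p)) (ℓ.comp (fderiv ℝ f q)) q :=
      ℓ.hasFDerivAt.comp q hf
    have hL : HasFDerivAt (fun p => L (f p)) (L.comp (fderiv ℝ f q)) q :=
      L.hasFDerivAt.comp q hf
    have hi := (hasDerivAt_inv hq.2).comp_hasFDerivAt q hℓ
    have h4 := ((hts q hq.1).1.prodMk (hi.smul hL)).fderiv
    erw [h4]
    simp
    module
  have hb : Function.Bijective (fderiv ℝ g q₀) := by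
    -- The normalization of `ℓ` and `L` at `q₀` reduces the quotient rule to `R`.
    have : fderiv ℝ g q₀ = (tchebDual ε f q₀).prod R := by
      refine ContinuousLinearMap.ext fun v => ?_
      rw [hgd q₀ hqW]
      simp [hℓf, hLf, hLv]
    rw [this]
    exact hR
  obtain ⟨Ψ, t₀, t₁, u₀, r, hΨ, hsrc, hΨW, hr, htar, hbij⟩ :=
    exists_product_chart hWo hqW hgs hb
  have hΨU : Ψ.source ⊆ U := fun q hq => hBU (hΨW hq).1
  have hΨs : ∀ q ∈ Ψ.source, ContDiffAt ℝ ∞ Ψ q := fun q hq => hΨ ▸ hgs q (hΨW hq)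
  obtain ⟨hcc, hinv⟩ := isCoordChange_symm hΨU hΨs (by rwa [hΨ])
  have hdom := hcc.isTchebDomain h
  have hfield : ∀ q ∈ Ψ.target, tchebField ε (f ∘ Ψ.symm) q = (1, 0) := by
    intro q hq
    have hqs := Ψ.map_target hq
    have hne : ℓ (f (Ψ.symm q)) ≠ 0 := (hΨW hqs).2
    rw [← hinv q hq (tchebField ε (f ∘ Ψ.symm) q), hcc.field_comp h.toIsCaDomain hq, hΨ,
      hgd _ (hΨW hqs), h.dual_self (hΨU hqs), ← tchebPush, hℓZ _ (hΨW hqs).1, hLZ _ (hΨW hqs).1,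
      smul_smul, ← sub_smul]
    have : (ℓ (f (Ψ.symm q)))⁻¹ * (α (Ψ.symm q) + μ (Ψ.symm q)) - (ℓ (f (Ψ.symm q)) ^ 2)⁻¹ *
        ((α (Ψ.symm q) + μ (Ψ.symm q)) * ℓ (f (Ψ.symm q))) = 0 := by
      field_simp
      ring
    rw [this, zero_smul]
  refine ⟨Ψ, t₀, t₁, u₀, r, hsrc, hΨU, hr, htar,
    fun q hq => (hΨs q hq).contDiffWithinAt, hcc.smooth, hdom, hfield, fun q hq => ?_⟩
  refine ContinuousLinearMap.ext fun v => ?_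
  have hqs := Ψ.map_target hq
  have h1 := congrArg Prod.fst (hinv q hq v)
  rw [hΨ, hgd _ (hΨW hqs)] at h1
  rw [ContinuousLinearMap.coe_fst', ← h1]
  simp only [tchebDual, tchebNormSq, hcc.metric_comp h.toIsCaDomain hq,
    hcc.field_comp h.toIsCaDomain hq, smul_apply]

end IsTchebDomain

/-! ### The derivative of a determinant. -/

section Jacobi

variable {X : Type*} [NormedAddCommGroup X] [NormedSpace ℝ X] {ι : Type*} [Fintype ι]
  [DecidableEq ι]

theorem det_updateRow_eq_sum (A : Matrix ι ι ℝ) (i : ι) (b : ι → ℝ) :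
    (A.updateRow i b).det = ∑ j, b j * A.adjugate j i := by
  rw [← Matrix.cramer_transpose_apply, Matrix.cramer_eq_adjugate_mulVec, Matrix.mulVec,
    dotProduct, ← Matrix.adjugate_transpose]
  exact Finset.sum_congr rfl fun j _ => mul_comm _ _

/-- Jacobi's formula for the derivative of a determinant. -/
theorem fderiv_det {M : X → Matrix ι ι ℝ} {M' : ι → ι → X →L[ℝ] ℝ} {q : X}
    (hM : ∀ i j, HasFDerivAt (fun p => M p i j) (M' i j) q) :
    DifferentiableAt ℝ (fun p => (M p).det) q ∧ ∀ y, fderiv ℝ (fun p => (M p).det) q y =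
      ((Matrix.of fun i j => M' i j y) * (M q).adjugate).trace := by
  let D : ContinuousMultilinearMap ℝ (fun _ : ι => ι → ℝ) ℝ :=
    { (Matrix.detRowAlternating (R := ℝ) (n := ι)).toMultilinearMap with
      cont := Continuous.matrix_det (A := fun M : Matrix ι ι ℝ => M) continuous_id }
  let R : X → ι → ι → ℝ := fun p i j => M p i j
  have hM2 : HasFDerivAt R
      (ContinuousLinearMap.pi fun i => ContinuousLinearMap.pi fun j => M' i j) q :=
    hasFDerivAt_pi.2 fun i => hasFDerivAt_pi.2 fun j => hM i j
  have h1 := (D.hasFDerivAt (R q)).comp q hM2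
  have h2 : (fun p => (M p).det) = D ∘ R := rfl
  rw [h2]
  refine ⟨h1.differentiableAt, fun y => ?_⟩
  rw [h1.fderiv, ContinuousLinearMap.comp_apply, ContinuousMultilinearMap.linearDeriv_apply]
  refine Finset.sum_congr rfl fun i _ => ?_
  exact det_updateRow_eq_sum (M q) i fun j => M' i j y

theorem fderiv_det_of_eq_mul_add_mul {M : X → Matrix ι ι ℝ} {M' : ι → ι → X →L[ℝ] ℝ} {q : X}
    (hM : ∀ i j, HasFDerivAt (fun p => M p i j) (M' i j) q) {y : X} {A B : Matrix ι ι ℝ}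
    (hAB : (Matrix.of fun i j => M' i j y) = A * M q + M q * B) :
    fderiv ℝ (fun p => (M p).det) q y = (A.trace + B.trace) * (M q).det := by
  rw [(fderiv_det hM).2, hAB, add_mul, Matrix.trace_add, mul_assoc, Matrix.mul_adjugate,
    mul_assoc, Matrix.trace_mul_comm (M q), mul_assoc, Matrix.adjugate_mul]
  simp
  ring

end Jacobi

/-! ### Apolarity: comparing the induced volume with the metric volume. -/

section Volume

variable {m : ℕ}

theorem sum_smul_single (v : EuclideanSpace ℝ (Fin m)) :
    ∑ i, v i • EuclideanSpace.single i (1 : ℝ) = v := by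
  have := (EuclideanSpace.basisFun (Fin m) ℝ).sum_repr v
  simpa using this

theorem trace_eq_sum_single (A : EuclideanSpace ℝ (Fin m) →ₗ[ℝ] EuclideanSpace ℝ (Fin m)) :
    LinearMap.trace ℝ _ A = ∑ i, A (EuclideanSpace.single i 1) i := by
  rw [LinearMap.trace_eq_matrix_trace ℝ (EuclideanSpace.basisFun (Fin m) ℝ).toBasis]
  simp [Matrix.trace, LinearMap.toMatrix_apply]

/-- The matrix whose rows are `φ_* e_1, …, φ_* e_m, ξ`. -/
def frameMatrix (φ ξ : EuclideanSpace ℝ (Fin m) → EuclideanSpace ℝ (Fin (m + 1)))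
    (u : EuclideanSpace ℝ (Fin m)) : Matrix (Fin (m + 1)) (Fin (m + 1)) ℝ :=
  Matrix.of fun i j : Fin (m + 1) =>
    (Fin.snoc (α := fun _ => EuclideanSpace ℝ (Fin (m + 1)))
      (fun k : Fin m => fderiv ℝ φ u (EuclideanSpace.single k 1)) (ξ u) i) j

/-- The Gram matrix of `g` in the standard basis. -/
def gramMatrix (g : EuclideanSpace ℝ (Fin m) →L[ℝ] EuclideanSpace ℝ (Fin m) →L[ℝ] ℝ) :
    Matrix (Fin m) (Fin m) ℝ :=
  Matrix.of fun i j : Fin m => g (EuclideanSpace.single i 1) (EuclideanSpace.single j 1)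

variable {φ ξ : EuclideanSpace ℝ (Fin m) → EuclideanSpace ℝ (Fin (m + 1))}
  {N : Set (EuclideanSpace ℝ (Fin m))} {u : EuclideanSpace ℝ (Fin m)}

theorem frameMatrix_castSucc (i : Fin m) (j : Fin (m + 1)) :
    frameMatrix φ ξ u i.castSucc j = fderiv ℝ φ u (EuclideanSpace.single i 1) j := by
  simp [frameMatrix]

theorem frameMatrix_last (j : Fin (m + 1)) : frameMatrix φ ξ u (Fin.last m) j = ξ u j := by
  simp [frameMatrix]

theorem det_frameMatrix_ne_zero (h : IsTransversalAt φ ξ u) : (frameMatrix φ ξ u).det ≠ 0 := by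
  intro h0
  obtain ⟨c, hc, hc0⟩ := Matrix.exists_vecMul_eq_zero_iff.2 h0
  let v : EuclideanSpace ℝ (Fin m) := WithLp.toLp 2 fun i => c i.castSucc
  have h1 : frame φ ξ u (v, c (Fin.last m)) = frame φ ξ u (0, 0) := by
    rw [frame_apply, frame_apply]
    nth_rw 1 [← sum_smul_single v]
    ext j
    have := congrFun hc0 j
    simp only [Matrix.vecMul, dotProduct, Fin.sum_univ_castSucc, frameMatrix_castSucc,
      frameMatrix_last] at this
    simpa [v] using this
  have h2 := h.1 h1
  simp only [Prod.mk.injEq] at h2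
  apply hc
  ext i
  refine Fin.lastCases h2.2 (fun i => ?_) i
  exact congrArg (fun w : EuclideanSpace ℝ (Fin m) => w i) h2.1

theorem metricVolSq_pos
    {g : EuclideanSpace ℝ (Fin m) →L[ℝ] EuclideanSpace ℝ (Fin m) →L[ℝ] ℝ}
    (hs : ∀ v w, g v w = g w v) (hg : ∀ v, v ≠ 0 → 0 < g v v) : 0 < metricVolSq g := by
  refine Matrix.PosDef.det_pos (Matrix.PosDef.of_dotProduct_mulVec_pos ?_ ?_)
  · ext i j
    simp [hs]
  · intro x hx
    have h1 : WithLp.toLp 2 x ≠ (0 : EuclideanSpace ℝ (Fin m)) := by simpa using hx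
    have h2 := hg _ h1
    rw [← sum_smul_single (WithLp.toLp 2 x)] at h2
    simp only [map_sum, map_smul, sum_apply, smul_apply, smul_eq_mul, Finset.mul_sum] at h2
    rw [Finset.sum_comm] at h2
    simpa [dotProduct, Matrix.mulVec, Finset.mul_sum, mul_left_comm, mul_comm, mul_assoc] using h2

/-- The induced connection preserves the volume induced by an equiaffine field, so the logarithmic
derivative of the coordinate determinant is `Tr ∇_y`. The square gives the factor `2`. -/
theorem fderiv_inducedVolSq (hN : IsOpen N) (hφ : ContDiffOn ℝ ∞ φ N) (hξ : ContDiffOn ℝ ∞ ξ N)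
    (ht : IsTransversalAt φ ξ u) (hu : u ∈ N) {y a : EuclideanSpace ℝ (Fin m)}
    (ha : fderiv ℝ ξ u y = fderiv ℝ φ u a) :
    DifferentiableAt ℝ (inducedVolSq φ ξ) u ∧ fderiv ℝ (inducedVolSq φ ξ) u y =
      2 * LinearMap.trace ℝ _ (inducedConn φ ξ u y).toLinearMap * inducedVolSq φ ξ u := by
  have hφu := hφ.contDiffAt (hN.mem_nhds hu)
  have hξu := (hξ.contDiffAt (hN.mem_nhds hu)).differentiableAt (by simp)
  have hφd := (contDiffAt_fderiv hφu).differentiableAt (by simp)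
  let rowD : Fin (m + 1) → EuclideanSpace ℝ (Fin m) →L[ℝ] EuclideanSpace ℝ (Fin (m + 1)) :=
    Fin.snoc (α := fun _ => EuclideanSpace ℝ (Fin m) →L[ℝ] EuclideanSpace ℝ (Fin (m + 1)))
      (fun k => (fderiv ℝ (fderiv ℝ φ) u).flip (EuclideanSpace.single k 1)) (fderiv ℝ ξ u)
  let M' : Fin (m + 1) → Fin (m + 1) → EuclideanSpace ℝ (Fin m) →L[ℝ] ℝ := fun i j =>
    (EuclideanSpace.proj j : EuclideanSpace ℝ (Fin (m + 1)) →L[ℝ] ℝ).comp (rowD i)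
  have hM : ∀ i j, HasFDerivAt (fun p => frameMatrix φ ξ p i j) (M' i j) u := by
    intro i j
    refine (EuclideanSpace.proj j : EuclideanSpace ℝ (Fin (m + 1)) →L[ℝ] ℝ).hasFDerivAt.comp u
      (f := fun p => (Fin.snoc (α := fun _ => EuclideanSpace ℝ (Fin (m + 1)))
      (fun k : Fin m => fderiv ℝ φ p (EuclideanSpace.single k 1)) (ξ p) i)) ?_
    refine Fin.lastCases ?_ (fun i => ?_) i
    · simpa [rowD] using hξu.hasFDerivAt
    · have := hφd.hasFDerivAt.clm_apply
        (hasFDerivAt_const (EuclideanSpace.single i (1 : ℝ)) u)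
      simpa [rowD] using this
  -- The rows of `A` are the coefficients of the derivatives of the frame in the frame itself, from
  -- the Gauss formula and from `ha`. The last diagonal entry is `0` because `dξ` is tangential, so
  -- the trace involves the connection only.
  let A : Matrix (Fin (m + 1)) (Fin (m + 1)) ℝ := Matrix.of
    (Fin.snoc (α := fun _ => Fin (m + 1) → ℝ)
      (fun k => Fin.snoc (α := fun _ => ℝ)
        (fun l => inducedConn φ ξ u y (EuclideanSpace.single k 1) l)
        (inducedMetric φ ξ u y (EuclideanSpace.single k 1)))
      (Fin.snoc (α := fun _ => ℝ) (fun l => a l) 0))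
  have hA : (Matrix.of fun i j => M' i j y) = A * frameMatrix φ ξ u +
      frameMatrix φ ξ u * 0 := by
    ext i j
    rw [Matrix.mul_zero, add_zero, Matrix.mul_apply, Fin.sum_univ_castSucc]
    simp only [frameMatrix_castSucc, frameMatrix_last]
    have hsum : ∀ v : EuclideanSpace ℝ (Fin m), ∑ l, v l *
        (fderiv ℝ φ u (EuclideanSpace.single l 1)) j = fderiv ℝ φ u v j := by
      intro v
      conv_rhs => rw [← sum_smul_single v]
      simp
    refine Fin.lastCases ?_ (fun i => ?_) i
    · simp [A, M', rowD, hsum, ha]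
    · simp [A, M', rowD, hsum, gauss_formula ht]
  have h1 := fderiv_det_of_eq_mul_add_mul hM hA
  have h2 : inducedVolSq φ ξ = fun p => (frameMatrix φ ξ p).det ^ 2 := rfl
  have h3 : A.trace = LinearMap.trace ℝ _ (inducedConn φ ξ u y).toLinearMap := by
    rw [trace_eq_sum_single, Matrix.trace, Fin.sum_univ_castSucc]
    simp [A]
  have h4 := (fderiv_det hM).1
  rw [h2]
  refine ⟨h4.pow 2, ?_⟩
  have h5 := (h4.hasFDerivAt.pow 2).fderiv
  erw [h5]
  simp [h1, h3]
  ring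

/-- Metric compatibility reads `dG = A G + G Aᵀ` for the Gram matrix `G` and the matrix `A` of
Christoffel symbols. Jacobi's formula then gives `2 Tr A`. -/
theorem fderiv_metricVolSq
    {g : EuclideanSpace ℝ (Fin m) → EuclideanSpace ℝ (Fin m) →L[ℝ] EuclideanSpace ℝ (Fin m) →L[ℝ] ℝ}
    (hg : DifferentiableAt ℝ g u) (hi : (g u).IsInvertible)
    (hs : ∀ᶠ p in nhds u, ∀ v w, g p v w = g p w v) (y : EuclideanSpace ℝ (Fin m)) :
    DifferentiableAt ℝ (fun p => metricVolSq (g p)) u ∧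
      fderiv ℝ (fun p => metricVolSq (g p)) u y =
        2 * LinearMap.trace ℝ _ (leviCivita g u y).toLinearMap * metricVolSq (g u) := by
  let e : Fin m → EuclideanSpace ℝ (Fin m) := fun i => EuclideanSpace.single i 1
  let M' : Fin m → Fin m → EuclideanSpace ℝ (Fin m) →L[ℝ] ℝ := fun i j =>
    ((fderiv ℝ g u).flip (e i)).flip (e j)
  have hM : ∀ i j, HasFDerivAt (fun p => gramMatrix (g p) i j) (M' i j) u := by
    intro i j
    refine ((hg.hasFDerivAt.clm_apply (hasFDerivAt_const (e i) u)).clm_apply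
      (hasFDerivAt_const (e j) u)).congr_fderiv ?_
    ext
    simp [M']
  let A : Matrix (Fin m) (Fin m) ℝ := Matrix.of fun i k => leviCivita g u y (e i) k
  have hA : (Matrix.of fun i j => M' i j y) = A * gramMatrix (g u) +
      gramMatrix (g u) * A.transpose := by
    ext i j
    have h1 : ∀ v w, ∑ k, v k * g u (e k) w = g u v w := by
      intro v w
      conv_rhs => rw [← sum_smul_single v]
      simp [e]
    have h2 : ∀ v w, ∑ k, g u v (e k) * w k = g u v w := by
      intro v w
      conv_rhs => rw [← sum_smul_single w]
      simp [e, mul_comm]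
    simp only [Matrix.add_apply, Matrix.mul_apply, gramMatrix, Matrix.of_apply,
      Matrix.transpose_apply, A]
    rw [h1, h2]
    simp only [M', ContinuousLinearMap.flip_apply]
    exact fderiv_metric_eq hg hi hs _ _ _
  have h1 := fderiv_det_of_eq_mul_add_mul hM hA
  refine ⟨(fderiv_det hM).1, ?_⟩
  have h2 : (fun p => metricVolSq (g p)) = fun p => (gramMatrix (g p)).det := rfl
  rw [h2, h1, trace_eq_sum_single, Matrix.trace_transpose]
  have h3 : metricVolSq (g u) = (gramMatrix (g u)).det := rfl
  have h4 : ∑ i, ((leviCivita g u y).toLinearMap (EuclideanSpace.single i 1)) i = A.trace := rfl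
  rw [h3, h4]
  ring

/-- If the difference tensor is trace-free (apolarity), then the volume induced by an equiaffine
transversal field is a constant multiple of the volume of the affine metric. -/
theorem exists_inducedVolSq_eq (hN : IsOpen N) (hc : IsPreconnected N)
    (hφ : ContDiffOn ℝ ∞ φ N) (hξ : ContDiffOn ℝ ∞ ξ N)
    (ht : ∀ u ∈ N, IsTransversalAt φ ξ u)
    (hp : ∀ u ∈ N, ∀ v, v ≠ 0 → 0 < inducedMetric φ ξ u v v)
    (he : ∀ u ∈ N, ∀ v, fderiv ℝ ξ u v ∈ Set.range (fderiv ℝ φ u))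
    (htr : ∀ u ∈ N, ∀ v, LinearMap.trace ℝ _ (diffTensor φ ξ u v).toLinearMap = 0) :
    ∃ c : ℝ, 0 < c ∧ ∀ u ∈ N, inducedVolSq φ ξ u = c * metricVolSq (inducedMetric φ ξ u) := by
  rcases N.eq_empty_or_nonempty with rfl | ⟨u₀, hu₀⟩
  · exact ⟨1, one_pos, by simp⟩
  have hsym : ∀ u ∈ N, ∀ v w, inducedMetric φ ξ u v w = inducedMetric φ ξ u w v :=
    fun u hu v w => (induced_symm (ht u hu) (hφ.contDiffAt (hN.mem_nhds hu)) v w).2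
  have hmp : ∀ u ∈ N, 0 < metricVolSq (inducedMetric φ ξ u) := fun u hu =>
    metricVolSq_pos (hsym u hu) (hp u hu)
  have hvp : ∀ u ∈ N, 0 < inducedVolSq φ ξ u := fun u hu =>
    sq_pos_of_ne_zero (det_frameMatrix_ne_zero (ht u hu))
  -- The logarithmic derivative of the ratio is `2 Tr (∇ - ∇̂)`, which vanishes by `htr`.
  have hd : ∀ u ∈ N, HasFDerivAt (fun p => inducedVolSq φ ξ p *
      (metricVolSq (inducedMetric φ ξ p))⁻¹) (0 : EuclideanSpace ℝ (Fin m) →L[ℝ] ℝ) u := by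
    intro u hu
    have hg := (contDiffAt_induced (ht u hu) (hφ.contDiffAt (hN.mem_nhds hu))
      (hξ.contDiffAt (hN.mem_nhds hu))).2.differentiableAt (by simp)
    have hs : ∀ᶠ p in nhds u, ∀ v w, inducedMetric φ ξ p v w = inducedMetric φ ξ p w v :=
      Filter.mem_of_superset (hN.mem_nhds hu) hsym
    have h1 := fun y => fderiv_metricVolSq hg (isInvertible_of_posDef (hp u hu)) hs y
    have h2 : ∀ y, DifferentiableAt ℝ (inducedVolSq φ ξ) u ∧ fderiv ℝ (inducedVolSq φ ξ) u y =
        2 * LinearMap.trace ℝ _ (inducedConn φ ξ u y).toLinearMap * inducedVolSq φ ξ u := by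
      intro y
      obtain ⟨a, ha⟩ := he u hu y
      exact fderiv_inducedVolSq hN hφ hξ (ht u hu) hu ha.symm
    have hi := (hasDerivAt_inv (hmp u hu).ne').comp_hasFDerivAt u (h1 0).1.hasFDerivAt
    refine ((h2 0).1.hasFDerivAt.mul hi).congr_fderiv ?_
    ext y
    have h3 := htr u hu y
    have h4 : (diffTensor φ ξ u y).toLinearMap = (inducedConn φ ξ u y).toLinearMap -
      (leviCivita (inducedMetric φ ξ) u y).toLinearMap := rfl
    rw [h4, map_sub, sub_eq_zero] at h3
    have h5 := (hmp u hu).ne'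
    simp [(h1 y).2, (h2 y).2, h3]
    field_simp
    ring
  refine ⟨inducedVolSq φ ξ u₀ * (metricVolSq (inducedMetric φ ξ u₀))⁻¹,
    mul_pos (hvp u₀ hu₀) (inv_pos.2 (hmp u₀ hu₀)), fun u hu => ?_⟩
  rw [← hN.is_const_of_fderiv_eq_zero (𝕜 := ℝ) hc
    (fun q hq => (hd q hq).differentiableAt.differentiableWithinAt)
    (fun q hq => (hd q hq).fderiv) hu hu₀]
  have h5 := (hmp u hu).ne'
  field_simp

end Volume

/-! ### Geometry in the product coordinates. -/

/-- A coordinate domain `I × N` with `T = ∂/∂t`, in which `dt` is the form dual to `T`. -/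
structure IsTchebProductDomain {F G : Type*} [NormedAddCommGroup F] [NormedSpace ℝ F]
    [NormedAddCommGroup G] [NormedSpace ℝ G] [FiniteDimensional ℝ G] (ε : ℝ) (f : ℝ × G → F)
    (I : Set ℝ) (N : Set G) (α lam μ : ℝ × G → ℝ) : Prop
    extends IsTchebDomain ε f (I ×ˢ N) α lam μ where
  isOpen_time : IsOpen I
  convex_time : Convex ℝ I
  isOpen_base : IsOpen N
  convex_base : Convex ℝ N
  three_le : 3 ≤ Module.finrank ℝ (ℝ × G)
  field_eq : ∀ q ∈ I ×ˢ N, tchebField ε f q = (1, 0)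
  dual_eq : ∀ q ∈ I ×ˢ N, tchebDual ε f q = ContinuousLinearMap.fst ℝ ℝ G

namespace IsTchebProductDomain

variable {F G : Type*} [NormedAddCommGroup F] [NormedSpace ℝ F] [CompleteSpace F]
  [NormedAddCommGroup G] [NormedSpace ℝ G] [CompleteSpace G] [FiniteDimensional ℝ G]
  {ε : ℝ} {f : ℝ × G → F} {I : Set ℝ} {N : Set G} {α lam μ : ℝ × G → ℝ}

section Constancy

variable {X : Type*} [NormedAddCommGroup X] [NormedSpace ℝ X] {k : ℝ × G → X}
  {k' : ℝ × G → ℝ × G →L[ℝ] X}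

theorem hasFDerivAt_slice {D : ℝ × G →L[ℝ] X} {t : ℝ} {u : G} (hk : HasFDerivAt k D (t, u)) :
    HasFDerivAt (fun w => k (t, w)) (D.comp (ContinuousLinearMap.inr ℝ ℝ G)) u :=
  hk.comp u (hasFDerivAt_prodMk_right t u)

theorem eq_of_base (h : IsTchebProductDomain ε f I N α lam μ)
    (hk : ∀ q ∈ I ×ˢ N, HasFDerivAt k (k' q) q) (h0 : ∀ q ∈ I ×ˢ N, ∀ v, k' q (0, v) = 0)
    {t : ℝ} (ht : t ∈ I) {u w : G} (hu : u ∈ N) (hw : w ∈ N) : k (t, u) = k (t, w) := by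
  have hd : ∀ u ∈ N, HasFDerivAt (fun w => k (t, w)) (0 : G →L[ℝ] X) u := fun u hu =>
    (hasFDerivAt_slice (hk (t, u) ⟨ht, hu⟩)).congr_fderiv (by
      ext v
      simpa using h0 _ ⟨ht, hu⟩ v)
  exact h.isOpen_base.is_const_of_fderiv_eq_zero (𝕜 := ℝ) h.convex_base.isPreconnected
    (fun q hq => (hd q hq).differentiableAt.differentiableWithinAt)
    (fun q hq => (hd q hq).fderiv) hu hw

theorem eq_of_time (h : IsTchebProductDomain ε f I N α lam μ)
    (hk : ∀ q ∈ I ×ˢ N, HasFDerivAt k (k' q) q) (h0 : ∀ q ∈ I ×ˢ N, k' q (1, 0) = 0)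
    {t s : ℝ} (ht : t ∈ I) (hs : s ∈ I) {u : G} (hu : u ∈ N) : k (t, u) = k (s, u) := by
  have hd : ∀ t ∈ I, HasFDerivAt (fun s => k (s, u)) (0 : ℝ →L[ℝ] X) t := fun t ht =>
    ((hk (t, u) ⟨ht, hu⟩).comp t (hasFDerivAt_prodMk_left t u)).congr_fderiv (by
      ext
      simpa using h0 _ ⟨ht, hu⟩)
  exact h.isOpen_time.is_const_of_fderiv_eq_zero (𝕜 := ℝ) h.convex_time.isPreconnected
    (fun q hq => (hd q hq).differentiableAt.differentiableWithinAt)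
    (fun q hq => (hd q hq).fderiv) ht hs

theorem eq_of_forall (h : IsTchebProductDomain ε f I N α lam μ)
    (hk : ∀ q ∈ I ×ˢ N, HasFDerivAt k (0 : ℝ × G →L[ℝ] X) q)
    {p q : ℝ × G} (hp : p ∈ I ×ˢ N) (hq : q ∈ I ×ˢ N) : k p = k q :=
  (h.eq_of_base (k' := fun _ => 0) hk (by simp) hp.1 hp.2 hq.2).trans
    (h.eq_of_time (k' := fun _ => 0) hk (by simp) hp.1 hq.1 hq.2)

end Constancy

section Functions

variable {t s : ℝ} {u w : G}

theorem dual_apply (h : IsTchebProductDomain ε f I N α lam μ) {q : ℝ × G} (hq : q ∈ I ×ˢ N)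
    (y : ℝ × G) : tchebDual ε f q y = y.1 := by
  rw [h.dual_eq q hq]
  rfl

theorem normSq_eq (h : IsTchebProductDomain ε f I N α lam μ) (ht : t ∈ I) (hu : u ∈ N)
    (hw : w ∈ N) : tchebNormSq ε f (t, u) = tchebNormSq ε f (t, w) :=
  h.eq_of_base (fun _ hq => ((h.contDiffAt_normSq hq).differentiableAt (by simp)).hasFDerivAt)
    (fun q hq v => by rw [h.fderiv_normSq hq, h.dual_apply hq, mul_zero]) ht hu hw

theorem alpha_eq (h : IsTchebProductDomain ε f I N α lam μ) (ht : t ∈ I) (hu : u ∈ N)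
    (hw : w ∈ N) : α (t, u) = α (t, w) :=
  h.eq_of_base (fun _ hq => ((h.contDiffAt_alpha hq).differentiableAt (by simp)).hasFDerivAt)
    (fun q hq v => by
      rw [h.fderiv_alpha h.three_le hq, smul_apply, h.dual_apply hq, smul_zero]) ht hu hw

theorem mu_eq (h : IsTchebProductDomain ε f I N α lam μ) (ht : t ∈ I) (hu : u ∈ N)
    (hw : w ∈ N) : μ (t, u) = μ (t, w) :=
  h.eq_of_base
    (fun _ hq => ((h.contDiffAt_mu h.three_le hq).differentiableAt (by simp)).hasFDerivAt)
    (fun q hq v => by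
      rw [h.fderiv_mu h.three_le hq, smul_apply, h.dual_apply hq, smul_zero]) ht hu hw

theorem lam_eq (h : IsTchebProductDomain ε f I N α lam μ) (ht : t ∈ I) (hu : u ∈ N)
    (hw : w ∈ N) : lam (t, u) = lam (t, w) :=
  h.eq_of_base (fun _ hq => ((h.contDiffAt_lam hq).differentiableAt (by simp)).hasFDerivAt)
    (fun q hq v => by
      obtain ⟨c, hc⟩ := h.exists_fderiv_lam h.three_le hq
      rw [hc, smul_apply, h.dual_apply hq, smul_zero]) ht hu hw

theorem metric_time (h : IsTchebProductDomain ε f I N α lam μ) {q : ℝ × G} (hq : q ∈ I ×ˢ N)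
    (y : ℝ × G) : caMetric ε f q (1, 0) y = tchebNormSq ε f q * y.1 := by
  rw [← h.field_eq q hq, h.metric_field hq, h.dual_apply hq]

theorem metric_prod (h : IsTchebProductDomain ε f I N α lam μ) {q : ℝ × G} (hq : q ∈ I ×ˢ N)
    (y z : ℝ × G) : caMetric ε f q y z =
      tchebNormSq ε f q * (y.1 * z.1) + caMetric ε f q (0, y.2) (0, z.2) := by
  have h1 : ∀ y : ℝ × G, y = y.1 • (1, 0) + (0, y.2) := fun y => by simp
  have h2 : caMetric ε f q (0, y.2) (1, 0) = 0 := by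
    rw [h.metric_symm hq, h.metric_time hq, mul_zero]
  conv_lhs => rw [h1 y, h1 z]
  simp only [map_add, map_smul, add_apply, smul_apply, h.metric_time hq, h2]
  simp
  ring

/-- The components of `T` are constant here, so `∇̂_y T = α y` is a statement about Christoffel
symbols alone. -/
theorem leviCivita_time (h : IsTchebProductDomain ε f I N α lam μ) {q : ℝ × G}
    (hq : q ∈ I ×ˢ N) (y : ℝ × G) : leviCivita (caMetric ε f) q (1, 0) y = α q • y := by
  have h1 := h.fderiv_field hq y
  have h2 : tchebField ε f =ᶠ[nhds q] fun _ => (1, 0) :=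
    (h.eventually_mem hq).mono fun p hp => h.field_eq p hp
  rw [h2.fderiv_eq, h.field_eq q hq, h.leviCivita_symm hq] at h1
  simp only [fderiv_fun_const, Pi.zero_apply, zero_apply] at h1
  exact (sub_eq_zero.1 h1.symm).symm

/-- The conformal class of the slices does not depend on `t`. -/
theorem metric_base_div (h : IsTchebProductDomain ε f I N α lam μ) (ht : t ∈ I) (hs : s ∈ I)
    (hu : u ∈ N) (v w : G) :
    (tchebNormSq ε f (t, u))⁻¹ * caMetric ε f (t, u) (0, v) (0, w) =
      (tchebNormSq ε f (s, u))⁻¹ * caMetric ε f (s, u) (0, v) (0, w) := by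
  have hm : ∀ q ∈ I ×ˢ N, DifferentiableAt ℝ (fun p => caMetric ε f p (0, v) (0, w)) q :=
    fun q hq => (((h.contDiffAt_metric hq).clm_apply contDiffAt_const).clm_apply
      contDiffAt_const).differentiableAt (by simp)
  refine h.eq_of_time (k := fun q => (tchebNormSq ε f q)⁻¹ * caMetric ε f q (0, v) (0, w))
    (fun q hq => ((hasDerivAt_inv (h.normSq_pos hq).ne').comp_hasFDerivAt q
      ((h.contDiffAt_normSq hq).differentiableAt (by simp)).hasFDerivAt).mul
        (hm q hq).hasFDerivAt) (fun q hq => ?_) ht hs hu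
  have h1 := fderiv_clm_apply₂ ((h.contDiffAt_metric hq).differentiableAt (by simp))
    (differentiableAt_const ((0, v) : ℝ × G)) (differentiableAt_const ((0, w) : ℝ × G)) (1, 0)
  -- Both `h` on the slices and `‖T‖²` have `t`-derivative `2 α` times themselves, so the quotient
  -- is constant in `t`.
  rw [h.fderiv_metric hq, h.leviCivita_time hq, h.leviCivita_time hq] at h1
  have hr := (h.normSq_pos hq).ne'
  simp only [add_apply, smul_apply, h1, h.fderiv_normSq hq, h.dual_apply hq,
    Function.comp_apply]
  simp only [map_smul, smul_apply, smul_eq_mul, fderiv_fun_const, Pi.zero_apply, map_zero,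
    zero_apply, add_zero]
  field_simp
  ring

/-- The derivative of `θ` vanishes since `θ = dt` has constant components; `fderiv_dual` on slice
vectors then determines the `t`-component. -/
theorem leviCivita_base_fst (h : IsTchebProductDomain ε f I N α lam μ) {q : ℝ × G}
    (hq : q ∈ I ×ˢ N) (v w : G) : (leviCivita (caMetric ε f) q (0, v) (0, w)).1 =
      -(α q * ((tchebNormSq ε f q)⁻¹ * caMetric ε f q (0, v) (0, w))) := by
  have h1 := h.fderiv_dual hq (0, v) (0, w)
  have h2 : tchebDual ε f =ᶠ[nhds q] fun _ => ContinuousLinearMap.fst ℝ ℝ G :=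
    (h.eventually_mem hq).mono fun p hp => h.dual_eq p hp
  rw [h2.fderiv_eq] at h1
  simp only [h.dual_apply hq, fderiv_fun_const, Pi.zero_apply, zero_apply] at h1
  linear_combination -h1

theorem diff_base_fst (h : IsTchebProductDomain ε f I N α lam μ) {q : ℝ × G}
    (hq : q ∈ I ×ˢ N) (v w : G) : (caDiff ε f q (0, v) (0, w)).1 =
      (tchebNormSq ε f q)⁻¹ * caMetric ε f q (0, v) (0, w) * μ q := by
  have h1 := h.cubic_symm hq (tchebField ε f q) (0, v) (0, w)
  rw [h.diff_field hq, h.metric_field' hq, h.dual_apply hq, h.dual_apply hq,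
    h.metric_symm hq _ (0, v)] at h1
  have hr := (h.normSq_pos hq).ne'
  simp only [map_smul, mul_zero, zero_smul, add_zero, smul_eq_mul] at h1
  field_simp
  linear_combination h1

/-- The full trace of `K_V` is `n h(T, V) = 0`. In block form its `t`-entry is the `t`-component of
`K_V T = μ V`, also zero, so the slice block is trace-free. -/
theorem trace_diff_base (h : IsTchebProductDomain ε f I N α lam μ) {q : ℝ × G}
    (hq : q ∈ I ×ˢ N) (v : G) : LinearMap.trace ℝ G ((LinearMap.snd ℝ ℝ G) ∘ₗ
      (caDiff ε f q (0, v)).toLinearMap ∘ₗ (LinearMap.inr ℝ ℝ G)) = 0 := by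
  let A : ℝ × G →ₗ[ℝ] ℝ × G := (caDiff ε f q (0, v)).toLinearMap
  have h1 : LinearMap.trace ℝ _ A = 0 := by
    have h2 := h.metric_field hq (0, v)
    rw [h.metric_tchebField hq, h.dual_apply hq, mul_zero, tchebForm] at h2
    have h3 : (Module.finrank ℝ (ℝ × G) : ℝ) ≠ 0 := by
      have := h.three_le
      exact_mod_cast (by omega : Module.finrank ℝ (ℝ × G) ≠ 0)
    simp only [smul_apply, smul_eq_mul, mul_eq_zero, div_eq_zero_iff, one_ne_zero, h3,
      false_or] at h2
    exact h2
  have h4 : A = (A ∘ₗ LinearMap.inl ℝ ℝ G) ∘ₗ LinearMap.fst ℝ ℝ G +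
      (A ∘ₗ LinearMap.inr ℝ ℝ G) ∘ₗ LinearMap.snd ℝ ℝ G := by
    refine LinearMap.ext fun y => ?_
    simp only [LinearMap.add_apply, LinearMap.comp_apply, ← map_add]
    congr 1
    simp
  rw [h4, map_add, LinearMap.trace_comp_comm' (LinearMap.fst ℝ ℝ G) (A ∘ₗ LinearMap.inl ℝ ℝ G),
    LinearMap.trace_comp_comm' (LinearMap.snd ℝ ℝ G) (A ∘ₗ LinearMap.inr ℝ ℝ G)] at h1
  have h5 : LinearMap.fst ℝ ℝ G ∘ₗ A ∘ₗ LinearMap.inl ℝ ℝ G = 0 := by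
    ext
    have h6 := h.diff_field' hq (0, v)
    rw [h.field_eq q hq, h.dual_apply hq] at h6
    simp [A, h6]
  rw [h5, map_zero, zero_add] at h1
  exact h1

end Functions

/-! ### Constant axis and coaxis, and the fields that do not depend on `t`. -/

section Representation

variable {A B Y : ℝ → ℝ} {q : ℝ × G}

theorem hasFDerivAt_time {a : ℝ → ℝ} {c : ℝ} (ha : HasDerivAt a c q.1) :
    HasFDerivAt (fun p : ℝ × G => a p.1) (c • ContinuousLinearMap.fst ℝ ℝ G) q :=
  ha.comp_hasFDerivAt q hasFDerivAt_fst

theorem fderiv_apply_eq (h : IsTchebProductDomain ε f I N α lam μ) (hq : q ∈ I ×ˢ N)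
    (y : ℝ × G) : fderiv ℝ f q y = y.1 • tchebPush ε f q + fderiv ℝ f q (0, y.2) := by
  rw [tchebPush, h.field_eq q hq, ← map_smul, ← map_add]
  congr 1
  simp

/-- `A + B` is an antiderivative of `(α + μ) + (λ - 2μ - α) = λ - μ`, so its exponential is the
integrating factor for the axis, and inversely for the coaxis. -/
theorem axis_const (h : IsTchebProductDomain ε f I N α lam μ)
    (hA : ∀ q ∈ I ×ˢ N, HasDerivAt A (α q + μ q) q.1)
    (hB : ∀ q ∈ I ×ˢ N, HasDerivAt B (lam q - 2 * μ q - α q) q.1) (hq : q ∈ I ×ˢ N) :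
    HasFDerivAt (fun p => Real.exp (-(A p.1 + B p.1)) •
      (tchebPush ε f p - (α p + μ p) • f p)) (0 : ℝ × G →L[ℝ] F) q := by
  refine (((hasFDerivAt_time (hA q hq)).add (hasFDerivAt_time (hB q hq))).neg.exp.smul
    (h.fderiv_axis h.three_le hq)).congr_fderiv (ContinuousLinearMap.ext fun y => ?_)
  simp [h.dual_apply hq]
  module

theorem coaxis_const (h : IsTchebProductDomain ε f I N α lam μ)
    (hA : ∀ q ∈ I ×ˢ N, HasDerivAt A (α q + μ q) q.1)
    (hB : ∀ q ∈ I ×ˢ N, HasDerivAt B (lam q - 2 * μ q - α q) q.1) (hq : q ∈ I ×ˢ N) :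
    HasFDerivAt (fun p => Real.exp (A p.1 + B p.1) •
      (tchebCopush ε f p - (α p - μ p) • caConormal ε f p)) (0 : ℝ × G →L[ℝ] (F →L[ℝ] ℝ)) q := by
  refine (((hasFDerivAt_time (hA q hq)).add (hasFDerivAt_time (hB q hq))).exp.smul
    (h.fderiv_coaxis h.three_le hq)).congr_fderiv (ContinuousLinearMap.ext fun y => ?_)
  simp [h.dual_apply hq]
  module

/-- The `t`-derivative is `e^{-A} (Z - (α + μ) f) - e^B C`, which is zero because `e^{-A} = e^B
e^{-(A + B)}`. This is where the form of `γ₂` comes from. -/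
theorem fderiv_slice (h : IsTchebProductDomain ε f I N α lam μ)
    (hA : ∀ q ∈ I ×ˢ N, HasDerivAt A (α q + μ q) q.1)
    (hY : ∀ q ∈ I ×ˢ N, HasDerivAt Y (Real.exp (B q.1)) q.1) {C : F}
    (hC : ∀ q ∈ I ×ˢ N, Real.exp (-(A q.1 + B q.1)) •
      (tchebPush ε f q - (α q + μ q) • f q) = C) (hq : q ∈ I ×ˢ N) :
    HasFDerivAt (fun p => Real.exp (-A p.1) • f p - Y p.1 • C)
      (Real.exp (-A q.1) • ((fderiv ℝ f q).comp (ContinuousLinearMap.inr ℝ ℝ G)).comp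
        (ContinuousLinearMap.snd ℝ ℝ G)) q := by
  refine (((hasFDerivAt_time (hA q hq)).neg.exp.smul
    ((h.contDiffAt hq).differentiableAt (by simp)).hasFDerivAt).sub
    ((hasFDerivAt_time (hY q hq)).smul_const C)).congr_fderiv
    (ContinuousLinearMap.ext fun y => ?_)
  have h1 : Real.exp (-A q.1) = Real.exp (B q.1) * Real.exp (-(A q.1 + B q.1)) := by
    rw [← Real.exp_add]
    congr 1
    ring
  simp only [sub_apply, add_apply, smul_apply, ContinuousLinearMap.comp_apply,
    ContinuousLinearMap.smulRight_apply, neg_apply, ContinuousLinearMap.coe_fst',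
    ContinuousLinearMap.coe_snd', ContinuousLinearMap.inr_apply, Pi.neg_apply]
  rw [h.fderiv_apply_eq hq y, ← hC q hq, h1]
  module

/-- The equations for `α`, `μ`, `‖T‖²` and `Z` cancel all `dt` terms. On the slices the factor is
`(μ - α)(μ + α) - ε ‖T‖²`, constant by `shape_const`, which makes the shape operator a constant
multiple of the identity. -/
theorem fderiv_normal (h : IsTchebProductDomain ε f I N α lam μ)
    (hA : ∀ q ∈ I ×ˢ N, HasDerivAt A (α q + μ q) q.1) (hq : q ∈ I ×ˢ N) :
    HasFDerivAt (fun p => Real.exp (-A p.1) • ((μ p - α p) • tchebPush ε f p -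
      (ε * tchebNormSq ε f p) • f p))
      ((μ q ^ 2 - α q ^ 2 - ε * tchebNormSq ε f q) • Real.exp (-A q.1) •
        ((fderiv ℝ f q).comp (ContinuousLinearMap.inr ℝ ℝ G)).comp
          (ContinuousLinearMap.snd ℝ ℝ G)) q := by
  have hα := ((h.contDiffAt_alpha hq).differentiableAt (by simp)).hasFDerivAt
  have hμ := ((h.contDiffAt_mu h.three_le hq).differentiableAt (by simp)).hasFDerivAt
  have hr := ((h.contDiffAt_normSq hq).differentiableAt (by simp)).hasFDerivAt
  have hf := ((h.contDiffAt hq).differentiableAt (by simp)).hasFDerivAt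
  have hZ := ((h.contDiffAt_push hq).differentiableAt (by simp)).hasFDerivAt
  refine ((hasFDerivAt_time (hA q hq)).neg.exp.smul (((hμ.sub hα).smul hZ).sub
    ((hr.const_mul ε).smul hf))).congr_fderiv (ContinuousLinearMap.ext fun y => ?_)
  simp only [sub_apply, add_apply, smul_apply, ContinuousLinearMap.comp_apply,
    ContinuousLinearMap.smulRight_apply, neg_apply, ContinuousLinearMap.coe_fst',
    ContinuousLinearMap.coe_snd', ContinuousLinearMap.inr_apply, h.fderiv_push hq,
    h.fderiv_alpha h.three_le hq, h.fderiv_mu h.three_le hq, h.fderiv_normSq hq,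
    h.dual_apply hq, Pi.sub_apply, Pi.neg_apply, Pi.smul_apply']
  rw [h.fderiv_apply_eq hq y]
  module

theorem shape_const (h : IsTchebProductDomain ε f I N α lam μ) (hq : q ∈ I ×ˢ N) :
    HasFDerivAt (fun p => μ p ^ 2 - α p ^ 2 - ε * tchebNormSq ε f p)
      (0 : ℝ × G →L[ℝ] ℝ) q := by
  have hα := ((h.contDiffAt_alpha hq).differentiableAt (by simp)).hasFDerivAt
  have hμ := ((h.contDiffAt_mu h.three_le hq).differentiableAt (by simp)).hasFDerivAt
  have hr := ((h.contDiffAt_normSq hq).differentiableAt (by simp)).hasFDerivAt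
  refine (((hμ.pow 2).sub (hα.pow 2)).sub (hr.const_mul ε)).congr_fderiv
    (ContinuousLinearMap.ext fun y => ?_)
  simp [h.fderiv_alpha h.three_le hq, h.fderiv_mu h.three_le hq, h.fderiv_normSq hq]
  ring

/-- The Gauss formula of the slices. -/
theorem fderiv_fderiv_base (h : IsTchebProductDomain ε f I N α lam μ) (hq : q ∈ I ×ˢ N)
    (v w : G) : fderiv ℝ (fderiv ℝ f) q (0, v) (0, w) =
      fderiv ℝ f q (0, (leviCivita (caMetric ε f) q (0, v) (0, w) +
        caDiff ε f q (0, v) (0, w)).2) +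
      ((tchebNormSq ε f q)⁻¹ * caMetric ε f q (0, v) (0, w)) •
        ((μ q - α q) • tchebPush ε f q - (ε * tchebNormSq ε f q) • f q) := by
  rw [h.gauss hq, h.fderiv_apply_eq hq]
  simp only [Prod.fst_add, h.leviCivita_base_fst hq, h.diff_base_fst hq]
  have hr := (h.normSq_pos hq).ne'
  match_scalars
  · ring
  · simp
  · field_simp

end Representation

end IsTchebProductDomain

/-! ### Constant rescaling of the transversal field. -/

section Rescaling

variable {E F : Type*} [NormedAddCommGroup E] [NormedSpace ℝ E] [CompleteSpace E]
  [NormedAddCommGroup F] [NormedSpace ℝ F] [CompleteSpace F]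

theorem leviCivita_smul {g g₁ : E → E →L[ℝ] E →L[ℝ] ℝ} {p : E} {c : ℝ}
    (hg : DifferentiableAt ℝ g p) (hi : (g p).IsInvertible) (h₁ : (g₁ p).IsInvertible)
    (hgg : g₁ =ᶠ[nhds p] fun q => c • g q) (v w : E) :
    leviCivita g₁ p v w = leviCivita g p v w := by
  refine leviCivita_eq_of h₁ fun z => ?_
  have h2 : fderiv ℝ g₁ p = c • fderiv ℝ g p := by
    rw [hgg.fderiv_eq, fderiv_fun_const_smul hg]
  rw [hgg.self_of_nhds, smul_apply, smul_apply, leviCivita_apply hi, christoffelFirst_apply,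
    christoffelFirst_apply, h2]
  simp
  ring

theorem isTransversalAt_smul {f ξ : E → F} {p : E} {c : ℝ} (hc : c ≠ 0)
    (h : IsTransversalAt f ξ p) : IsTransversalAt f (fun q => c • ξ q) p := by
  have hb : Function.Bijective (Prod.map (id : E → E) (fun s : ℝ => s * c)) :=
    Function.bijective_id.prodMap (mulRight_bijective₀ c hc)
  refine (congrArg Function.Bijective (funext ?_)).mp (Function.Bijective.comp h hb)
  rintro ⟨v, s⟩
  simp [frame_apply, mul_smul]

theorem induced_smul {f ξ : E → F} {p : E} {c : ℝ} (hc : c ≠ 0)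
    (h : IsTransversalAt f ξ p) (v w : E) :
    inducedConn f (fun q => c • ξ q) p v w = inducedConn f ξ p v w ∧
      inducedMetric f (fun q => c • ξ q) p v w = c⁻¹ * inducedMetric f ξ p v w := by
  refine induced_eq_of_gauss (isTransversalAt_smul hc h) ?_
  rw [gauss_formula h, smul_smul]
  congr 2
  field_simp

end Rescaling

/-! ### Normalizing an equiaffine field to the affine normal. -/

section AffineNormal

variable {m : ℕ} {φ ξ : EuclideanSpace ℝ (Fin m) → EuclideanSpace ℝ (Fin (m + 1))}
  {N : Set (EuclideanSpace ℝ (Fin m))}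

theorem inducedVolSq_smul (c : ℝ) (u : EuclideanSpace ℝ (Fin m)) :
    inducedVolSq φ (fun p => c • ξ p) u = c ^ 2 * inducedVolSq φ ξ u := by
  have h1 : frameMatrix φ (fun p => c • ξ p) u =
      (frameMatrix φ ξ u).updateRow (Fin.last m) (c • frameMatrix φ ξ u (Fin.last m)) := by
    ext i j
    refine Fin.lastCases ?_ (fun i => ?_) i
    · simp [frameMatrix_last]
    · rw [Matrix.updateRow_ne (Fin.castSucc_lt_last i).ne]
      simp [frameMatrix_castSucc]
  have h2 : inducedVolSq φ (fun p => c • ξ p) u =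
    (frameMatrix φ (fun p => c • ξ p) u).det ^ 2 := rfl
  have h3 : inducedVolSq φ ξ u = (frameMatrix φ ξ u).det ^ 2 := rfl
  rw [h2, h3, h1, Matrix.det_updateRow_smul, Matrix.updateRow_eq_self]
  ring

theorem metricVolSq_smul (c : ℝ)
    (g : EuclideanSpace ℝ (Fin m) →L[ℝ] EuclideanSpace ℝ (Fin m) →L[ℝ] ℝ) :
    metricVolSq (c • g) = c ^ m * metricVolSq g := by
  have h1 : metricVolSq (c • g) = (c • gramMatrix g).det := rfl
  rw [h1, Matrix.det_smul, Fintype.card_fin]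
  rfl

/-- An equiaffine transversal field with definite metric and trace-free difference tensor is a
constant multiple of the affine normal. -/
theorem exists_isAffineNormal (hN : IsOpen N) (hc : IsPreconnected N)
    (hφ : ContDiffOn ℝ ∞ φ N) (hξ : ContDiffOn ℝ ∞ ξ N)
    (ht : ∀ u ∈ N, IsTransversalAt φ ξ u)
    (hp : ∀ u ∈ N, ∀ v, v ≠ 0 → 0 < inducedMetric φ ξ u v v)
    (he : ∀ u ∈ N, ∀ v, fderiv ℝ ξ u v ∈ Set.range (fderiv ℝ φ u))
    (htr : ∀ u ∈ N, ∀ v, LinearMap.trace ℝ _ (diffTensor φ ξ u v).toLinearMap = 0) :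
    ∃ k : ℝ, 0 < k ∧ IsAffineNormal N φ (fun p => k • ξ p) ∧
      ∀ u ∈ N, ∀ v w, diffTensor φ (fun p => k • ξ p) u v w = diffTensor φ ξ u v w := by
  obtain ⟨c, hc0, hcv⟩ := exists_inducedVolSq_eq hN hc hφ hξ ht hp he htr
  -- Replacing `ξ` by `k ξ` multiplies the squared induced volume by `k²` and the metric by `k⁻¹`,
  -- hence the Gram determinant by `k^{-m}`. Equality of volumes requires `k^{m+2} c = 1`.
  obtain ⟨k, hk, hkc⟩ : ∃ k : ℝ, 0 < k ∧ k ^ (m + 2) = c⁻¹ :=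
    ⟨c⁻¹ ^ ((m + 2 : ℕ) : ℝ)⁻¹, Real.rpow_pos_of_pos (inv_pos.2 hc0) _,
      Real.rpow_inv_natCast_pow (inv_pos.2 hc0).le (by omega)⟩
  have hsm : ∀ u ∈ N, ∀ v w, _ := fun u hu v w => induced_smul hk.ne' (ht u hu) v w
  have hmet : ∀ u ∈ N, inducedMetric φ (fun p => k • ξ p) u = k⁻¹ • inducedMetric φ ξ u := by
    intro u hu
    ext v w
    exact (hsm u hu v w).2
  have hp' : ∀ u ∈ N, ∀ v, v ≠ 0 → 0 < inducedMetric φ (fun p => k • ξ p) u v v := by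
    intro u hu v hv
    rw [(hsm u hu v v).2]
    exact mul_pos (inv_pos.2 hk) (hp u hu v hv)
  refine ⟨k, hk, ⟨hφ, (contDiffOn_const (c := k)).smul hξ, fun u hu => isTransversalAt_smul hk.ne' (ht u hu),
    hp', fun u hu v => ?_, fun u hu => ?_⟩, fun u hu v w => ?_⟩
  · have hd := (hξ.contDiffAt (hN.mem_nhds hu)).differentiableAt (by simp)
    obtain ⟨a, ha⟩ := he u hu v
    refine ⟨k • a, ?_⟩
    rw [fderiv_fun_const_smul hd, smul_apply, map_smul, ha]
  · rw [inducedVolSq_smul, hcv u hu, hmet u hu, metricVolSq_smul]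
    have h1 : k ^ 2 * c * k ^ m = 1 := by
      rw [mul_right_comm, ← pow_add, add_comm 2 m, hkc, inv_mul_cancel₀ hc0.ne']
    have h2 : k⁻¹ ^ m * k ^ m = 1 := by rw [← mul_pow, inv_mul_cancel₀ hk.ne', one_pow]
    have h3 : k ^ m ≠ 0 := pow_ne_zero _ hk.ne'
    apply mul_right_cancel₀ h3
    linear_combination (metricVolSq (inducedMetric φ ξ u)) * (h1 - h2)
  · have hg := (contDiffAt_induced (ht u hu) (hφ.contDiffAt (hN.mem_nhds hu))
      (hξ.contDiffAt (hN.mem_nhds hu))).2.differentiableAt (by simp)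
    have hev : inducedMetric φ (fun p => k • ξ p) =ᶠ[nhds u] fun p => k⁻¹ • inducedMetric φ ξ p :=
      Filter.mem_of_superset (hN.mem_nhds hu) hmet
    simp only [diffTensor, sub_apply, (hsm u hu v w).1]
    rw [leviCivita_smul hg (isInvertible_of_posDef (hp u hu))
      (isInvertible_of_posDef (hp' u hu)) hev]

end AffineNormal

/-! ### The slices as hypersurfaces of a hyperplane. -/

namespace IsTchebProductDomain

variable {m : ℕ} {F : Type*} [NormedAddCommGroup F] [NormedSpace ℝ F] [CompleteSpace F]
  {ε : ℝ} {f : ℝ × EuclideanSpace ℝ (Fin m) → F} {I : Set ℝ} {N : Set (EuclideanSpace ℝ (Fin m))}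
  {α lam μ : ℝ × EuclideanSpace ℝ (Fin m) → ℝ}

/-- A slice `φ`, given by its derivative, with the transversal field `ξ` induced from `x`: its
Gauss formula, induced metric and difference tensor. -/
theorem slice_tensors (h : IsTchebProductDomain ε f I N α lam μ) {A : ℝ → ℝ}
    {P : F →L[ℝ] EuclideanSpace ℝ (Fin (m + 1))}
    {φ ξ : EuclideanSpace ℝ (Fin m) → EuclideanSpace ℝ (Fin (m + 1))}
    (hφ : ∀ q ∈ I ×ˢ N, fderiv ℝ φ q.2 = P.comp (Real.exp (-A q.1) •
      (fderiv ℝ f q).comp (ContinuousLinearMap.inr ℝ ℝ _)))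
    (hξ : ∀ q ∈ I ×ˢ N, ξ q.2 = P (Real.exp (-A q.1) • ((μ q - α q) • tchebPush ε f q -
      (ε * tchebNormSq ε f q) • f q)))
    (hinj : ∀ q ∈ I ×ˢ N, ∀ (v : EuclideanSpace ℝ (Fin m)) (s : ℝ), P (Real.exp (-A q.1) • fderiv ℝ f q (0, v) + s • Real.exp (-A q.1) •
      ((μ q - α q) • tchebPush ε f q - (ε * tchebNormSq ε f q) • f q)) = 0 →
      Real.exp (-A q.1) • fderiv ℝ f q (0, v) + s • Real.exp (-A q.1) •
      ((μ q - α q) • tchebPush ε f q - (ε * tchebNormSq ε f q) • f q) = 0)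
    {q : ℝ × EuclideanSpace ℝ (Fin m)} (hq : q ∈ I ×ˢ N) :
    IsTransversalAt φ ξ q.2 ∧
    (∀ v w, inducedMetric φ ξ q.2 v w =
      (tchebNormSq ε f q)⁻¹ * caMetric ε f q (0, v) (0, w)) ∧
    ∀ v w, inducedConn φ ξ q.2 v w =
      (leviCivita (caMetric ε f) q (0, v) (0, w) + caDiff ε f q (0, v) (0, w)).2 := by
  have ht : IsTransversalAt φ ξ q.2 := by
    have hfin : Module.finrank ℝ (EuclideanSpace ℝ (Fin m) × ℝ) =
        Module.finrank ℝ (EuclideanSpace ℝ (Fin (m + 1))) := by simp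
    -- `hinj` lifts a relation in the hyperplane back to `F`. There the coefficient of `f` is `-s ε
    -- ‖T‖²`, so transversality of the position vector forces `s = 0` and then `v = 0`.
    have hi : Function.Injective (frame φ ξ q.2).toLinearMap := by
      rw [← LinearMap.ker_eq_bot, LinearMap.ker_eq_bot']
      rintro ⟨v, s⟩ hvs
      have h1 : frame φ ξ q.2 (v, s) = 0 := hvs
      rw [frame_apply, hφ q hq, hξ q hq, ← map_smul] at h1
      simp only [ContinuousLinearMap.comp_apply, smul_apply, ContinuousLinearMap.inr_apply,
        ← map_add] at h1
      have h2 := hinj q hq v s h1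
      have h3 : fderiv ℝ f q (s * (μ q - α q), v) + (-(s * (ε * tchebNormSq ε f q))) • f q =
          fderiv ℝ f q 0 + (0 : ℝ) • f q := by
        rw [h.fderiv_apply_eq hq]
        have h4 : Real.exp (-A q.1) • (fderiv ℝ f q (0, v) + s • ((μ q - α q) • tchebPush ε f q -
            (ε * tchebNormSq ε f q) • f q)) = 0 := by
          rw [← h2]
          module
        have h5 := (smul_eq_zero.1 h4).resolve_left (Real.exp_ne_zero _)
        rw [map_zero, zero_smul, add_zero, ← h5]
        module
      have h5 := (h.transversal q hq).eq_of_add_smul_eq h3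
      have hε : ε ≠ 0 := by
        intro h0
        simpa [h0] using h.sign_mul_self
      have hr := (h.normSq_pos hq).ne'
      have hs : s = 0 := by simpa [hε, hr] using h5.2
      have hv := congrArg Prod.snd h5.1
      simp only [Prod.snd_zero] at hv
      rw [hv, hs]
      rfl
    exact ⟨hi, (LinearMap.injective_iff_surjective_of_finrank_eq_finrank hfin).1 hi⟩
  have hg : ∀ v w, fderiv ℝ (fderiv ℝ φ) q.2 v w = fderiv ℝ φ q.2
      (leviCivita (caMetric ε f) q (0, v) (0, w) + caDiff ε f q (0, v) (0, w)).2 +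
      ((tchebNormSq ε f q)⁻¹ * caMetric ε f q (0, v) (0, w)) • ξ q.2 := by
    intro v w
    have h1 : fderiv ℝ φ =ᶠ[nhds q.2] fun u => P.comp (Real.exp (-A q.1) •
        (fderiv ℝ f (q.1, u)).comp (ContinuousLinearMap.inr ℝ ℝ _)) :=
      Filter.mem_of_superset (h.isOpen_base.mem_nhds hq.2) fun u hu => hφ (q.1, u) ⟨hq.1, hu⟩
    have h2 : HasFDerivAt (fun u => fderiv ℝ f (q.1, u)) _ q.2 := hasFDerivAt_slice
      ((contDiffAt_fderiv (h.contDiffAt hq)).differentiableAt (by simp)).hasFDerivAt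
    have h3 := ((hasFDerivAt_const P q.2).clm_comp
      ((h2.clm_comp (hasFDerivAt_const (ContinuousLinearMap.inr ℝ ℝ _) q.2)).const_smul
        (Real.exp (-A q.1)))).fderiv
    rw [h1.fderiv_eq]
    erw [h3]
    rw [hφ q hq, hξ q hq]
    simp [h.fderiv_fderiv_base hq]
    module
  exact ⟨ht, fun v w => (induced_eq_of_gauss ht (hg v w)).2,
    fun v w => (induced_eq_of_gauss ht (hg v w)).1⟩

/-- The product form of the metric lets a slice vector pair only with the slice component, and
`‖T‖²` is constant on each slice, so the Christoffel symbols of the first kind are proportional. -/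
theorem slice_leviCivita (h : IsTchebProductDomain ε f I N α lam μ)
    {g : EuclideanSpace ℝ (Fin m) → EuclideanSpace ℝ (Fin m) →L[ℝ] EuclideanSpace ℝ (Fin m) →L[ℝ] ℝ}
    (hg : ∀ q ∈ I ×ˢ N, ∀ v w, g q.2 v w =
      (tchebNormSq ε f q)⁻¹ * caMetric ε f q (0, v) (0, w))
    {q : ℝ × EuclideanSpace ℝ (Fin m)} (hq : q ∈ I ×ˢ N) (hi : (g q.2).IsInvertible)
    (hgd : DifferentiableAt ℝ g q.2) (v w : EuclideanSpace ℝ (Fin m)) :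
    leviCivita g q.2 v w = (leviCivita (caMetric ε f) q (0, v) (0, w)).2 := by
  have hd : ∀ y v w, fderiv ℝ g q.2 y v w =
      (tchebNormSq ε f q)⁻¹ * fderiv ℝ (caMetric ε f) q (0, y) (0, v) (0, w) := by
    intro y v w
    have h1 := fderiv_clm_apply₂ hgd (differentiableAt_const v) (differentiableAt_const w) y
    have h2 : (fun u => g u v w) =ᶠ[nhds q.2]
        fun u => (tchebNormSq ε f q)⁻¹ * caMetric ε f (q.1, u) (0, v) (0, w) :=
      Filter.mem_of_superset (h.isOpen_base.mem_nhds hq.2) fun u hu => by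
        show g u v w = _
        rw [hg (q.1, u) ⟨hq.1, hu⟩, h.normSq_eq hq.1 hu hq.2]
    have h3 : HasFDerivAt (fun u => caMetric ε f (q.1, u)) _ q.2 := hasFDerivAt_slice
      ((h.contDiffAt_metric hq).differentiableAt (by simp)).hasFDerivAt
    have h4 := (((h3.clm_apply (hasFDerivAt_const ((0, v) : ℝ × _) q.2)).clm_apply
      (hasFDerivAt_const ((0, w) : ℝ × _) q.2)).const_mul (tchebNormSq ε f q)⁻¹).fderiv
    rw [h2.fderiv_eq] at h1
    erw [h4] at h1
    simp at h1
    exact h1.symm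
  refine leviCivita_eq_of hi fun z => ?_
  have h5 := leviCivita_apply (h.isInvertible_metric hq) (0, v) (0, w) (0, z)
  rw [h.metric_prod hq] at h5
  simp only [mul_zero, zero_add] at h5
  rw [hg q hq, h5, christoffelFirst_apply, christoffelFirst_apply, hd, hd, hd]
  ring

end IsTchebProductDomain

/-! ### Construction of the affine hypersphere. -/

namespace IsTchebProductDomain

variable {m : ℕ} {F : Type*} [NormedAddCommGroup F] [NormedSpace ℝ F] [CompleteSpace F]
  [FiniteDimensional ℝ F]
  {ε : ℝ} {f : ℝ × EuclideanSpace ℝ (Fin m) → F} {I : Set ℝ} {N : Set (EuclideanSpace ℝ (Fin m))}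
  {α lam μ : ℝ × EuclideanSpace ℝ (Fin m) → ℝ}

/-- The representation of the hypersurface by an affine hypersphere. -/
theorem exists_affineHypersphere (h : IsTchebProductDomain ε f I N α lam μ)
    (hF : Module.finrank ℝ F = m + 2) {q₀ : ℝ × EuclideanSpace ℝ (Fin m)} (hq₀ : q₀ ∈ I ×ˢ N)
    {A B Y : ℝ → ℝ} (hA : ∀ q ∈ I ×ˢ N, HasDerivAt A (α q + μ q) q.1)
    (hB : ∀ q ∈ I ×ˢ N, HasDerivAt B (lam q - 2 * μ q - α q) q.1)
    (hY : ∀ q ∈ I ×ˢ N, HasDerivAt Y (Real.exp (B q.1)) q.1) :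
    ∃ (φ ξ : EuclideanSpace ℝ (Fin m) → EuclideanSpace ℝ (Fin (m + 1)))
      (ι : EuclideanSpace ℝ (Fin (m + 1)) →ᵃ[ℝ] F) (C : F),
      C ≠ 0 ∧ Function.Injective ι ∧ IsAffineHypersphere N φ ξ ∧
      (∀ q ∈ I ×ˢ N, f q = Real.exp (A q.1) • ι (φ q.2) + (Real.exp (A q.1) * Y q.1) • C) ∧
      ∀ q ∈ I ×ˢ N, ∀ v w : EuclideanSpace ℝ (Fin m),
        caDiff ε f q (0, v) (0, w) =
          ((tchebNormSq ε f q)⁻¹ * caMetric ε f q (0, v) (0, w) * μ q) • tchebField ε f q +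
            (0, diffTensor φ ξ q.2 v w) := by
  let C : F := Real.exp (-(A q₀.1 + B q₀.1)) • (tchebPush ε f q₀ - (α q₀ + μ q₀) • f q₀)
  have hC : ∀ q ∈ I ×ˢ N, Real.exp (-(A q.1 + B q.1)) •
      (tchebPush ε f q - (α q + μ q) • f q) = C := fun q hq =>
    h.eq_of_forall (fun p hp => h.axis_const hA hB hp) hq hq₀
  have hC0 : C ≠ 0 := by
    intro h0
    have h1 := (smul_eq_zero.1 h0).resolve_left (Real.exp_ne_zero _)
    have h2 := (h.transversal q₀ hq₀).eq_of_add_smul_eq (v := tchebField ε f q₀) (w := 0)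
      (s := -(α q₀ + μ q₀)) (r := 0) (by
        rw [map_zero, zero_smul, zero_add, ← h1, tchebPush]
        module)
    exact h.ne_zero q₀ hq₀ h2.1
  -- The constant covector of the coaxis. It vanishes on slice tangent vectors and on `η`, so its
  -- kernel is the direction of the hyperplane containing `φ`.
  let ℓ : F →L[ℝ] ℝ := Real.exp (A q₀.1 + B q₀.1) •
    (tchebCopush ε f q₀ - (α q₀ - μ q₀) • caConormal ε f q₀)
  have hℓ : ∀ q ∈ I ×ˢ N, Real.exp (A q.1 + B q.1) •
      (tchebCopush ε f q - (α q - μ q) • caConormal ε f q) = ℓ := fun q hq =>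
    h.eq_of_forall (fun p hp => h.coaxis_const hA hB hp) hq hq₀
  have hℓv : ∀ q ∈ I ×ˢ N, ∀ y, ℓ (fderiv ℝ f q y) =
      -(Real.exp (A q.1 + B q.1) * (tchebNormSq ε f q * y.1)) := by
    intro q hq y
    rw [← hℓ q hq]
    simp [h.copush_tangent hq, h.conormal_tangent hq, h.metric_field hq, h.dual_apply hq]
  have hℓZ : ∀ q ∈ I ×ˢ N, ℓ (tchebPush ε f q) =
      -(Real.exp (A q.1 + B q.1) * tchebNormSq ε f q) := by
    intro q hq
    rw [tchebPush, hℓv q hq, h.field_eq q hq, mul_one]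
  have hℓf : ∀ q ∈ I ×ˢ N, ℓ (f q) = Real.exp (A q.1 + B q.1) * ((α q - μ q) * ε) := by
    intro q hq
    rw [← hℓ q hq]
    simp [h.copush_self hq, h.conormal_self hq]
  have hZ0 : ℓ (tchebPush ε f q₀) ≠ 0 := by
    rw [hℓZ q₀ hq₀]
    exact neg_ne_zero.2 (mul_ne_zero (Real.exp_ne_zero _) (h.normSq_pos hq₀).ne')
  -- `R` identifies `ker ℓ` with `ℝ^(m+1)`, and `J` below is the inverse identification. The
  -- normalized `Z` only provides a vector on which `ℓ` is `1`.
  obtain ⟨R, -, hR⟩ := exists_complement_coordinates (G := EuclideanSpace ℝ (Fin (m + 1)))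
    (θ := ℓ) (T := (ℓ (tchebPush ε f q₀))⁻¹ • tchebPush ε f q₀)
    (by rw [map_smul, smul_eq_mul, inv_mul_cancel₀ hZ0]) (by simp [hF])
  obtain ⟨e, he⟩ := isInvertible_of_bijective hR
  have hex : ∀ x, e x = (ℓ x, R x) := fun x => by
    have := DFunLike.congr_fun he x
    simpa using this
  let J : EuclideanSpace ℝ (Fin (m + 1)) →L[ℝ] F :=
    e.symm.toContinuousLinearMap.comp (ContinuousLinearMap.inr ℝ ℝ _)
  have hJR : ∀ x, ℓ x = 0 → J (R x) = x := by
    intro x hx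
    have : e.symm (0, R x) = x := by rw [e.symm_apply_eq, hex, hx]
    simpa [J] using this
  have hJinj : Function.Injective J := by
    intro y z hyz
    have := e.symm.injective hyz
    simpa using this
  let W : ℝ × EuclideanSpace ℝ (Fin m) → F := fun q => Real.exp (-A q.1) • f q - Y q.1 • C
  have hW : ∀ q ∈ I ×ˢ N, HasFDerivAt W _ q := fun q hq => h.fderiv_slice hA hY hC hq
  let η : ℝ × EuclideanSpace ℝ (Fin m) → F := fun p =>
    Real.exp (-A p.1) • ((μ p - α p) • tchebPush ε f p - (ε * tchebNormSq ε f p) • f p)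
  have hη : ∀ q ∈ I ×ˢ N, HasFDerivAt η _ q := fun q hq => h.fderiv_normal hA hq
  have hℓη : ∀ q ∈ I ×ˢ N, ℓ (η q) = 0 := by
    intro q hq
    simp only [η, map_smul, map_sub, smul_eq_mul, hℓZ q hq, hℓf q hq]
    linear_combination -(Real.exp (-A q.1) * Real.exp (A q.1 + B q.1) * tchebNormSq ε f q *
      (α q - μ q)) * h.sign_mul_self
  have hℓW : ∀ q ∈ I ×ˢ N, ℓ (W q - W q₀) = 0 := by
    intro q hq
    rw [map_sub, sub_eq_zero]
    refine h.eq_of_forall (k := fun q => ℓ (W q)) (fun p hp => ?_) hq hq₀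
    refine (ℓ.hasFDerivAt.comp p (hW p hp)).congr_fderiv (ContinuousLinearMap.ext fun y => ?_)
    simp [hℓv p hp]
  -- By `hℓW` the values of `W` lie in the affine hyperplane through `W q₀` with direction `ker ℓ`.
  -- The slice `t = q₀.1` is an arbitrary choice, as `hWt` and `hηt` show.
  let φ : EuclideanSpace ℝ (Fin m) → EuclideanSpace ℝ (Fin (m + 1)) :=
    fun u => R (W (q₀.1, u) - W q₀)
  let ξ : EuclideanSpace ℝ (Fin m) → EuclideanSpace ℝ (Fin (m + 1)) := fun u => R (η (q₀.1, u))
  have hWt : ∀ q ∈ I ×ˢ N, W (q₀.1, q.2) = W q := fun q hq =>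
    h.eq_of_time hW (fun p hp => by simp [Prod.mk_zero_zero]) hq₀.1 hq.1 hq.2
  have hηt : ∀ q ∈ I ×ˢ N, η (q₀.1, q.2) = η q := fun q hq =>
    h.eq_of_time hη (fun p hp => by simp [Prod.mk_zero_zero]) hq₀.1 hq.1 hq.2
  have hφ : ∀ q ∈ I ×ˢ N, fderiv ℝ φ q.2 = R.comp (Real.exp (-A q.1) •
      (fderiv ℝ f q).comp (ContinuousLinearMap.inr ℝ ℝ _)) := by
    intro q hq
    have h1 : φ =ᶠ[nhds q.2] fun u => R (W (q.1, u) - W q₀) :=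
      Filter.mem_of_superset (h.isOpen_base.mem_nhds hq.2) fun u hu =>
        congrArg (fun x => R (x - W q₀)) (hWt (q.1, u) ⟨hq.1, hu⟩)
    have h2 := (R.hasFDerivAt.comp q.2 ((hasFDerivAt_slice (hW q hq)).sub_const (W q₀))).fderiv
    rw [h1.fderiv_eq]
    erw [h2]
    ext v
    simp
  have hξd : ∀ q ∈ I ×ˢ N, ∀ v, fderiv ℝ ξ q.2 v =
      (μ q ^ 2 - α q ^ 2 - ε * tchebNormSq ε f q) • fderiv ℝ φ q.2 v := by
    intro q hq v
    have h1 : ξ =ᶠ[nhds q.2] fun u => R (η (q.1, u)) :=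
      Filter.mem_of_superset (h.isOpen_base.mem_nhds hq.2) fun u hu =>
        congrArg R (hηt (q.1, u) ⟨hq.1, hu⟩)
    have h2 := (R.hasFDerivAt.comp q.2 (hasFDerivAt_slice (hη q hq))).fderiv
    rw [h1.fderiv_eq, hφ q hq]
    erw [h2]
    simp
  have hten : ∀ q ∈ I ×ˢ N, _ := fun q hq => h.slice_tensors (ξ := ξ) hφ
    -- The vectors in question lie in `ker ℓ`, where `J` is a left inverse of `R`.
    (fun q hq => congrArg R (hηt q hq)) (fun q hq v s hvs => by
      have h1 := hJR _ (show ℓ (Real.exp (-A q.1) • fderiv ℝ f q (0, v) + s • η q) = 0 by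
        rw [map_add, map_smul, map_smul, hℓη q hq, hℓv q hq]
        simp)
      have h2 : R (Real.exp (-A q.1) • fderiv ℝ f q (0, v) + s • η q) = 0 := hvs
      rw [h2, map_zero] at h1
      exact h1.symm) hq
  have hN : ∀ u ∈ N, (q₀.1, u) ∈ I ×ˢ N := fun u hu => ⟨hq₀.1, hu⟩
  have hincl : ContDiff ℝ ∞ fun u : EuclideanSpace ℝ (Fin m) => (q₀.1, u) :=
    contDiff_const.prodMk contDiff_id
  have hφs : ContDiffOn ℝ ∞ φ N := by
    have h1 : ContDiffOn ℝ ∞ (fun u => f (q₀.1, u)) N :=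
      h.smooth.comp hincl.contDiffOn hN
    have h2 : ContDiffOn ℝ ∞ (fun u => W (q₀.1, u) - W q₀) N :=
      ((h1.const_smul (Real.exp (-A q₀.1))).sub (contDiffOn_const (c := Y q₀.1 • C))).sub
        (contDiffOn_const (c := W q₀))
    exact R.contDiff.comp_contDiffOn h2
  have hξs : ContDiffOn ℝ ∞ ξ N := by
    intro u hu
    have hq := hN u hu
    have h1 : ContDiffAt ℝ ∞ (fun p => Real.exp (-A q₀.1) • ((μ p - α p) • tchebPush ε f p -
        (ε * tchebNormSq ε f p) • f p)) (q₀.1, u) :=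
      contDiffAt_const.smul ((((h.contDiffAt_mu h.three_le hq).sub
        (h.contDiffAt_alpha hq)).smul (h.contDiffAt_push hq)).sub
        ((contDiffAt_const.mul (h.contDiffAt_normSq hq)).smul (h.contDiffAt hq)))
    exact (R.contDiff.contDiffAt.comp u (h1.comp u hincl.contDiffAt)).contDiffWithinAt
  have htr : ∀ u ∈ N, IsTransversalAt φ ξ u := fun u hu => (hten _ (hN u hu)).1
  have hpos : ∀ u ∈ N, ∀ v, v ≠ 0 → 0 < inducedMetric φ ξ u v v := by
    intro u hu v hv
    rw [(hten _ (hN u hu)).2.1]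
    exact mul_pos (inv_pos.2 (h.normSq_pos (hN u hu)))
      (h.posDef _ (hN u hu) _ (by simpa using hv))
  have hdiff : ∀ q ∈ I ×ˢ N, ∀ v w, diffTensor φ ξ q.2 v w =
      (caDiff ε f q (0, v) (0, w)).2 := by
    intro q hq v w
    have h1 := (contDiffAt_induced (hten q hq).1 (hφs.contDiffAt (h.isOpen_base.mem_nhds hq.2))
      (hξs.contDiffAt (h.isOpen_base.mem_nhds hq.2))).2.differentiableAt (by simp)
    have h2 := h.slice_leviCivita (g := inducedMetric φ ξ) (fun p hp => (hten p hp).2.1) hq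
      (isInvertible_of_posDef (hpos q.2 hq.2)) h1 v w
    simp only [diffTensor, sub_apply, (hten q hq).2.2, h2]
    simp
  have htrace : ∀ u ∈ N, ∀ v, LinearMap.trace ℝ _ (diffTensor φ ξ u v).toLinearMap = 0 := by
    intro u hu v
    have h1 : (diffTensor φ ξ u v).toLinearMap = LinearMap.snd ℝ ℝ _ ∘ₗ
        (caDiff ε f (q₀.1, u) (0, v)).toLinearMap ∘ₗ LinearMap.inr ℝ ℝ _ :=
      LinearMap.ext fun w => hdiff _ (hN u hu) v w
    rw [h1]
    exact h.trace_diff_base (hN u hu) v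
  obtain ⟨k, hk, hnormal, hkd⟩ := exists_isAffineNormal h.isOpen_base
    h.convex_base.isPreconnected hφs hξs htr hpos (fun u hu v => ⟨_ • v, by
      rw [map_smul]
      exact (hξd _ (hN u hu) v).symm⟩) htrace
  let ι : EuclideanSpace ℝ (Fin (m + 1)) →ᵃ[ℝ] F :=
    J.toLinearMap.toAffineMap + AffineMap.const ℝ _ (W q₀)
  have hι : ∀ y, ι y = J y + W q₀ := fun y => rfl
  -- The minus sign in the mean curvature comes from the convention `dξ = -φ_* S`; the factor `k`
  -- comes from the volume normalization.
  refine ⟨φ, fun u => k • ξ u, ι, C, hC0,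
    ?_, ⟨hnormal, -(k * (μ q₀ ^ 2 - α q₀ ^ 2 - ε * tchebNormSq ε f q₀)), ?_⟩, ?_, ?_⟩
  · intro y z hyz
    exact hJinj (by simpa [hι] using hyz)
  · intro u hu v
    have h1 := (hξs.contDiffAt (h.isOpen_base.mem_nhds hu)).differentiableAt (by simp)
    have h2 := h.eq_of_forall (fun p hp => h.shape_const hp) (hN u hu) hq₀
    rw [fderiv_fun_const_smul h1, smul_apply, hξd _ (hN u hu) v, h2, map_smul]
    module
  · intro q hq
    have h1 : J (φ q.2) = W q - W q₀ := by
      rw [← hJR _ (hℓW q hq), ← hWt q hq]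
    have h2 : Real.exp (A q.1) * Real.exp (-A q.1) = 1 := by
      rw [← Real.exp_add, add_neg_cancel, Real.exp_zero]
    rw [hι, h1, sub_add_cancel]
    simp only [W, smul_sub, smul_smul, h2]
    module
  · intro q hq v w
    rw [hkd q.2 hq.2, hdiff q hq, h.field_eq q hq]
    ext1
    · simp [h.diff_base_fst hq]
    · simp

end IsTchebProductDomain

/-! ### From the manifold to a chart, and the main theorem. -/

/-- The hypotheses of the classification hold in the coordinates of a chart, away from the zeros
of `T`. -/
theorem isTchebDomain_chart {m : ℕ} {F : Type*} [NormedAddCommGroup F] [NormedSpace ℝ F]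
    [CompleteSpace F] {M : Type*} [TopologicalSpace M]
    [ChartedSpace (EuclideanSpace ℝ (Fin (m + 1))) M]
    [IsManifold (modelWithCornersSelf ℝ (EuclideanSpace ℝ (Fin (m + 1)))) ∞ M]
    {ε : ℝ} {x : M → F} (hx : IsConvexCentroaffine (EuclideanSpace ℝ (Fin (m + 1))) ε x)
    {α lam μ : M → ℝ} (hα : TchebOperatorEq (EuclideanSpace ℝ (Fin (m + 1))) ε x α)
    (hlam : DiffTTEq (EuclideanSpace ℝ (Fin (m + 1))) ε x lam)
    (hμ : DiffTPerpEq (EuclideanSpace ℝ (Fin (m + 1))) ε x μ) (p : M) :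
    IsTchebDomain ε (x ∘ (chartAt (EuclideanSpace ℝ (Fin (m + 1))) p).symm)
      ((chartAt (EuclideanSpace ℝ (Fin (m + 1))) p).target ∩
        tchebField ε (x ∘ (chartAt (EuclideanSpace ℝ (Fin (m + 1))) p).symm) ⁻¹' {0}ᶜ)
      (α ∘ (chartAt (EuclideanSpace ℝ (Fin (m + 1))) p).symm)
      (lam ∘ (chartAt (EuclideanSpace ℝ (Fin (m + 1))) p).symm)
      (μ ∘ (chartAt (EuclideanSpace ℝ (Fin (m + 1))) p).symm) := by
  have he := chart_mem_atlas (EuclideanSpace ℝ (Fin (m + 1))) p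
  set e := chartAt (EuclideanSpace ℝ (Fin (m + 1))) p with hedef
  have hca : IsCaDomain ε (x ∘ e.symm) e.target :=
    { sign := hx.sign
      isOpen := e.open_target
      smooth := by
        rw [← contMDiffOn_iff_contDiffOn]
        exact hx.smooth.comp_contMDiffOn contMDiffOn_chart_symm
      transversal := hx.transversal e he
      posDef := hx.posDef e he }
  have ho : IsOpen (e.target ∩ tchebField ε (x ∘ e.symm) ⁻¹' {0}ᶜ) :=
    -- The nonvanishing set of `T` is open because `T` is smooth already under the centroaffine
    -- hypotheses.
    ContinuousOn.isOpen_inter_preimage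
      (fun q hq => (hca.contDiffAt_tchebField hq).continuousAt.continuousWithinAt)
      e.open_target isOpen_compl_singleton
  exact
    { sign := hca.sign
      isOpen := ho
      smooth := hca.smooth.mono Set.inter_subset_left
      transversal := fun q hq => hca.transversal q hq.1
      posDef := fun q hq => hca.posDef q hq.1
      operator_eq := fun q hq => hα e he q hq.1
      diff_self := fun q hq => hlam e he q hq.1
      diff_perp := fun q hq => hμ e he q hq.1 hq.2
      ne_zero := fun q hq => hq.2 }

end

/-- Here `n = m + 1 ≥ 3` is the dimension of `M`. In the conclusion `a`, `l`, `b` are the functions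
`α`, `lam`, `μ` in terms of the coordinate `t`, the functions `A`, `B`, `Y` are arbitrary
antiderivatives, so that `exp (A t)` is `γ₁` and `exp (A t) * Y t` is `γ₂`, and `ι` identifies
`ℝ^n` with an affine hyperplane of `ℝ^(n+1)`. -/
theorem proposition3p2 (m : ℕ) (hm : 2 ≤ m)
    {M : Type*} [TopologicalSpace M] [ChartedSpace (EuclideanSpace ℝ (Fin (m + 1))) M]
    [IsManifold 𝓘(ℝ, EuclideanSpace ℝ (Fin (m + 1))) ∞ M]
    (ε : ℝ) (x : M → EuclideanSpace ℝ (Fin (m + 2)))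
    (hx : IsConvexCentroaffine (EuclideanSpace ℝ (Fin (m + 1))) ε x)
    (α lam μ : M → ℝ) (hα : TchebOperatorEq (EuclideanSpace ℝ (Fin (m + 1))) ε x α)
    (hlam : DiffTTEq (EuclideanSpace ℝ (Fin (m + 1))) ε x lam)
    (hμ : DiffTPerpEq (EuclideanSpace ℝ (Fin (m + 1))) ε x μ)
    (p : M) (hp : TchebNeZeroAt (EuclideanSpace ℝ (Fin (m + 1))) ε x p) :
    ∃ (ψ : OpenPartialHomeomorph M (ℝ × EuclideanSpace ℝ (Fin m))) (t₀ t₁ : ℝ)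
      (N : Set (EuclideanSpace ℝ (Fin m)))
      (g' : EuclideanSpace ℝ (Fin m) →
        EuclideanSpace ℝ (Fin m) →L[ℝ] EuclideanSpace ℝ (Fin m) →L[ℝ] ℝ)
      (a l b : ℝ → ℝ),
      p ∈ ψ.source ∧ IsTchebProduct ε x ψ t₀ t₁ N g' ∧
      ContDiffOn ℝ ∞ a (Set.Ioo t₀ t₁) ∧ ContDiffOn ℝ ∞ l (Set.Ioo t₀ t₁) ∧
      ContDiffOn ℝ ∞ b (Set.Ioo t₀ t₁) ∧
      (∀ q ∈ ψ.target, α (ψ.symm q) = a q.1 ∧ lam (ψ.symm q) = l q.1 ∧ μ (ψ.symm q) = b q.1) ∧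
      ∀ A B Y : ℝ → ℝ,
        (∀ t ∈ Set.Ioo t₀ t₁, HasDerivAt A (a t + b t) t) →
        (∀ t ∈ Set.Ioo t₀ t₁, HasDerivAt B (l t - 2 * b t - a t) t) →
        (∀ t ∈ Set.Ioo t₀ t₁, HasDerivAt Y (Real.exp (B t)) t) →
        ∃ (φ ξ : EuclideanSpace ℝ (Fin m) → EuclideanSpace ℝ (Fin (m + 1)))
          (ι : EuclideanSpace ℝ (Fin (m + 1)) →ᵃ[ℝ] EuclideanSpace ℝ (Fin (m + 2)))
          (C : EuclideanSpace ℝ (Fin (m + 2))),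
          C ≠ 0 ∧ Function.Injective ι ∧ IsAffineHypersphere N φ ξ ∧
          (∀ q ∈ ψ.target,
            x (ψ.symm q) = Real.exp (A q.1) • ι (φ q.2) + (Real.exp (A q.1) * Y q.1) • C) ∧
          ∀ q ∈ ψ.target, ∀ v w : EuclideanSpace ℝ (Fin m),
            caDiff ε (x ∘ ψ.symm) q (0, v) (0, w) =
              ((tchebNormSq ε (x ∘ ψ.symm) q)⁻¹ *
                caMetric ε (x ∘ ψ.symm) q (0, v) (0, w) * b q.1) •
                tchebField ε (x ∘ ψ.symm) q +
              (0, diffTensor φ ξ q.2 v w) := by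
  let e := chartAt (EuclideanSpace ℝ (Fin (m + 1))) p
  have hU := isTchebDomain_chart hx hα hlam hμ p
  have h3 : 3 ≤ Module.finrank ℝ (EuclideanSpace ℝ (Fin (m + 1))) := by
    rw [finrank_euclideanSpace_fin]
    lia
  have hdim : Module.finrank ℝ (EuclideanSpace ℝ (Fin (m + 1))) =
      Module.finrank ℝ (EuclideanSpace ℝ (Fin m)) + 1 := by
    simp only [finrank_euclideanSpace_fin]
  obtain ⟨Ψ, t₀, t₁, u₀, r, hq₀, hsub, hr, htarget, hΨ, hΨs, hT, hfield, hdual⟩ :=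
    hU.exists_product_coordinates h3 hdim (q₀ := e p) ⟨mem_chart_target _ p, hp⟩
  have hse : Ψ.source ⊆ e.target := fun q hq => (hsub hq).1
  let ψ : OpenPartialHomeomorph M (ℝ × EuclideanSpace ℝ (Fin m)) := e.trans Ψ
  have hψt : ψ.target = Ψ.target := by
    rw [OpenPartialHomeomorph.trans_target]
    exact Set.inter_eq_left.2 fun q hq => hse (Ψ.map_target hq)
  -- The reference slice through `p`, on which `g'` is read off below; by `metric_base_div` every
  -- slice gives the same `g'`.
  let t := (Ψ (e p)).1
  have hq₁ : Ψ (e p) ∈ Set.Ioo t₀ t₁ ×ˢ Metric.ball u₀ r := htarget ▸ Ψ.map_source hq₀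
  have h : IsTchebProductDomain ε (x ∘ ψ.symm) (Set.Ioo t₀ t₁) (Metric.ball u₀ r)
      (α ∘ ψ.symm) (lam ∘ ψ.symm) (μ ∘ ψ.symm) :=
    { htarget ▸ hT with
      isOpen_time := isOpen_Ioo
      convex_time := convex_Ioo t₀ t₁
      isOpen_base := Metric.isOpen_ball
      convex_base := convex_ball u₀ r
      three_le := by
        rw [Module.finrank_prod, finrank_euclideanSpace_fin, Module.finrank_self]
        lia
      field_eq := fun q hq => hfield q (htarget ▸ hq)
      dual_eq := fun q hq => hdual q (htarget ▸ hq) }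
  have hu₀ : u₀ ∈ Metric.ball u₀ r := Metric.mem_ball_self hr
  -- The functions of `t` are the values along the line over the centre `u₀`; the coefficients are
  -- constant on slices.
  let a : ℝ → ℝ := fun t => α (ψ.symm (t, u₀))
  let l : ℝ → ℝ := fun t => lam (ψ.symm (t, u₀))
  let b : ℝ → ℝ := fun t => μ (ψ.symm (t, u₀))
  have ha : ∀ q ∈ Set.Ioo t₀ t₁ ×ˢ Metric.ball u₀ r, α (ψ.symm q) = a q.1 :=
    fun q hq => h.alpha_eq hq.1 hq.2 hu₀
  have hl : ∀ q ∈ Set.Ioo t₀ t₁ ×ˢ Metric.ball u₀ r, lam (ψ.symm q) = l q.1 :=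
    fun q hq => h.lam_eq hq.1 hq.2 hu₀
  have hb : ∀ q ∈ Set.Ioo t₀ t₁ ×ˢ Metric.ball u₀ r, μ (ψ.symm q) = b q.1 :=
    fun q hq => h.mu_eq hq.1 hq.2 hu₀
  have hslice : ∀ k : ℝ × EuclideanSpace ℝ (Fin m) → ℝ,
      (∀ q ∈ Set.Ioo t₀ t₁ ×ˢ Metric.ball u₀ r, ContDiffAt ℝ ∞ k q) →
      ContDiffOn ℝ ∞ (fun t => k (t, u₀)) (Set.Ioo t₀ t₁) := fun k hk t ht =>
    ((hk (t, u₀) ⟨ht, hu₀⟩).comp t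
      (contDiff_id.prodMk contDiff_const).contDiffAt).contDiffWithinAt
  let i := ContinuousLinearMap.inr ℝ ℝ (EuclideanSpace ℝ (Fin m))
  refine ⟨ψ, t₀, t₁, Metric.ball u₀ r,
    fun u => (tchebNormSq ε (x ∘ ψ.symm) (t, u))⁻¹ •
      (caMetric ε (x ∘ ψ.symm) (t, u)).bilinearComp i i, a, l, b, ?_, ?_,
    hslice _ fun _ hq => h.contDiffAt_alpha hq, hslice _ fun _ hq => h.contDiffAt_lam hq,
    hslice _ fun _ hq => h.contDiffAt_mu h.three_le hq, ?_, ?_⟩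
  · rw [OpenPartialHomeomorph.trans_source]
    exact ⟨mem_chart_source _ p, hq₀⟩
  · exact
      { smooth := hΨ.contMDiffOn.comp (contMDiffOn_chart.mono fun q hq => hq.1)
          fun q hq => hq.2
        smooth_symm := contMDiffOn_chart_symm.comp (hΨs.contMDiffOn.mono fun q hq => hq.1)
          fun q hq => hq.2
        isOpen := Metric.isOpen_ball
        isConnected := (convex_ball u₀ r).isConnected ⟨u₀, hu₀⟩
        target_eq := hψt.trans htarget
        field_eq := fun q hq => hfield q (hψt ▸ hq)
        metric_eq := by
          intro q hq s s' v v'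
          rw [hψt, htarget] at hq
          have h1 := h.metric_base_div hq₁.1 hq.1 hq.2 v v'
          have h2 := (h.normSq_pos hq).ne'
          rw [h.metric_prod hq, mul_add]
          congr 1
          change _ = tchebNormSq ε (x ∘ ψ.symm) q *
            ((tchebNormSq ε (x ∘ ψ.symm) (t, q.2))⁻¹ *
              caMetric ε (x ∘ ψ.symm) (t, q.2) (0, v) (0, v'))
          rw [h1, mul_inv_cancel_left₀ h2] }
  · intro q hq
    rw [hψt, htarget] at hq
    exact ⟨ha q hq, hl q hq, hb q hq⟩
  · intro A B Y hA hB hY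
    obtain ⟨φ, ξ, ι, C, hC, hι, hφ, hx', hK⟩ := h.exists_affineHypersphere
      (finrank_euclideanSpace_fin) hq₁ (A := A) (B := B) (Y := Y)
      (fun q hq => by
        simp only [Function.comp_apply, ha q hq, hb q hq]
        exact hA q.1 hq.1)
      (fun q hq => by
        simp only [Function.comp_apply, ha q hq, hb q hq, hl q hq]
        exact hB q.1 hq.1)
      (fun q hq => hY q.1 hq.1)
    refine ⟨φ, ξ, ι, C, hC, hι, hφ, fun q hq => hx' q (htarget ▸ hψt ▸ hq),
      fun q hq v w => ?_⟩
    rw [hψt, htarget] at hq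
    rw [← hb q hq]
    exact hK q hq v w
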